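/- **Setting.** Let $\Omega$ be a non-empty finite set, $H:\Omega\to[1,n]$ a function with $n$ real, $Z(\beta)=\sum_{x\in\Omega}e^{-\beta H(x)}$, and let $\mu_\beta(x)=e^{-\beta H(x)}/Z(\beta)$ be the Gibbs distribution. Fix $\beta_{\min}<\beta_{\max}$ and put $Q=Z(\beta_{\min})/Z(\beta_{\max})$, $q=\ln Q$. An oracle returns, for any $\beta\in[\beta_{\min},\beta_{\max}]$, a fresh independent sample from $\mu_\beta$. *One run of TPA.* Put $\beta_0=\beta_{\min}$. For $i=1,2,\dots$ call the oracle to get $X\sim\mu_{\beta_{i-1}}$, draw $U\in[0,1]$ uniformly, and put $\beta_i=\beta_{i-1}-\ln U/H(X)$; stop at the first $i$ with $\beta_i\notin[\beta_{\min},\beta_{\max}]$ and output the multiset of the earlier values $\beta_1,\dots,\beta_{i-1}$. Let $\mathrm{TPA}(k)$ be the union (with multiplicities) of the outputs of $k$ independent runs. *Schedule.* For integers $k,d\ge1$, sort $\mathrm{TPA}(k)$, draw an index $c$ uniformly from $\{1,\dots,d\}$, keep the values number $c,c+d,c+2d,\dots$, and add $\beta_{\min}$ in front and $\beta_{\max}$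 at the end. Call the result $(\beta_0,\dots,\beta_\ell)$. *Paired product estimator.* Repeat $r\ge1$ times independently: draw $X_i\sim\mu_{\beta_i}$ for $0\le i\le\ell$ (one oracle call each), and compute $$W=\prod_{i<\ell}e^{-\frac{\beta_{i+1}-\beta_i}{2}H(X_i)},\qquad V=\prod_{i<\ell}e^{\frac{\beta_{i+1}-\beta_i}{2}H(X_{i+1})}.$$ Output $\hat Q=\bar V/\bar W$, the quotient of the averages over the $r$ repetitions. *Constants.* For $\varepsilon>0$ let $\tilde\varepsilon=1-(1+\varepsilon)^{-1/2}$. For $0<\rho<1$ let $$\tau_\rho(d)=\min\Bigl\{\tau+\tau^+ :\ \tau\ge0,\ \tau^+>0,\ \frac{\Gamma(d+2,\tau d)}{\tau^+\,d\,d!}\le1-\rho\Bigr\},\qquad \Gamma(a,b)=\int_b^\infty t^{a-1}e^{-t}\,dt .$$ **Theorem.** Let $k,d,r\ge1$ be integers and $m=k/d$. 1. If $\varepsilon>0$ and, for some $\gamma\in(0,\frac14)$ and $\rho=\frac{0.75}{1-\gamma}$, $$m\ \ge\ \frac{\tau_\rho(d)\,\ln n}{2\ln\bigl(1+\frac12\gamma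 r\tilde\varepsilon^2\bigr)},\qquad(*)$$ then $\hat Q\in\bigl(\frac{Q}{1+\varepsilon},\,Q(1+\varepsilon)\bigr)$ with probability at least $0.75$. 2. The expected number of oracle calls is $mq(r+d)+2r+md$. If the $k=md$ calls that end the $k$ TPA runs are counted as a single call (that is, if one counts $N+1+(\ell+1)r$ calls, where $N$ is the number of points of $\mathrm{TPA}(k)$), the expected number is $mq(r+d)+2r+1$. 3. Condition $(*)$ holds whenever $n\ge 1$, $\varepsilon>0$, $d=64$, $m\ge3.6\ln n$ and $r=\lceil2\tilde\varepsilon^{-2}\rceil$. As $\varepsilon\to0^+$, $\tilde\varepsilon=\frac12\varepsilon+O(\varepsilon^2)$ and $\lceil2\tilde\varepsilon^{-2}\rceil=8(1+o(1))\varepsilon^{-2}$. 4. For all constants $q_0>0$, $n_0>1$, $\varepsilon_0>0$, $A>0$ there is a constant $C$, depending only on them, such that whenever $q\ge q_0$, $n\ge n_0$, $0<\varepsilon\le\varepsilon_0$, $d=64$, $3.6\ln n\le m\le A\ln n$ and $r=\lceil2\tilde\varepsilon^{-2}\rceil$, the estimate satisfies $\hat Q\in\bigl(\frac{Q}{1+\varepsilon},Q(1+\varepsilon)\bigr)$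 with probability at least $0.75$ and the expected number of oracle calls is at most $C\,q\ln n\cdot\varepsilon^{-2}$. -/

import Mathlib

open MeasureTheory ProbabilityTheory Filter Topology Asymptotics
open scoped ENNReal unitInterval

namespace GibbsTPA

noncomputable section

/-! ### The Gibbs distribution and its sampling oracles -/

/-- The partition function `Z(β) = ∑ₓ exp(-β H(x))`. -/
def partitionFn {α : Type*} [Fintype α] (H : α → ℝ) (β : ℝ) : ℝ :=
  ∑ x, Real.exp (-β * H x)

/-- The Gibbs distribution `μ_β(x) = exp(-β H(x)) / Z(β)`. -/
def gibbs {α : Type*} [Fintype α] [MeasurableSpace α] (H : α → ℝ) (β : ℝ) : Measure α :=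
  ∑ x, ENNReal.ofReal (Real.exp (-β * H x) / partitionFn H β) • Measure.dirac x

/-- The target `Q = Z(βmin) / Z(βmax)`. -/
def ratio {α : Type*} [Fintype α] (H : α → ℝ) (lo hi : ℝ) : ℝ :=
  partitionFn H lo / partitionFn H hi

/-- `q = ln Q`. -/
def logRatio {α : Type*} [Fintype α] (H : α → ℝ) (lo hi : ℝ) : ℝ :=
  Real.log (ratio H lo hi)

/-- An exact sampling oracle for the Gibbs distributions with parameter in `[lo, hi]`. A call with
parameter `β` consumes a fresh random seed with law `ν` and returns a sample from `μ_β`. -/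
structure IsGibbsOracle {α S : Type*} [Fintype α] [MeasurableSpace α] [MeasurableSpace S]
    (H : α → ℝ) (lo hi : ℝ) (ν : Measure S) (oracle : ℝ → S → α) : Prop where
  measurable : Measurable (fun p : ℝ × S => oracle p.1 p.2)
  map_eq : ∀ β ∈ Set.Icc lo hi, ν.map (oracle β) = gibbs H β

/-! ### The TPA method

The Hamiltonian is positive here, so that a TPA step is almost surely finite. -/

/-- One step from `β`, with sample `x` and uniform variable `u`: the value `β - ln u / H(x)`. -/
def tpaStep {α : Type*} (H : α → ℝ) (β : ℝ) (x : α) (u : ℝ) : ℝ :=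
  β - Real.log u / H x

/-- The successive values `β₀ = βmin, β₁, β₂, …` of one run of TPA. The passage from `β_i` to
`β_{i+1}` makes one oracle call, at `β_i`, with the fresh randomness `ω i`. The values after the
first exit from `[βmin, βmax]` are never used. -/
def tpaPath {α S : Type*} (H : α → ℝ) (oracle : ℝ → S → α) (lo : ℝ) (ω : ℕ → S × I) : ℕ → ℝ
  | 0 => lo
  | i + 1 =>
      tpaStep H (tpaPath H oracle lo ω i) (oracle (tpaPath H oracle lo ω i) (ω i).1) (ω i).2

/-- The indices `i` such that `β_{i+1}` lies outside `[βmin, βmax]`; the least of them is the number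
of points that the run outputs. -/
def tpaExits {α S : Type*} (H : α → ℝ) (oracle : ℝ → S → α) (lo hi : ℝ) (ω : ℕ → S × I) : Set ℕ :=
  {i | tpaPath H oracle lo ω (i + 1) ∉ Set.Icc lo hi}

/-- The output of one run of TPA: the multiset of the values `β₁, …, β_N` before the first exit from
`[βmin, βmax]` (empty by convention in the null event that there is no exit). -/
def tpaOutput {α S : Type*} (H : α → ℝ) (oracle : ℝ → S → α) (lo hi : ℝ) (ω : ℕ → S × I) :
    Multiset ℝ :=
  (Multiset.range (sInf (tpaExits H oracle lo hi ω))).map (fun i => tpaPath H oracle lo ω (i + 1))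

/-- The number of oracle calls made by one run of TPA: one for each of the values `β₁, …, β_N` and
one for the value that leaves the interval; it is infinite if there is no exit. -/
def tpaCalls {α S : Type*} (H : α → ℝ) (oracle : ℝ → S → α) (lo hi : ℝ) (ω : ℕ → S × I) : ℕ∞ :=
  ⨅ i ∈ tpaExits H oracle lo hi ω, ((i + 1 : ℕ) : ℕ∞)

/-- `TPA(k)`: the union, with multiplicities, of the outputs of `k` runs. -/
def tpaUnion {α S : Type*} (H : α → ℝ) (oracle : ℝ → S → α) (lo hi : ℝ) {k : ℕ}
    (ω : Fin k → ℕ → S × I) : Multiset ℝ :=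
  ∑ j, tpaOutput H oracle lo hi (ω j)

/-! ### The schedule -/

/-- The sublist of the entries of `L` whose zero-based indices are `c, c + d, c + 2d, …`
(for `c < d`). -/
def everyNth (d c : ℕ) (L : List ℝ) : List ℝ :=
  ((List.range L.length).filter (fun i => i % d = c)).map (fun i => L.getD i 0)

/-- The schedule `(β₀, …, β_ℓ)`: sort the multiset, keep every `d`-th value starting from the one
with zero-based index `c`, and add the two end points. -/
def schedule (lo hi : ℝ) (d c : ℕ) (B : Multiset ℝ) : List ℝ :=
  lo :: (everyNth d c (B.sort (· ≤ ·)) ++ [hi])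

/-! ### The paired product estimator -/

/-- `W = ∏_{i<ℓ} exp(-(β_{i+1} - β_i)/2 · H(X_i))`, where `s = (β₀, …, β_ℓ)`. -/
def pairedW {α : Type*} (H : α → ℝ) (s : List ℝ) (X : ℕ → α) : ℝ :=
  ∏ i ∈ Finset.range (s.length - 1), Real.exp (-((s.getD (i + 1) 0 - s.getD i 0) / 2) * H (X i))

/-- `V = ∏_{i<ℓ} exp((β_{i+1} - β_i)/2 · H(X_{i+1}))`, where `s = (β₀, …, β_ℓ)`. -/
def pairedV {α : Type*} (H : α → ℝ) (s : List ℝ) (X : ℕ → α) : ℝ :=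
  ∏ i ∈ Finset.range (s.length - 1),
    Real.exp (((s.getD (i + 1) 0 - s.getD i 0) / 2) * H (X (i + 1)))

/-- The estimate `V̄ / W̄` of the paired product estimator with `r` repetitions. In repetition `j`
the sample `X_i ∼ μ_{β_i}` is the oracle's answer at `β_i` with the fresh seed `η j i`, for
`0 ≤ i ≤ ℓ`; the seeds with `i > ℓ` are not used. -/
def pairedEstimate {α S : Type*} (H : α → ℝ) (oracle : ℝ → S → α) (s : List ℝ) {r : ℕ}
    (η : Fin r → ℕ → S) : ℝ :=
  ((∑ j, pairedV H s (fun i => oracle (s.getD i 0) (η j i))) / r) /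
    ((∑ j, pairedW H s (fun i => oracle (s.getD i 0) (η j i))) / r)

/-! ### The whole algorithm -/

/-- The randomness of the algorithm: for each of the `k` TPA runs a sequence of oracle seeds and
numbers in `[0, 1]`; the offset; for each of the `r` repetitions of the estimator a sequence of
oracle seeds. -/
abbrev Randomness (S : Type*) (k d r : ℕ) : Type _ :=
  (Fin k → ℕ → S × I) × Fin d × (Fin r → ℕ → S)

/-- All components are independent: the seeds have law `ν`, the numbers in `[0, 1]` and the offset
are uniform. -/
def law {S : Type*} [MeasurableSpace S] (ν : Measure S) (k d r : ℕ) :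
    Measure (Randomness S k d r) :=
  (Measure.pi fun _ : Fin k => Measure.infinitePi fun _ : ℕ => ν.prod (volume : Measure I)).prod
    ((uniformOn (Set.univ : Set (Fin d))).prod
      (Measure.pi fun _ : Fin r => Measure.infinitePi fun _ : ℕ => ν))

/-- The schedule that the algorithm generates. -/
def algSchedule {α S : Type*} (H : α → ℝ) (oracle : ℝ → S → α) (lo hi : ℝ) {k d r : ℕ}
    (ω : Randomness S k d r) : List ℝ :=
  schedule lo hi d ω.2.1 (tpaUnion H oracle lo hi ω.1)

/-- The estimate that the algorithm returns. -/
def algEstimate {α S : Type*} (H : α → ℝ) (oracle : ℝ → S → α) (lo hi : ℝ) {k d r : ℕ}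
    (ω : Randomness S k d r) : ℝ :=
  pairedEstimate H oracle (algSchedule H oracle lo hi ω) ω.2.2

/-- The number of oracle calls of the algorithm: those of the `k` TPA runs, and `r (ℓ + 1)` calls
of the paired product estimator. -/
def algCalls {α S : Type*} (H : α → ℝ) (oracle : ℝ → S → α) (lo hi : ℝ) {k d r : ℕ}
    (ω : Randomness S k d r) : ℝ≥0∞ :=
  (∑ j, ((tpaCalls H oracle lo hi (ω.1 j) : ℕ∞) : ℝ≥0∞)) +
    (((algSchedule H oracle lo hi ω).length * r : ℕ) : ℝ≥0∞)

/-- The number of oracle calls when the `k` calls that end the `k` TPA runs are counted as a single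
call: `N + 1 + (ℓ + 1) r`, where `N` is the number of points of `TPA(k)`. -/
def algCallsMerged {α S : Type*} (H : α → ℝ) (oracle : ℝ → S → α) (lo hi : ℝ) {k d r : ℕ}
    (ω : Randomness S k d r) : ℝ≥0∞ :=
  (((tpaUnion H oracle lo hi ω.1).card + 1 + (algSchedule H oracle lo hi ω).length * r : ℕ) : ℝ≥0∞)

/-! ### The constants of the bound -/

/-- The upper incomplete gamma function `Γ(a, b) = ∫_b^∞ t^(a-1) e^(-t) dt`. -/
def upperGamma (a b : ℝ) : ℝ := ∫ t in Set.Ioi b, t ^ (a - 1) * Real.exp (-t)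

/-- `τ_ρ(d)`: the least value of `τ + τ⁺` over `τ ≥ 0`, `τ⁺ > 0` with
`Γ(d + 2, τ d) / (τ⁺ · d · d!) ≤ 1 - ρ`. -/
def tauRho (ρ : ℝ) (d : ℕ) : ℝ :=
  sInf {t : ℝ | ∃ τ τp : ℝ, 0 ≤ τ ∧ 0 < τp ∧
    upperGamma (d + 2) (τ * d) / (τp * d * (d.factorial : ℝ)) ≤ 1 - ρ ∧ t = τ + τp}

/-- `ε̃ = 1 - (1 + ε)^(-1/2)`. -/
def epsTilde (ε : ℝ) : ℝ := 1 - (1 + ε) ^ (-(1 / 2) : ℝ)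

/-- The condition
`m ≥ τ_ρ(d) ln n / (2 ln(1 + γ r ε̃² / 2))` for some `γ ∈ (0, 1/4)` and `ρ = 0.75 / (1 - γ)`. -/
def ParamCondition (n ε m : ℝ) (d r : ℕ) : Prop :=
  ∃ γ ∈ Set.Ioo (0 : ℝ) (1 / 4),
    tauRho ((3 / 4) / (1 - γ)) d * Real.log n /
      (2 * Real.log (1 + (1 / 2) * γ * r * epsTilde ε ^ 2)) ≤ m

/-- The estimate lies in `(Q / (1 + ε), Q (1 + ε))` with probability at least `3/4`. -/
def Succeeds {α S : Type*} [Fintype α] [MeasurableSpace S] (H : α → ℝ) (lo hi : ℝ) (ν : Measure S)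
    (oracle : ℝ → S → α) (k d r : ℕ) (ε : ℝ) : Prop :=
  ENNReal.ofReal (3 / 4) ≤ law ν k d r
    {ω | algEstimate H oracle lo hi ω ∈
      Set.Ioo (ratio H lo hi / (1 + ε)) (ratio H lo hi * (1 + ε))}

end

end GibbsTPA

set_option linter.unusedSectionVars false

/-! Work in the coordinate z(β) = ln Z(lo) - ln Z(β) (`freeDiff`), which is increasing and concave,
with derivative the mean energy in [1, n]. A TPA step multiplies Z by a uniform variable
(`map_partitionFn_tpaStep`), so it moves z by an exponential variable of mean one. The points of
`TPA(k)` therefore behave like a Poisson process of rate k on [0, q]. Only the law of the number of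
points in one interval is needed (`map_unionVisits`). It comes from characteristic functions: the
true one and the Poisson candidate satisfy the same first-step equation, and bounded solutions are
unique because each step leaves [lo, hi] with probability bounded below
(`eq_zero_of_le_lintegral_tpaStep`). The mean number of calls follows, because the offset keeps on
average one point in d.

For a fixed schedule, the means of V and W have quotient Q by telescoping, and both have relative
second moment exp(κ), where κ (`curvature`) is a sum of second differences of z. Chebyshev's
inequality for each of the two averages gives accuracy with probability at least 1 - γ once exp(κ) ≤
1 + γ r ε̃² / 2 (`le_measure_pairedEstimate_mem`).

It remains to bound κ. By concavity, an interval of z-length δ on which ln z' drops by w contributes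
at most δ w / 2 (`secondDifference_le`). The drops add up to at most ln n, so κ ≤ (θ ln n + excess)
/ 2, where `excess` is the sum of (δ - θ)⁺ w (`curvature_le`). The excess is an integral over pairs
(t, x): the pair counts if a single schedule interval contains t and, in the coordinate z, the
segment [x, x + θ]. Then no kept point lies strictly inside the span of t and that segment. If the
span contains N points of `TPA(k)`, at most (d - N)⁺ of the d offsets allow this
(`card_offsets_avoiding_le`). Averaging over N and integrating over x gives an incomplete gamma
function (`lintegral_poissonDeficit_le`), and integrating over t gives a factor at most ln n. With θ
= τ / m, Markov's inequality makes the excess at most τ⁺ ln n / m with probability at least ρ. The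
success probability is then at least ρ (1 - γ) = 3/4. -/

namespace GibbsTPA

/-! ### The partition function -/

section Partition

variable {α : Type*} [Fintype α]

/-- The mean of `H` under the Gibbs distribution, which is minus the logarithmic derivative of the
partition function. -/
noncomputable def meanEnergy (H : α → ℝ) (β : ℝ) : ℝ :=
  (∑ x, H x * Real.exp (-β * H x)) / partitionFn H β

/-- The free energy difference `ln Z(lo) - ln Z(β)`. -/
noncomputable def freeDiff (H : α → ℝ) (lo β : ℝ) : ℝ :=
  Real.log (partitionFn H lo) - Real.log (partitionFn H β)

theorem partitionFn_pos [Nonempty α] (H : α → ℝ) (β : ℝ) : 0 < partitionFn H β :=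
  Finset.sum_pos (fun _ _ => Real.exp_pos _) Finset.univ_nonempty

theorem continuous_partitionFn (H : α → ℝ) : Continuous (partitionFn H) := by
  unfold partitionFn
  fun_prop

theorem strictAnti_partitionFn [Nonempty α] {H : α → ℝ} (hH : ∀ x, 0 < H x) :
    StrictAnti (partitionFn H) := fun a b hab =>
  Finset.sum_lt_sum_of_nonempty Finset.univ_nonempty fun x _ =>
    Real.exp_lt_exp.2 (by nlinarith [hH x])

/-- The lower bound on `H` forces exponential decay. This locates, in an explicit interval, the
parameter at which the partition function has dropped by a given factor. -/
theorem partitionFn_le_mul_exp {H : α → ℝ} (hH : ∀ x, 1 ≤ H x) {a b : ℝ} (hab : a ≤ b) :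
    partitionFn H b ≤ partitionFn H a * Real.exp (-(b - a)) := by
  unfold partitionFn
  rw [Finset.sum_mul]
  refine Finset.sum_le_sum fun x _ => ?_
  rw [← Real.exp_add]
  exact Real.exp_le_exp.2 (by nlinarith [hH x])

theorem partitionFn_eq_sum_mul_exp (H : α → ℝ) (a b : ℝ) :
    partitionFn H b = ∑ x, Real.exp (-a * H x) * Real.exp (-(b - a) * H x) := by
  unfold partitionFn
  refine Finset.sum_congr rfl fun x _ => ?_
  rw [← Real.exp_add]
  ring_nf

theorem continuous_freeDiff [Nonempty α] (H : α → ℝ) (lo : ℝ) : Continuous (freeDiff H lo) :=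
  continuous_const.sub
    ((continuous_partitionFn H).log fun β => (partitionFn_pos H β).ne')

theorem strictMono_freeDiff [Nonempty α] {H : α → ℝ} (hH : ∀ x, 0 < H x) (lo : ℝ) :
    StrictMono (freeDiff H lo) := fun _ _ hab =>
  sub_lt_sub_left (Real.log_lt_log (partitionFn_pos H _) (strictAnti_partitionFn hH hab)) _

@[simp] theorem freeDiff_self (H : α → ℝ) (lo : ℝ) : freeDiff H lo lo = 0 := sub_self _

theorem freeDiff_eq_logRatio [Nonempty α] (H : α → ℝ) (lo hi : ℝ) :
    freeDiff H lo hi = logRatio H lo hi := by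
  rw [freeDiff, logRatio, ratio, Real.log_div (partitionFn_pos H _).ne' (partitionFn_pos H _).ne']

theorem freeDiff_sub [Nonempty α] (H : α → ℝ) (lo a b : ℝ) :
    freeDiff H lo b - freeDiff H lo a = -Real.log (partitionFn H b / partitionFn H a) := by
  rw [freeDiff, freeDiff,
    Real.log_div (partitionFn_pos H _).ne' (partitionFn_pos H _).ne']
  ring

theorem continuous_meanEnergy [Nonempty α] (H : α → ℝ) : Continuous (meanEnergy H) :=
  Continuous.div (by fun_prop) (continuous_partitionFn H) fun β => (partitionFn_pos H β).ne'

theorem meanEnergy_mem_Icc [Nonempty α] {H : α → ℝ} {n : ℝ} (hH : ∀ x, H x ∈ Set.Icc 1 n) (β : ℝ) :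
    meanEnergy H β ∈ Set.Icc 1 n := by
  have hZ := partitionFn_pos H β
  rw [meanEnergy, Set.mem_Icc, le_div_iff₀ hZ, div_le_iff₀ hZ, partitionFn, Finset.mul_sum,
    Finset.mul_sum]
  exact ⟨Finset.sum_le_sum fun x _ => mul_le_mul_of_nonneg_right (hH x).1 (Real.exp_pos _).le,
    Finset.sum_le_sum fun x _ => mul_le_mul_of_nonneg_right (hH x).2 (Real.exp_pos _).le⟩

/-- The free energy lies below its tangents. -/
theorem freeDiff_sub_le_mul_meanEnergy [Nonempty α] (H : α → ℝ) (lo a b : ℝ) :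
    freeDiff H lo b - freeDiff H lo a ≤ (b - a) * meanEnergy H a := by
  have hZ := partitionFn_pos H a
  -- Jensen's inequality for the exponential under the Gibbs law at `a`. It follows from `1 + u ≤
  -- e^u` with `u` centred at the mean energy, so that the linear terms cancel in the sum.
  have key : Real.exp (-((b - a) * meanEnergy H a)) ≤ partitionFn H b / partitionFn H a := by
    rw [le_div_iff₀ hZ, partitionFn_eq_sum_mul_exp H a b]
    have h1 : ∀ x ∈ Finset.univ, Real.exp (-((b - a) * meanEnergy H a)) * (Real.exp (-a * H x) *
        (1 - (b - a) * (H x - meanEnergy H a))) ≤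
        Real.exp (-a * H x) * Real.exp (-(b - a) * H x) := fun x _ => by
      have h2 := Real.add_one_le_exp (-((b - a) * (H x - meanEnergy H a)))
      have h3 : Real.exp (-(b - a) * H x) = Real.exp (-((b - a) * meanEnergy H a)) *
          Real.exp (-((b - a) * (H x - meanEnergy H a))) := by
        rw [← Real.exp_add]; ring_nf
      rw [h3, mul_left_comm]
      gcongr
      linarith
    refine le_trans (le_of_eq ?_) (Finset.sum_le_sum h1)
    rw [← Finset.mul_sum]
    congr 1
    have h4 : ∑ x, Real.exp (-a * H x) * (1 - (b - a) * (H x - meanEnergy H a)) =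
        partitionFn H a * (1 + (b - a) * meanEnergy H a) -
          (b - a) * ∑ x, H x * Real.exp (-a * H x) := by
      rw [partitionFn, Finset.sum_mul, Finset.mul_sum, ← Finset.sum_sub_distrib]
      exact Finset.sum_congr rfl fun x _ => by ring
    have h5 : ∑ x, H x * Real.exp (-a * H x) = meanEnergy H a * partitionFn H a := by
      rw [meanEnergy, div_mul_cancel₀ _ hZ.ne']
    rw [h4, h5]; ring
  rw [freeDiff_sub]
  have := (Real.le_log_iff_exp_le (div_pos (partitionFn_pos H b) hZ)).2 key
  linarith

/-- Adding the tangent inequalities at `a` and at `b` gives concavity without a second derivative.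
-/
theorem antitone_meanEnergy [Nonempty α] (H : α → ℝ) : Antitone (meanEnergy H) := by
  intro a b hab
  rcases hab.eq_or_lt with rfl | hab
  · exact le_rfl
  have h1 := freeDiff_sub_le_mul_meanEnergy H 0 a b
  have h2 := freeDiff_sub_le_mul_meanEnergy H 0 b a
  nlinarith

end Partition

/-! ### One step of TPA -/

section Step

theorem le_tpaStep {α : Type*} {H : α → ℝ} (hH : ∀ x, 0 < H x) (β : ℝ) (x : α) (u : I) :
    β ≤ tpaStep H β x u := by
  have h1 := Real.log_nonpos u.2.1 u.2.2
  have h2 := div_nonpos_of_nonpos_of_nonneg h1 (hH x).le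
  rw [tpaStep]
  linarith

theorem volume_unitInterval_image (s : Set I) : volume s = volume (Subtype.val '' s : Set ℝ) :=
  comap_subtype_coe_apply measurableSet_Icc _ _

variable {α : Type*} [Fintype α] [MeasurableSpace α]

theorem lintegral_gibbs [MeasurableSingletonClass α] (H : α → ℝ) (β : ℝ) (f : α → ℝ≥0∞) :
    ∫⁻ x, f x ∂(gibbs H β) =
      ∑ x, ENNReal.ofReal (Real.exp (-β * H x) / partitionFn H β) * f x := by
  rw [gibbs, lintegral_finsetSum_measure]
  simp

theorem isProbabilityMeasure_gibbs [Nonempty α] [MeasurableSingletonClass α] (H : α → ℝ) (β : ℝ) :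
    IsProbabilityMeasure (gibbs H β) := by
  constructor
  rw [← lintegral_one, lintegral_gibbs]
  simp only [mul_one]
  rw [← ENNReal.ofReal_sum_of_nonneg fun x _ =>
    div_nonneg (Real.exp_pos _).le (partitionFn_pos H β).le, ← Finset.sum_div]
  change ENNReal.ofReal (partitionFn H β / partitionFn H β) = 1
  rw [div_self (partitionFn_pos H β).ne', ENNReal.ofReal_one]

theorem integral_gibbs [Nonempty α] [MeasurableSingletonClass α] (H : α → ℝ) (β : ℝ) (f : α → ℝ) :
    ∫ x, f x ∂(gibbs H β) = (∑ x, Real.exp (-β * H x) * f x) / partitionFn H β := by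
  have hZ := partitionFn_pos H β
  rw [gibbs, integral_finsetSum_measure]
  · simp only [integral_smul_measure, integral_dirac, smul_eq_mul]
    rw [Finset.sum_div]
    refine Finset.sum_congr rfl fun x _ => ?_
    rw [ENNReal.toReal_ofReal (div_nonneg (Real.exp_pos _).le hZ.le)]
    ring
  · exact fun x _ => (integrable_dirac (by simp)).smul_measure ENNReal.ofReal_ne_top

/-- After a step from `b`, the partition function is uniformly distributed in `[0, Z(b)]`. -/
theorem map_partitionFn_tpaStep [Nonempty α] [MeasurableSingletonClass α] {S : Type*}
    [MeasurableSpace S] {ν : Measure S} [IsProbabilityMeasure ν] {H : α → ℝ} {lo hi b : ℝ}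
    {oracle : ℝ → S → α} (hH : ∀ x, 1 ≤ H x) (ho : IsGibbsOracle H lo hi ν oracle)
    (hb : b ∈ Set.Icc lo hi) :
    (ν.prod (volume : Measure I)).map
      (fun p => partitionFn H (tpaStep H b (oracle b p.1) p.2) / partitionFn H b) =
      volume.restrict (Set.Icc 0 1) := by
  have hH0 : ∀ x, 0 < H x := fun x => one_pos.trans_le (hH x)
  have hZ := partitionFn_pos H b
  have := isProbabilityMeasure_gibbs H b
  have hob : Measurable (oracle b) := ho.measurable.comp measurable_prodMk_left
  have hstep : Measurable fun p : α × I => partitionFn H (tpaStep H b p.1 p.2) / partitionFn H b := by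
    refine ((continuous_partitionFn H).measurable.comp ?_).div_const _
    exact measurable_const.sub ((Real.measurable_log.comp
      (measurable_subtype_coe.comp measurable_snd)).div ((measurable_of_finite H).comp
        measurable_fst))
  have h1 : (ν.prod (volume : Measure I)).map
      (fun p => partitionFn H (tpaStep H b (oracle b p.1) p.2) / partitionFn H b) =
      ((gibbs H b).prod (volume : Measure I)).map
        (fun p => partitionFn H (tpaStep H b p.1 p.2) / partitionFn H b) := by
    rw [← ho.map_eq b hb]
    conv_rhs => rw [← Measure.map_id (μ := (volume : Measure I))]
    rw [Measure.map_prod_map _ _ hob measurable_id, Measure.map_map hstep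
      (hob.prodMap measurable_id)]
    rfl
  rw [h1]
  have : IsProbabilityMeasure (((gibbs H b).prod (volume : Measure I)).map
      (fun p => partitionFn H (tpaStep H b p.1 p.2) / partitionFn H b)) :=
    Measure.isProbabilityMeasure_map hstep.aemeasurable
  refine Measure.ext_of_Iic _ _ fun w => ?_
  rw [Measure.restrict_apply measurableSet_Iic]
  rcases le_or_gt w 0 with hw | hw
  · rw [Measure.map_apply hstep measurableSet_Iic]
    have e1 : (fun p : α × I => partitionFn H (tpaStep H b p.1 p.2) / partitionFn H b) ⁻¹'
        Set.Iic w = ∅ := by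
      refine Set.eq_empty_of_forall_notMem fun p hp => ?_
      have := div_pos (partitionFn_pos H (tpaStep H b p.1 p.2)) hZ
      exact not_le.2 (hw.trans_lt this) hp
    rw [e1, measure_empty]
    refine (measure_mono_null (t := {0}) ?_ (by simp)).symm
    rintro y ⟨hy1, hy2, -⟩
    exact le_antisymm (le_trans hy1 hw) hy2
  rcases le_or_gt 1 w with hw1 | hw1
  · rw [Measure.map_apply hstep measurableSet_Iic]
    have e1 : (fun p : α × I => partitionFn H (tpaStep H b p.1 p.2) / partitionFn H b) ⁻¹'
        Set.Iic w = Set.univ := by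
      refine Set.eq_univ_of_forall fun p => ?_
      refine le_trans ((div_le_one hZ).2 ?_) hw1
      exact (strictAnti_partitionFn hH0).antitone (le_tpaStep hH0 _ _ _)
    have e2 : Set.Iic w ∩ Set.Icc (0 : ℝ) 1 = Set.Icc 0 1 :=
      Set.inter_eq_right.2 fun y hy => le_trans hy.2 hw1
    rw [e1, e2]
    simp
  -- For 0 < w < 1 the event is that the step reaches `c`, the parameter with Z(c) = w Z(b). Given
  -- the sample x it reads u ≤ exp(-(c - b) H(x)), and the Gibbs average of this bound is Z(c) /
  -- Z(b) = w.
  obtain ⟨c, hc, hcw⟩ : ∃ c ∈ Set.Icc b (b - Real.log w), partitionFn H c = w * partitionFn H b := by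
    have hl := Real.log_neg hw hw1
    refine intermediate_value_Icc' (by linarith) (continuous_partitionFn H).continuousOn ⟨?_, ?_⟩
    · refine (partitionFn_le_mul_exp hH (by linarith)).trans (le_of_eq ?_)
      rw [show -(b - Real.log w - b) = Real.log w by ring, Real.exp_log hw, mul_comm]
    · nlinarith
  have hbc : b < c := by
    rcases hc.1.eq_or_lt with h | h
    · rw [← h] at hcw
      nlinarith
    · exact h
  have e2 : Set.Iic w ∩ Set.Icc (0 : ℝ) 1 = Set.Icc 0 w := by
    ext y
    simp only [Set.mem_inter_iff, Set.mem_Iic, Set.mem_Icc]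
    constructor
    · rintro ⟨h, h', -⟩; exact ⟨h', h⟩
    · rintro ⟨h, h'⟩; exact ⟨h', h, by linarith⟩
  rw [Measure.map_apply hstep measurableSet_Iic, Measure.prod_apply (hstep measurableSet_Iic),
    lintegral_gibbs, e2, Real.volume_Icc, sub_zero]
  have e3 : ∀ x, volume (Prod.mk x ⁻¹' ((fun p : α × I =>
      partitionFn H (tpaStep H b p.1 p.2) / partitionFn H b) ⁻¹' Set.Iic w)) =
      ENNReal.ofReal (Real.exp (-(c - b) * H x)) := by
    intro x
    have hexp1 : Real.exp (-(c - b) * H x) ≤ 1 :=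
      Real.exp_le_one_iff.2 (by nlinarith [hH0 x])
    rw [volume_unitInterval_image, ← sub_zero (Real.exp (-(c - b) * H x)), ← Real.volume_Ioc]
    congr 1
    ext y
    simp only [Set.mem_image, Set.mem_preimage, Set.mem_Iic, Set.mem_Ioc, Subtype.exists,
      exists_and_right, exists_eq_right]
    have key : ∀ y : ℝ, 0 < y →
        (partitionFn H (tpaStep H b x y) / partitionFn H b ≤ w ↔ y ≤ Real.exp (-(c - b) * H x)) := by
      intro y hy
      rw [div_le_iff₀ hZ, ← hcw, (strictAnti_partitionFn hH0).le_iff_ge, tpaStep,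
        ← Real.log_le_iff_le_exp hy, le_sub_comm, div_le_iff₀ (hH0 x)]
      constructor <;> intro h <;> linarith
    constructor
    · rintro ⟨hy, h⟩
      -- At u = 0 the convention `Real.log 0 = 0` makes the step stay at `b`. The quotient is then 1
      -- > w, so this point is outside the event.
      rcases hy.1.eq_or_lt with h0 | h0
      · exfalso
        rw [← h0] at h
        simp only [tpaStep, Real.log_zero, zero_div, sub_zero, div_self hZ.ne'] at h
        linarith
      · exact ⟨h0, (key y h0).1 h⟩
    · rintro ⟨h0, h⟩
      exact ⟨⟨h0.le, h.trans hexp1⟩, (key y h0).2 h⟩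
  simp only [e3]
  simp_rw [← ENNReal.ofReal_mul (div_nonneg (Real.exp_pos _).le hZ.le)]
  rw [← ENNReal.ofReal_sum_of_nonneg fun x _ => by positivity]
  congr 1
  have e4 := partitionFn_eq_sum_mul_exp H b c
  rw [hcw] at e4
  rw [← mul_div_cancel_right₀ w hZ.ne', e4, Finset.sum_div]
  exact Finset.sum_congr rfl fun x _ => by ring

end Step

/-! ### Sequences of independent variables: head and tail -/

section HeadTail

variable {X : Type*} [MeasurableSpace X]

/-- Prepending an independent copy to an i.i.d. sequence gives an i.i.d. sequence, as is seen on
cylinder sets. The inverse map splits off the first step of a run. -/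
theorem map_natCases_prod_infinitePi (μ : Measure X) [IsProbabilityMeasure μ] :
    (μ.prod (Measure.infinitePi fun _ : ℕ => μ)).map
      (fun p : X × (ℕ → X) => fun i : ℕ => Nat.casesOn i p.1 p.2) =
      Measure.infinitePi fun _ : ℕ => μ := by
  classical
  have hmeas : Measurable (fun p : X × (ℕ → X) => fun i : ℕ =>
      (Nat.casesOn i p.1 p.2 : X)) := by
    refine measurable_pi_iff.2 fun i => ?_
    cases i with
    | zero => exact measurable_fst
    | succ i => exact (measurable_pi_apply i).comp measurable_snd
  refine Measure.eq_infinitePi _ fun s t ht => ?_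
  -- Padding with `univ` replaces the index set by an initial segment, on which the shift acts
  -- simply.
  set t' : ℕ → Set X := fun i => if i ∈ s then t i else Set.univ with ht'
  have ht'm : ∀ i, MeasurableSet (t' i) := fun i => by
    simp only [ht']
    split_ifs
    · exact ht i
    · exact MeasurableSet.univ
  obtain ⟨N, hN⟩ : ∃ N, s ⊆ Finset.range (N + 1) := by
    refine ⟨s.sup id, fun i hi => Finset.mem_range.2 (Nat.lt_succ_of_le ?_)⟩
    exact Finset.le_sup (f := id) hi
  have e1 : (Set.pi (s : Set ℕ) t) = Set.pi (Finset.range (N + 1) : Set ℕ) t' := by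
    ext x
    simp only [Set.mem_pi, Finset.mem_coe, ht']
    constructor
    · intro h i _
      split_ifs with his
      · exact h i his
      · trivial
    · intro h i hi
      have := h i (hN hi)
      rwa [if_pos hi] at this
  have e2 : (fun p : X × (ℕ → X) => fun i : ℕ => (Nat.casesOn i p.1 p.2 : X)) ⁻¹'
      Set.pi (Finset.range (N + 1) : Set ℕ) t' =
      t' 0 ×ˢ Set.pi (Finset.range N : Set ℕ) fun i => t' (i + 1) := by
    ext p
    simp only [Set.mem_preimage, Set.mem_pi, Finset.coe_range, Set.mem_Iio, Set.mem_prod]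
    constructor
    · intro h
      exact ⟨h 0 (Nat.succ_pos _), fun i hi => h (i + 1) (Nat.succ_lt_succ hi)⟩
    · rintro ⟨h0, h⟩ i hi
      cases i with
      | zero => exact h0
      | succ i => exact h i (Nat.lt_of_succ_lt_succ hi)
  have e3 : ∏ i ∈ s, μ (t i) = ∏ i ∈ Finset.range (N + 1), μ (t' i) := by
    rw [← Finset.prod_subset hN]
    · exact Finset.prod_congr rfl fun i hi => by simp only [ht', if_pos hi]
    · intro i _ hi
      simp only [ht', if_neg hi, measure_univ]
  rw [Measure.map_apply hmeas (MeasurableSet.pi (Finset.countable_toSet _) fun i _ => ht i), e1, e2,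
    Measure.prod_prod, Measure.infinitePi_pi _ fun i _ => ht'm _, e3, Finset.prod_range_succ',
    mul_comm]

theorem map_head_tail_infinitePi (μ : Measure X) [IsProbabilityMeasure μ] :
    (Measure.infinitePi fun _ : ℕ => μ).map (fun ω => (ω 0, fun i => ω (i + 1))) =
      μ.prod (Measure.infinitePi fun _ : ℕ => μ) := by
  have hmeas : Measurable (fun p : X × (ℕ → X) => fun i : ℕ =>
      (Nat.casesOn i p.1 p.2 : X)) := by
    refine measurable_pi_iff.2 fun i => ?_
    cases i with
    | zero => exact measurable_fst
    | succ i => exact (measurable_pi_apply i).comp measurable_snd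
  conv_lhs => rw [← map_natCases_prod_infinitePi μ]
  rw [Measure.map_map (by fun_prop) hmeas]
  exact Measure.map_id

theorem measurePreserving_head_tail (μ : Measure X) [IsProbabilityMeasure μ] :
    MeasurePreserving (fun ω : ℕ → X => (ω 0, fun i => ω (i + 1)))
      (Measure.infinitePi fun _ : ℕ => μ) (μ.prod (Measure.infinitePi fun _ : ℕ => μ)) :=
  ⟨by fun_prop, map_head_tail_infinitePi μ⟩

end HeadTail

/-! ### Paths of TPA -/

section Path

variable {α S : Type*}

/-- The definition unrolls a path at its last step. First-step analysis needs it unrolled at the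
first one. -/
theorem tpaPath_succ_eq_tpaPath_tail (H : α → ℝ) (oracle : ℝ → S → α) (b : ℝ) (ω : ℕ → S × I)
    (i : ℕ) : tpaPath H oracle b ω (i + 1) =
      tpaPath H oracle (tpaStep H b (oracle b (ω 0).1) (ω 0).2) (fun i => ω (i + 1)) i := by
  induction i with
  | zero => rfl
  | succ i ih => rw [tpaPath, ih]; rfl

theorem monotone_tpaPath {H : α → ℝ} (hH : ∀ x, 0 < H x) (oracle : ℝ → S → α) (b : ℝ)
    (ω : ℕ → S × I) : Monotone (tpaPath H oracle b ω) :=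
  monotone_nat_of_le_succ fun _ => le_tpaStep hH _ _ _

theorem le_tpaPath {H : α → ℝ} (hH : ∀ x, 0 < H x) (oracle : ℝ → S → α) (b : ℝ)
    (ω : ℕ → S × I) (i : ℕ) : b ≤ tpaPath H oracle b ω i :=
  monotone_tpaPath hH oracle b ω (Nat.zero_le i)

/-- The number of visits of the path (after its start) to the set `B`. -/
noncomputable def visits (H : α → ℝ) (oracle : ℝ → S → α) (B : Set ℝ) (b : ℝ) (ω : ℕ → S × I) :
    ℝ≥0∞ := ∑' i, B.indicator 1 (tpaPath H oracle b ω (i + 1))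

theorem visits_eq_add_visits_tail (H : α → ℝ) (oracle : ℝ → S → α) (B : Set ℝ) (b : ℝ)
    (ω : ℕ → S × I) : visits H oracle B b ω =
      B.indicator 1 (tpaStep H b (oracle b (ω 0).1) (ω 0).2) +
        visits H oracle B (tpaStep H b (oracle b (ω 0).1) (ω 0).2) (fun i => ω (i + 1)) := by
  rw [visits, tsum_eq_zero_add' ENNReal.summable]
  congr 1
  exact tsum_congr fun i => by rw [tpaPath_succ_eq_tpaPath_tail]

theorem visits_eq_zero {H : α → ℝ} (hH : ∀ x, 0 < H x) (oracle : ℝ → S → α) {B : Set ℝ} {b hi : ℝ}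
    (hB : B ⊆ Set.Iic hi) (hb : hi < b) (ω : ℕ → S × I) : visits H oracle B b ω = 0 :=
  ENNReal.tsum_eq_zero.2 fun i => Set.indicator_of_notMem
    (fun h => not_le.2 (hb.trans_le (le_tpaPath hH oracle b ω (i + 1))) (hB h)) _

variable [Fintype α] [MeasurableSpace α] [MeasurableSingletonClass α] [MeasurableSpace S]

theorem measurable_uncurry_tpaStep {oracle : ℝ → S → α} (H : α → ℝ)
    (ho : Measurable fun p : ℝ × S => oracle p.1 p.2) :
    Measurable fun p : ℝ × S × I => tpaStep H p.1 (oracle p.1 p.2.1) p.2.2 := by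
  refine measurable_fst.sub (Measurable.div ?_ ?_)
  · exact Real.measurable_log.comp (measurable_subtype_coe.comp (measurable_snd.comp measurable_snd))
  · exact (measurable_of_finite H).comp
      (ho.comp (measurable_fst.prodMk (measurable_fst.comp measurable_snd)))

theorem measurable_uncurry_tpaPath {oracle : ℝ → S → α} (H : α → ℝ)
    (ho : Measurable fun p : ℝ × S => oracle p.1 p.2) (i : ℕ) :
    Measurable fun p : ℝ × (ℕ → S × I) => tpaPath H oracle p.1 p.2 i := by
  induction i with
  | zero => exact measurable_fst
  | succ i ih =>
    exact (measurable_uncurry_tpaStep H ho).comp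
      (ih.prodMk ((measurable_pi_apply i).comp measurable_snd))

theorem measurable_uncurry_visits {oracle : ℝ → S → α} (H : α → ℝ)
    (ho : Measurable fun p : ℝ × S => oracle p.1 p.2) {B : Set ℝ} (hB : MeasurableSet B) :
    Measurable fun p : ℝ × (ℕ → S × I) => visits H oracle B p.1 p.2 :=
  Measurable.tsum fun i =>
    (measurable_one.indicator hB).comp (measurable_uncurry_tpaPath H ho (i + 1))

variable [Nonempty α] {ν : Measure S} [IsProbabilityMeasure ν] {H : α → ℝ} {lo hi : ℝ}
  {oracle : ℝ → S → α}

/-- A bounded function that vanishes above `hi` and that is at most its mean after one TPA step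
vanishes. -/
theorem eq_zero_of_le_lintegral_tpaStep (hH : ∀ x, 1 ≤ H x) (ho : IsGibbsOracle H lo hi ν oracle)
    {Φ : ℝ → ℝ≥0∞} {C : ℝ≥0∞} (hC : C ≠ ∞) (hΦC : ∀ b, Φ b ≤ C) (hΦ0 : ∀ b, hi < b → Φ b = 0)
    (hrec : ∀ b ∈ Set.Icc lo hi,
      Φ b ≤ ∫⁻ p, Φ (tpaStep H b (oracle b p.1) p.2) ∂(ν.prod (volume : Measure I)))
    {b : ℝ} (hb : b ∈ Set.Icc lo hi) : Φ b = 0 := by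
  have hH0 : ∀ x, 0 < H x := fun x => one_pos.trans_le (hH x)
  -- The quotient of partition functions is uniform, so a step from `b` stays below `hi` with
  -- probability 1 - Z(hi) / Z(b), which is largest at `b = lo`. Iterating the hypothesis gives Φ ≤
  -- C r^m for every m.
  set r : ℝ≥0∞ := ENNReal.ofReal (1 - partitionFn H hi / partitionFn H lo) with hr
  have hr1 : r < 1 := by
    rw [hr, ENNReal.ofReal_lt_one]
    have := div_pos (partitionFn_pos H hi) (partitionFn_pos H lo)
    linarith
  have hprob : ∀ b ∈ Set.Icc lo hi, (ν.prod (volume : Measure I))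
      {p | tpaStep H b (oracle b p.1) p.2 ≤ hi} ≤ r := by
    intro b hb
    have hm : Measurable fun p : S × I =>
        partitionFn H (tpaStep H b (oracle b p.1) p.2) / partitionFn H b :=
      ((continuous_partitionFn H).measurable.comp
        ((measurable_uncurry_tpaStep H ho.measurable).comp measurable_prodMk_left)).div_const _
    have h1 := map_partitionFn_tpaStep hH ho hb
    have h2 := congrFun (congrArg DFunLike.coe h1) (Set.Ici (partitionFn H hi / partitionFn H b))
    rw [Measure.map_apply hm measurableSet_Ici, Measure.restrict_apply measurableSet_Ici] at h2
    calc _ ≤ _ := measure_mono fun p hp => ?_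
      _ = _ := h2
      _ ≤ volume (Set.Icc (partitionFn H hi / partitionFn H b) 1) :=
        measure_mono fun y hy => ⟨hy.1, hy.2.2⟩
      _ ≤ r := ?_
    · exact div_le_div_of_nonneg_right
        ((strictAnti_partitionFn hH0).antitone hp) (partitionFn_pos H b).le
    · rw [Real.volume_Icc, hr]
      refine ENNReal.ofReal_le_ofReal (sub_le_sub_left ?_ _)
      exact div_le_div_of_nonneg_left (partitionFn_pos H hi).le (partitionFn_pos H b)
        ((strictAnti_partitionFn hH0).antitone hb.1)
  have hpow : ∀ m : ℕ, ∀ b ∈ Set.Icc lo hi, Φ b ≤ C * r ^ m := by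
    intro m
    induction m with
    | zero => intro b _; simpa using hΦC b
    | succ m ih =>
      intro b hb
      have hms : MeasurableSet {p : S × I | tpaStep H b (oracle b p.1) p.2 ≤ hi} :=
        ((measurable_uncurry_tpaStep H ho.measurable).comp measurable_prodMk_left)
          measurableSet_Iic
      calc Φ b ≤ _ := hrec b hb
        _ ≤ ∫⁻ p, {p : S × I | tpaStep H b (oracle b p.1) p.2 ≤ hi}.indicator
              (fun _ => C * r ^ m) p ∂(ν.prod (volume : Measure I)) := by
            refine lintegral_mono fun p => ?_
            by_cases hp : tpaStep H b (oracle b p.1) p.2 ≤ hi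
            · rw [Set.indicator_of_mem (show p ∈ {p : S × I | tpaStep H b (oracle b p.1) p.2 ≤ hi} from hp)]
              exact ih _ ⟨hb.1.trans (le_tpaStep hH0 _ _ _), hp⟩
            · rw [hΦ0 _ (not_le.1 hp)]
              exact zero_le
        _ ≤ C * r ^ m * r := by
            rw [lintegral_indicator_const hms]
            gcongr
            exact hprob b hb
        _ = C * r ^ (m + 1) := by rw [pow_succ, mul_assoc]
  have hlim : Tendsto (fun m : ℕ => C * r ^ m) atTop (𝓝 (C * 0)) :=
    ENNReal.Tendsto.const_mul (ENNReal.tendsto_pow_atTop_nhds_zero_of_lt_one hr1) (Or.inr hC)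
  rw [mul_zero] at hlim
  exact le_antisymm (ge_of_tendsto' hlim fun m => hpow m b hb) zero_le

/-- The law of the randomness of one run of TPA. -/
noncomputable abbrev runLaw (ν : Measure S) : Measure (ℕ → S × I) :=
  Measure.infinitePi fun _ : ℕ => ν.prod (volume : Measure I)

/-- Whether the number of visits is infinite does not depend on the first one. Its probability thus
equals its own mean after a step, and it vanishes above `hi`, so it is zero. In particular a run of
TPA almost surely stops. -/
theorem ae_visits_ne_top (hH : ∀ x, 1 ≤ H x) (ho : IsGibbsOracle H lo hi ν oracle) {B : Set ℝ}
    (hB : MeasurableSet B) (hBhi : B ⊆ Set.Iic hi) {b : ℝ} (hb : b ∈ Set.Icc lo hi) :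
    ∀ᵐ ω ∂(runLaw ν), visits H oracle B b ω ≠ ∞ := by
  have hH0 : ∀ x, 0 < H x := fun x => one_pos.trans_le (hH x)
  have hm := measurable_uncurry_visits H ho.measurable hB
  have key : ∀ b, (runLaw ν) {ω | visits H oracle B b ω = ∞} =
      ∫⁻ p, (runLaw ν) {ω | visits H oracle B (tpaStep H b (oracle b p.1) p.2) ω = ∞}
        ∂(ν.prod (volume : Measure I)) := by
    intro b
    have hs : Measurable fun p : S × I => tpaStep H b (oracle b p.1) p.2 :=
      (measurable_uncurry_tpaStep H ho.measurable).comp measurable_prodMk_left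
    have hms : MeasurableSet {p : (S × I) × (ℕ → S × I) |
        visits H oracle B (tpaStep H b (oracle b p.1.1) p.1.2) p.2 = ∞} :=
      (hm.comp ((hs.comp measurable_fst).prodMk measurable_snd)) (measurableSet_singleton ∞)
    have h1 := (measurePreserving_head_tail (ν.prod (volume : Measure I))).measure_preimage
      hms.nullMeasurableSet
    rw [Measure.prod_apply hms] at h1
    refine Eq.trans ?_ h1
    congr 1
    ext ω
    simp only [Set.mem_ofPred_eq, Set.mem_preimage]
    rw [visits_eq_add_visits_tail, ENNReal.add_eq_top]
    refine or_iff_right fun h => ?_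
    by_cases hmem : tpaStep H b (oracle b (ω 0).1) (ω 0).2 ∈ B
    · rw [Set.indicator_of_mem hmem] at h
      exact ENNReal.one_ne_top h
    · rw [Set.indicator_of_notMem hmem] at h
      exact ENNReal.zero_ne_top h
  have := eq_zero_of_le_lintegral_tpaStep hH ho
    (Φ := fun b => (runLaw ν) {ω | visits H oracle B b ω = ∞}) ENNReal.one_ne_top
    (fun b => prob_le_one) (fun b hb => ?_) (fun b _ => (key b).le) hb
  · rw [ae_iff]
    simpa using this
  · simp [visits_eq_zero hH0 oracle hBhi hb]

end Path

/-! ### Characteristic function of the number of visits -/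

theorem hasDerivAt_max_sub_max {A B s : ℝ} (hAB : A ≤ B) (hA : s ≠ A) (hB : s ≠ B) :
    HasDerivAt (fun s => max B s - max A s) (if A < s ∧ s < B then -1 else 0) s := by
  rcases lt_or_gt_of_ne hA with h | h
  · rw [if_neg fun h' => lt_asymm h h'.1]
    refine (hasDerivAt_const s (B - A)).congr_of_eventuallyEq ?_
    filter_upwards [Iio_mem_nhds h] with r hr
    rw [max_eq_left (le_trans (le_of_lt hr) hAB), max_eq_left (le_of_lt hr)]
  rcases lt_or_gt_of_ne hB with h' | h'
  · rw [if_pos ⟨h, h'⟩]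
    refine ((hasDerivAt_id s).const_sub B).congr_of_eventuallyEq ?_
    filter_upwards [Iio_mem_nhds h', Ioi_mem_nhds h] with r hr hr'
    rw [max_eq_left (le_of_lt hr), max_eq_right (le_of_lt hr'), id]
  · rw [if_neg fun h'' => lt_asymm h' h''.2]
    refine (hasDerivAt_const s (0 : ℝ)).congr_of_eventuallyEq ?_
    filter_upwards [Ioi_mem_nhds h', Ioi_mem_nhds h] with r hr hr'
    rw [max_eq_right (le_of_lt hr), max_eq_right (le_of_lt hr'), sub_self]

/-- `exp((x - 1) λ)`, where `λ` is the length of `[A, B] ∩ [s, ∞)`. -/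
noncomputable def expOverlap (x : ℂ) (A B s : ℝ) : ℂ :=
  Complex.exp ((x - 1) * ((max B s - max A s : ℝ) : ℂ))

theorem continuous_expOverlap (x : ℂ) (A B : ℝ) : Continuous (expOverlap x A B) := by
  unfold expOverlap
  fun_prop

theorem norm_expOverlap_le_one {x : ℂ} (hx : ‖x‖ ≤ 1) {A B : ℝ} (hAB : A ≤ B) (s : ℝ) :
    ‖expOverlap x A B s‖ ≤ 1 := by
  rw [expOverlap, Complex.norm_exp, Complex.re_mul_ofReal, Real.exp_le_one_iff]
  refine mul_nonpos_of_nonpos_of_nonneg ?_ (sub_nonneg.2 (max_le_max_right s hAB))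
  have := (Complex.re_le_norm x).trans hx
  simpa using this

/-- If `E` is exponential with mean one, then `𝔼 f(y + E) g(y + E) = g(y)` where `g` is
`expOverlap x A B` and `f` is `x` on `(A, B)` and one elsewhere. -/
theorem integral_mul_expOverlap {x : ℂ} (hx : ‖x‖ ≤ 1) {A B : ℝ} (hAB : A ≤ B) (y : ℝ) :
    ∫ w in Set.Icc (0 : ℝ) 1, (if A < y - Real.log w ∧ y - Real.log w < B then x else 1) *
      expOverlap x A B (y - Real.log w) = expOverlap x A B y := by
  rw [integral_Icc_eq_integral_Ioc, ← intervalIntegral.integral_of_le zero_le_one]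
  -- The antiderivative is w g(y - ln w), whose derivative is g - g' at y - ln w. As g' = (1 - x) g
  -- inside (A, B) and g' = 0 outside, this is x g or g. The two exceptional points are the kinks of
  -- g. At w = 0 the factor w and the bound on g give continuity.
  rw [integral_eq_of_hasDerivAt_off_countable_of_le
    (fun w : ℝ => (w : ℂ) * expOverlap x A B (y - Real.log w)) _ zero_le_one
    (s := {Real.exp (y - A), Real.exp (y - B)}) (Set.countable_insert.2 (Set.countable_singleton _))]
  · simp
  · intro w hw
    rcases hw.1.eq_or_lt with h0 | h0
    · rw [← h0]
      refine ContinuousAt.continuousWithinAt ?_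
      rw [ContinuousAt, Complex.ofReal_zero, zero_mul]
      refine squeeze_zero_norm (a := fun w : ℝ => |w|) (fun w => ?_) ?_
      · rw [norm_mul, Complex.norm_real, Real.norm_eq_abs]
        exact mul_le_of_le_one_right (abs_nonneg _) (norm_expOverlap_le_one hx hAB _)
      · simpa using (continuous_abs.tendsto (0 : ℝ))
    · refine ContinuousAt.continuousWithinAt ?_
      refine Complex.continuous_ofReal.continuousAt.mul ?_
      exact (continuous_expOverlap x A B).continuousAt.comp
        (continuousAt_const.sub (Real.continuousAt_log h0.ne'))
  · rintro w ⟨⟨h0, h1⟩, hw⟩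
    have hne : ∀ D : ℝ, w ≠ Real.exp (y - D) → y - Real.log w ≠ D := by
      intro D hD h
      exact hD (by rw [← Real.exp_log h0]; congr 1; linarith)
    simp only [Set.mem_insert_iff, Set.mem_singleton_iff, not_or] at hw
    have d1 := hasDerivAt_max_sub_max hAB (hne A hw.1) (hne B hw.2)
    have d2 := d1.comp w ((Real.hasDerivAt_log h0.ne').const_sub y)
    have d3 := ((d2.ofReal_comp.const_mul (x - 1)).cexp)
    have d4 := (hasDerivAt_id w).ofReal_comp.mul d3
    have hw0 : (w : ℂ) ≠ 0 := Complex.ofReal_ne_zero.2 h0.ne'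
    refine HasDerivAt.congr_deriv (f := fun w : ℝ => (w : ℂ) * expOverlap x A B (y - Real.log w))
      d4 ?_
    simp only [expOverlap, Function.comp]
    split_ifs
    · push_cast
      simp only [id]
      field_simp
      ring
    · simp
  · rw [intervalIntegrable_iff_integrableOn_Ioc_of_le zero_le_one]
    refine Measure.integrableOn_of_bounded (M := 1) (by simp) ?_ ?_
    · refine Measurable.aestronglyMeasurable ?_
      have hm : Measurable fun w : ℝ => y - Real.log w := measurable_const.sub Real.measurable_log
      refine Measurable.mul (Measurable.ite ?_ measurable_const measurable_const)
        ((continuous_expOverlap x A B).measurable.comp hm)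
      exact hm measurableSet_Ioo
    · refine ae_of_all _ fun w => ?_
      rw [norm_mul]
      refine mul_le_one₀ ?_ (norm_nonneg _) (norm_expOverlap_le_one hx hAB _)
      split_ifs
      · exact hx
      · simp

section CharFun

variable {α S : Type*} [Fintype α] [MeasurableSpace α] [MeasurableSingletonClass α] [Nonempty α]
  [MeasurableSpace S] {ν : Measure S} [IsProbabilityMeasure ν] {H : α → ℝ} {lo hi : ℝ}
  {oracle : ℝ → S → α}

/-- The set `B` of parameters is, up to its end points, the interval `(A, B')` in the coordinate
`ln Z(lo) - ln Z(β)`. -/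
structure IsFreeInterval (H : α → ℝ) (lo hi : ℝ) (B : Set ℝ) (A A' : ℝ) : Prop where
  measurableSet : MeasurableSet B
  subset : B ⊆ Set.Iic hi
  le : A ≤ A'
  le_freeDiff : A' ≤ freeDiff H lo hi
  mem : ∀ β, A < freeDiff H lo β → freeDiff H lo β < A' → β ∈ B
  mem_Icc : ∀ β ∈ B, freeDiff H lo β ∈ Set.Icc A A'

/-- The factor `e^{itN}`. -/
noncomputable def phase (t : ℝ) (N : ℝ≥0∞) : ℂ :=
  Complex.exp (((t * N.toReal : ℝ) : ℂ) * Complex.I)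

theorem measurable_phase (t : ℝ) : Measurable (phase t) := by
  unfold phase
  fun_prop

theorem norm_phase (t : ℝ) (N : ℝ≥0∞) : ‖phase t N‖ = 1 :=
  Complex.norm_exp_ofReal_mul_I _

/-- Finiteness matters: `toReal` sends ∞ to 0, so the rule fails for infinite counts. -/
theorem phase_add (t : ℝ) {M N : ℝ≥0∞} (hM : M ≠ ∞) (hN : N ≠ ∞) :
    phase t (M + N) = phase t M * phase t N := by
  rw [phase, phase, phase, ENNReal.toReal_add hM hN, ← Complex.exp_add]
  congr 1
  push_cast
  ring

theorem phase_zero (t : ℝ) : phase t 0 = 1 := by simp [phase]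

theorem phase_one (t : ℝ) : phase t 1 = Complex.exp (t * Complex.I) := by simp [phase]

/-- The characteristic function of the number of visits, as a function of the starting point. -/
noncomputable def visitsChar (ν : Measure S) (H : α → ℝ) (oracle : ℝ → S → α) (B : Set ℝ) (t b : ℝ) :
    ℂ := ∫ ω, phase t (visits H oracle B b ω) ∂(runLaw ν)

theorem measurable_visitsChar (ho : IsGibbsOracle H lo hi ν oracle) {B : Set ℝ}
    (hB : MeasurableSet B) (t : ℝ) : Measurable (visitsChar ν H oracle B t) :=
  ((measurable_phase t).comp
    (measurable_uncurry_visits H ho.measurable hB)).stronglyMeasurable.integral_prod_right'.measurable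

theorem norm_visitsChar_le_one (B : Set ℝ) (t b : ℝ) : ‖visitsChar ν H oracle B t b‖ ≤ 1 := by
  refine (norm_integral_le_of_norm_le_const (C := 1) (ae_of_all _ fun ω => ?_)).trans ?_
  · rw [norm_phase]
  · simp

theorem measurable_tpaStep_oracle (ho : IsGibbsOracle H lo hi ν oracle) (b : ℝ) :
    Measurable fun p : S × I => tpaStep H b (oracle b p.1) p.2 :=
  (measurable_uncurry_tpaStep H ho.measurable).comp measurable_prodMk_left

theorem measurable_phase_indicator {B : Set ℝ} (hB : MeasurableSet B) (t : ℝ) :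
    Measurable fun b : ℝ => phase t (B.indicator 1 b) :=
  (measurable_phase t).comp (measurable_one.indicator hB)

/-- First-step analysis: split off the first step, and factor the phase of the sum, which is
legitimate because the number of visits is almost surely finite. -/
theorem visitsChar_eq_integral (hH : ∀ x, 1 ≤ H x) (ho : IsGibbsOracle H lo hi ν oracle)
    {B : Set ℝ} (hB : MeasurableSet B) (hBhi : B ⊆ Set.Iic hi) (t : ℝ) {b : ℝ}
    (hb : b ∈ Set.Icc lo hi) : visitsChar ν H oracle B t b =
      ∫ p, phase t (B.indicator 1 (tpaStep H b (oracle b p.1) p.2)) *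
        visitsChar ν H oracle B t (tpaStep H b (oracle b p.1) p.2)
        ∂(ν.prod (volume : Measure I)) := by
  have hsm := measurable_tpaStep_oracle ho b
  set Ψ : (S × I) × (ℕ → S × I) → ℂ := fun p =>
    phase t (B.indicator 1 (tpaStep H b (oracle b p.1.1) p.1.2)) *
      phase t (visits H oracle B (tpaStep H b (oracle b p.1.1) p.1.2) p.2) with hΨ
  have hint : Integrable Ψ ((ν.prod (volume : Measure I)).prod (runLaw ν)) := by
    refine Integrable.of_bound (C := 1) (Measurable.aestronglyMeasurable ?_)
      (ae_of_all _ fun p => ?_)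
    · exact ((measurable_phase_indicator hB t).comp (hsm.comp measurable_fst)).mul
        ((measurable_phase t).comp ((measurable_uncurry_visits H ho.measurable hB).comp
          ((hsm.comp measurable_fst).prodMk measurable_snd)))
    · rw [hΨ, norm_mul, norm_phase, norm_phase, mul_one]
  have h1 : ∫ ω, Ψ (ω 0, fun i => ω (i + 1)) ∂(runLaw ν) =
      ∫ p, Ψ p ∂((ν.prod (volume : Measure I)).prod (runLaw ν)) := by
    have h := measurePreserving_head_tail (ν.prod (volume : Measure I))
    rw [← h.map_eq, integral_map h.measurable.aemeasurable]
    rw [h.map_eq]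
    exact hint.1
  have h2 : visitsChar ν H oracle B t b = ∫ ω, Ψ (ω 0, fun i => ω (i + 1)) ∂(runLaw ν) := by
    refine integral_congr_ae ?_
    filter_upwards [ae_visits_ne_top hH ho hB hBhi hb] with ω hω
    rw [visits_eq_add_visits_tail] at hω ⊢
    exact phase_add t (fun h => hω (by rw [h, top_add])) (fun h => hω (by rw [h, add_top]))
  rw [h2, h1, integral_prod _ hint]
  exact integral_congr_ae (ae_of_all _ fun p => integral_const_mul (μ := runLaw ν)
    (phase t (B.indicator 1 (tpaStep H b (oracle b p.1) p.2)))
    fun ω => phase t (visits H oracle B (tpaStep H b (oracle b p.1) p.2) ω))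

/-- A step changes `freeDiff` by -ln w with w uniform, so `integral_mul_expOverlap` transfers to
TPA. The end points of the interval are hit with probability zero, which is why `IsFreeInterval` may
leave them undetermined. -/
theorem expOverlap_eq_integral (hH : ∀ x, 1 ≤ H x) (ho : IsGibbsOracle H lo hi ν oracle) {B : Set ℝ}
    {A A' : ℝ} (hB : IsFreeInterval H lo hi B A A') (t : ℝ) {b : ℝ} (hb : b ∈ Set.Icc lo hi) :
    expOverlap (Complex.exp (t * Complex.I)) A A' (freeDiff H lo b) =
      ∫ p, phase t (B.indicator 1 (tpaStep H b (oracle b p.1) p.2)) *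
        expOverlap (Complex.exp (t * Complex.I)) A A'
          (freeDiff H lo (tpaStep H b (oracle b p.1) p.2)) ∂(ν.prod (volume : Measure I)) := by
  set x : ℂ := Complex.exp (t * Complex.I) with hxdef
  have hx : ‖x‖ = 1 := Complex.norm_exp_ofReal_mul_I t
  have hm : Measurable fun p : S × I =>
      partitionFn H (tpaStep H b (oracle b p.1) p.2) / partitionFn H b :=
    ((continuous_partitionFn H).measurable.comp (measurable_tpaStep_oracle ho b)).div_const _
  have hlaw := map_partitionFn_tpaStep hH ho hb
  have hu : ∀ p : S × I, freeDiff H lo (tpaStep H b (oracle b p.1) p.2) = freeDiff H lo b -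
      Real.log (partitionFn H (tpaStep H b (oracle b p.1) p.2) / partitionFn H b) := fun p => by
    have := freeDiff_sub H lo b (tpaStep H b (oracle b p.1) p.2)
    linarith
  have hne : ∀ D : ℝ, ∀ᵐ p ∂(ν.prod (volume : Measure I)),
      freeDiff H lo (tpaStep H b (oracle b p.1) p.2) ≠ D := by
    intro D
    have h0 : ∀ᵐ w ∂((ν.prod (volume : Measure I)).map fun p =>
        partitionFn H (tpaStep H b (oracle b p.1) p.2) / partitionFn H b),
        w ≠ Real.exp (freeDiff H lo b - D) := by
      rw [hlaw]
      exact ae_restrict_of_ae (Measure.ae_ne volume _)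
    filter_upwards [ae_of_ae_map hm.aemeasurable h0] with p hp h
    refine hp ?_
    rw [← h, hu, sub_sub_cancel, Real.exp_log]
    exact div_pos (partitionFn_pos H _) (partitionFn_pos H _)
  have hfm' : Measurable fun w : ℝ =>
      (if A < freeDiff H lo b - Real.log w ∧ freeDiff H lo b - Real.log w < A' then x else 1) *
      expOverlap x A A' (freeDiff H lo b - Real.log w) := by
    have hml : Measurable fun w : ℝ => freeDiff H lo b - Real.log w :=
      measurable_const.sub Real.measurable_log
    exact Measurable.mul (Measurable.ite (hml measurableSet_Ioo) measurable_const
      measurable_const) ((continuous_expOverlap x A A').measurable.comp hml)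
  have h1 := integral_mul_expOverlap hx.le hB.le (freeDiff H lo b)
  rw [← hlaw, integral_map hm.aemeasurable hfm'.aestronglyMeasurable] at h1
  refine Eq.trans h1.symm (integral_congr_ae ?_)
  filter_upwards [hne A, hne A'] with p hpA hpA'
  rw [← hu]
  congr 1
  split_ifs with h
  · rw [Set.indicator_of_mem (hB.mem _ h.1 h.2), Pi.one_apply, phase_one]
  · rw [Set.indicator_of_notMem, phase_zero]
    intro h'
    have := hB.mem_Icc _ h'
    exact h ⟨lt_of_le_of_ne this.1 hpA.symm, lt_of_le_of_ne this.2 hpA'⟩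

/-- Both sides solve the same one-step equation, whose coefficient has modulus one, and both equal 1
above `hi`. The norm of their difference therefore satisfies the hypotheses of
`eq_zero_of_le_lintegral_tpaStep`. -/
theorem visitsChar_eq_expOverlap (hH : ∀ x, 1 ≤ H x) (ho : IsGibbsOracle H lo hi ν oracle)
    {B : Set ℝ} {A A' : ℝ} (hB : IsFreeInterval H lo hi B A A') (t : ℝ) {b : ℝ}
    (hb : b ∈ Set.Icc lo hi) : visitsChar ν H oracle B t b =
      expOverlap (Complex.exp (t * Complex.I)) A A' (freeDiff H lo b) := by
  have hH0 : ∀ x, 0 < H x := fun x => one_pos.trans_le (hH x)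
  have hx : ‖Complex.exp (t * Complex.I)‖ = 1 := Complex.norm_exp_ofReal_mul_I t
  set F : ℝ → ℂ := visitsChar ν H oracle B t with hF
  set G : ℝ → ℂ := fun b => expOverlap (Complex.exp (t * Complex.I)) A A' (freeDiff H lo b) with hG
  have hF1 : ∀ b, ‖F b‖ ≤ 1 := norm_visitsChar_le_one B t
  have hG1 : ∀ b, ‖G b‖ ≤ 1 := fun b => norm_expOverlap_le_one hx.le hB.le _
  have hGm : Measurable G :=
    ((continuous_expOverlap _ A A').comp (continuous_freeDiff H lo)).measurable
  have hzero := eq_zero_of_le_lintegral_tpaStep hH ho (Φ := fun b => ‖F b - G b‖ₑ)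
    (C := 2) (by simp) (fun b => ?_) (fun b hb => ?_) (fun b hb => ?_) hb
  · exact sub_eq_zero.1 (enorm_eq_zero.1 hzero)
  · rw [← ofReal_norm, ← ENNReal.ofReal_ofNat]
    refine ENNReal.ofReal_le_ofReal ((norm_sub_le _ _).trans ?_)
    linarith [hF1 b, hG1 b]
  · have h1 : F b = 1 := by
      simp [hF, visitsChar, visits_eq_zero hH0 oracle hB.subset hb, phase_zero]
    have h2 : A' ≤ freeDiff H lo b :=
      hB.le_freeDiff.trans ((strictMono_freeDiff hH0 lo) hb).le
    have h3 : G b = 1 := by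
      simp only [hG, expOverlap]
      rw [max_eq_right h2, max_eq_right (hB.le.trans h2)]
      simp
    rw [h1, h3, sub_self, enorm_zero]
  · have hint : ∀ K : ℝ → ℂ, Measurable K → (∀ b, ‖K b‖ ≤ 1) →
        Integrable (fun p : S × I => phase t (B.indicator 1 (tpaStep H b (oracle b p.1) p.2)) *
          K (tpaStep H b (oracle b p.1) p.2)) (ν.prod (volume : Measure I)) := by
      intro K hKm hK1
      refine Integrable.of_bound (C := 1) (Measurable.aestronglyMeasurable ?_)
        (ae_of_all _ fun p => ?_)
      · exact ((measurable_phase_indicator hB.measurableSet t).comp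
          (measurable_tpaStep_oracle ho b)).mul (hKm.comp (measurable_tpaStep_oracle ho b))
      · rw [norm_mul, norm_phase, one_mul]
        exact hK1 _
    have e1 : F b - G b = ∫ p, phase t (B.indicator 1 (tpaStep H b (oracle b p.1) p.2)) *
        (F (tpaStep H b (oracle b p.1) p.2) - G (tpaStep H b (oracle b p.1) p.2))
        ∂(ν.prod (volume : Measure I)) := by
      have e2 : F b = _ := visitsChar_eq_integral hH ho hB.measurableSet hB.subset t hb
      have e3 : G b = _ := expOverlap_eq_integral hH ho hB t hb
      rw [e2, e3, ← integral_sub (hint F (measurable_visitsChar ho hB.measurableSet t) hF1)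
        (hint G hGm hG1)]
      simp only [← mul_sub]
    rw [e1]
    refine (enorm_integral_le_lintegral_enorm _).trans (lintegral_mono fun p => ?_)
    rw [enorm_mul, ← ofReal_norm (phase _ _), norm_phase, ENNReal.ofReal_one, one_mul]

end CharFun

/-! ### The points of `TPA(k)` form a Poisson process -/

section Union

variable {α S : Type*} [Fintype α] [MeasurableSpace α] [MeasurableSingletonClass α] [Nonempty α]
  [MeasurableSpace S] {ν : Measure S} [IsProbabilityMeasure ν] {H : α → ℝ} {lo hi : ℝ}
  {oracle : ℝ → S → α} {k : ℕ}

/-- The law of the randomness of `k` runs of TPA. -/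
noncomputable abbrev unionLaw (ν : Measure S) (k : ℕ) : Measure (Fin k → ℕ → S × I) :=
  Measure.pi fun _ : Fin k => runLaw ν

/-- The number of points of `TPA(k)` in `B`. -/
noncomputable def unionVisits (H : α → ℝ) (oracle : ℝ → S → α) (B : Set ℝ) (lo : ℝ)
    (ω : Fin k → ℕ → S × I) : ℝ≥0∞ := ∑ j, visits H oracle B lo (ω j)

theorem measurable_unionVisits (ho : IsGibbsOracle H lo hi ν oracle) {B : Set ℝ}
    (hB : MeasurableSet B) :
    Measurable fun ω : Fin k → ℕ → S × I => unionVisits H oracle B lo ω :=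
  Finset.measurable_sum _ fun j _ => (measurable_uncurry_visits H ho.measurable hB).comp
    (measurable_const.prodMk (measurable_pi_apply j))

theorem ae_forall_visits_ne_top (hH : ∀ x, 1 ≤ H x) (ho : IsGibbsOracle H lo hi ν oracle)
    (hlh : lo ≤ hi) {B : Set ℝ} (hB : MeasurableSet B) (hBhi : B ⊆ Set.Iic hi) :
    ∀ᵐ ω ∂(unionLaw ν k), ∀ j, visits H oracle B lo (ω j) ≠ ∞ := by
  rw [ae_all_iff]
  intro j
  exact (measurePreserving_eval (fun _ : Fin k => runLaw ν) j).quasiMeasurePreserving.ae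
    (ae_visits_ne_top hH ho hB hBhi ⟨le_rfl, hlh⟩)

theorem phase_sum {ι : Type*} (s : Finset ι) (t : ℝ) {N : ι → ℝ≥0∞} (hN : ∀ i ∈ s, N i ≠ ∞) :
    phase t (∑ i ∈ s, N i) = ∏ i ∈ s, phase t (N i) := by
  classical
  induction s using Finset.induction_on with
  | empty => simp [phase_zero]
  | insert i s hi ih =>
    have hs : ∀ i ∈ s, N i ≠ ∞ := fun i hi => hN i (Finset.mem_insert_of_mem hi)
    rw [Finset.sum_insert hi, Finset.prod_insert hi, phase_add t (hN i (Finset.mem_insert_self i s))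
      (ENNReal.sum_ne_top.2 hs), ih hs]

/-- Independence of the runs raises the characteristic function to the power `k`. A run starts at z
= 0 ≤ A, so the overlap is the whole length A' - A, and the power is the Poisson characteristic
function. -/
theorem map_unionVisits (hH : ∀ x, 1 ≤ H x) (ho : IsGibbsOracle H lo hi ν oracle)
    (hlh : lo ≤ hi) {B : Set ℝ} {A A' : ℝ} (hB : IsFreeInterval H lo hi B A A') (hA : 0 ≤ A) :
    (unionLaw ν k).map (fun ω => (unionVisits H oracle B lo ω).toReal) =
      (poissonMeasure (k * (A' - A)).toNNReal).map (Nat.cast : ℕ → ℝ) := by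
  have hm := measurable_unionVisits (k := k) ho hB.measurableSet
  have hP1 : IsProbabilityMeasure ((unionLaw ν k).map
      (fun ω => (unionVisits H oracle B lo ω).toReal)) :=
    Measure.isProbabilityMeasure_map hm.ennreal_toReal.aemeasurable
  have hP2 : IsProbabilityMeasure
      ((poissonMeasure (k * (A' - A)).toNNReal).map (Nat.cast : ℕ → ℝ)) :=
    Measure.isProbabilityMeasure_map Measurable.of_discrete.aemeasurable
  refine Measure.ext_of_charFun ?_
  ext t
  rw [charFun_map_cast_poissonMeasure, charFun_apply_real,
    integral_map hm.ennreal_toReal.aemeasurable (by fun_prop)]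
  have h1 : ∫ ω, Complex.exp (t * ((unionVisits H oracle B lo ω).toReal : ℝ) * Complex.I)
      ∂(unionLaw ν k) = ∫ ω, ∏ j, phase t (visits H oracle B lo (ω j)) ∂(unionLaw ν k) := by
    refine integral_congr_ae ?_
    filter_upwards [ae_forall_visits_ne_top hH ho hlh hB.measurableSet hB.subset] with ω hω
    rw [← phase_sum _ _ fun j _ => hω j, phase, unionVisits]
    push_cast
    rfl
  rw [h1, integral_fintype_prod_eq_prod (fun _ : Fin k => fun ω => phase t (visits H oracle B lo ω))]
  change ∏ _ : Fin k, visitsChar ν H oracle B t lo = _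
  rw [Finset.prod_const, Finset.card_univ, Fintype.card_fin,
    visitsChar_eq_expOverlap hH ho hB t ⟨le_rfl, hlh⟩, freeDiff_self, expOverlap,
    max_eq_left hA, max_eq_left (hA.trans hB.le), ← Complex.exp_nat_mul]
  have h2 : (((k * (A' - A)).toNNReal : ℝ) : ℂ) = k * (A' - A) := by
    rw [Real.coe_toNNReal _ (mul_nonneg k.cast_nonneg (sub_nonneg.2 hB.le))]
    push_cast
    rfl
  congr 1
  rw [h2]
  push_cast
  ring

theorem lintegral_comp_unionVisits (hH : ∀ x, 1 ≤ H x) (ho : IsGibbsOracle H lo hi ν oracle)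
    (hlh : lo ≤ hi) {B : Set ℝ} {A A' : ℝ} (hB : IsFreeInterval H lo hi B A A') (hA : 0 ≤ A)
    {φ : ℝ≥0∞ → ℝ≥0∞} (hφ : Measurable φ) :
    ∫⁻ ω, φ (unionVisits H oracle B lo ω) ∂(unionLaw ν k) = ∑' n : ℕ, φ n *
      ENNReal.ofReal (Real.exp (-(k * (A' - A))) * (k * (A' - A)) ^ n / n.factorial) := by
  have hm := measurable_unionVisits (k := k) ho hB.measurableSet
  have h1 : ∫⁻ ω, φ (unionVisits H oracle B lo ω) ∂(unionLaw ν k) =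
      ∫⁻ ω, φ (ENNReal.ofReal (unionVisits H oracle B lo ω).toReal) ∂(unionLaw ν k) := by
    refine lintegral_congr_ae ?_
    filter_upwards [ae_forall_visits_ne_top hH ho hlh hB.measurableSet hB.subset] with ω hω
    rw [ENNReal.ofReal_toReal]
    exact ENNReal.sum_ne_top.2 fun j _ => hω j
  have hφ' : Measurable fun y : ℝ => φ (ENNReal.ofReal y) := hφ.comp ENNReal.measurable_ofReal
  rw [h1, ← lintegral_map hφ' hm.ennreal_toReal, map_unionVisits hH ho hlh hB hA,
    lintegral_map hφ' Measurable.of_discrete, lintegral_countable']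
  refine tsum_congr fun n => ?_
  rw [ENNReal.ofReal_natCast, poissonMeasure_singleton,
    Real.coe_toNNReal _ (mul_nonneg k.cast_nonneg (sub_nonneg.2 hB.le))]

theorem lintegral_unionVisits (hH : ∀ x, 1 ≤ H x) (ho : IsGibbsOracle H lo hi ν oracle)
    (hlh : lo ≤ hi) {B : Set ℝ} {A A' : ℝ} (hB : IsFreeInterval H lo hi B A A') (hA : 0 ≤ A) :
    ∫⁻ ω, unionVisits H oracle B lo ω ∂(unionLaw ν k) = ENNReal.ofReal (k * (A' - A)) := by
  rw [lintegral_comp_unionVisits hH ho hlh hB hA (φ := fun y => y) measurable_id]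
  set r : ℝ := k * (A' - A) with hr
  have hr0 : 0 ≤ r := mul_nonneg k.cast_nonneg (sub_nonneg.2 hB.le)
  have h1 : ∀ n : ℕ, (n : ℝ≥0∞) * ENNReal.ofReal (Real.exp (-r) * r ^ n / n.factorial) =
      ENNReal.ofReal (n * (Real.exp (-r) * r ^ n / n.factorial)) := fun n => by
    rw [ENNReal.ofReal_mul n.cast_nonneg, ENNReal.ofReal_natCast]
  have h2 : HasSum (fun n : ℕ => (n : ℝ) * (Real.exp (-r) * r ^ n / n.factorial)) r := by
    rw [← hasSum_nat_add_iff' 1]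
    have h3 := (NormedSpace.expSeries_div_hasSum_exp r).mul_left (r * Real.exp (-r))
    rw [← Real.exp_eq_exp_ℝ, mul_assoc r, ← Real.exp_add, neg_add_cancel, Real.exp_zero, mul_one] at h3
    simp only [Finset.range_one, Finset.sum_singleton, Nat.cast_zero, zero_mul, sub_zero]
    refine h3.congr_fun fun n => ?_
    rw [Nat.factorial_succ]
    push_cast
    field_simp
    ring
  simp_rw [h1]
  rw [← ENNReal.ofReal_tsum_of_nonneg (fun n => by positivity) h2.summable, h2.tsum_eq]

/-- The mean of `(d - N)⁺` for `N` Poisson of mean `y`. -/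
noncomputable def poissonDeficit (d : ℕ) (y : ℝ) : ℝ :=
  ∑ j ∈ Finset.range d, ((d : ℝ) - j) * (Real.exp (-y) * y ^ j / j.factorial)

/-- Truncated subtraction in `ℝ≥0∞` is exactly the positive part, so the terms with `j ≥ d` drop
out. -/
theorem lintegral_sub_unionVisits (hH : ∀ x, 1 ≤ H x) (ho : IsGibbsOracle H lo hi ν oracle)
    (hlh : lo ≤ hi) {B : Set ℝ} {A A' : ℝ} (hB : IsFreeInterval H lo hi B A A') (hA : 0 ≤ A)
    (d : ℕ) : ∫⁻ ω, ((d : ℝ≥0∞) - unionVisits H oracle B lo ω) ∂(unionLaw ν k) =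
      ENNReal.ofReal (poissonDeficit d (k * (A' - A))) := by
  have hr0 : 0 ≤ k * (A' - A) := mul_nonneg k.cast_nonneg (sub_nonneg.2 hB.le)
  rw [lintegral_comp_unionVisits hH ho hlh hB hA (φ := fun y => (d : ℝ≥0∞) - y)
    (measurable_const.sub measurable_id), tsum_eq_sum (s := Finset.range d)]
  · rw [poissonDeficit, ENNReal.ofReal_sum_of_nonneg]
    · refine Finset.sum_congr rfl fun j hj => ?_
      have hjd : (j : ℝ) ≤ d := Nat.cast_le.2 (Finset.mem_range.1 hj).le
      rw [ENNReal.ofReal_mul (sub_nonneg.2 hjd), ENNReal.ofReal_sub _ j.cast_nonneg,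
        ENNReal.ofReal_natCast, ENNReal.ofReal_natCast]
    · intro j hj
      have hjd : (j : ℝ) ≤ d := Nat.cast_le.2 (Finset.mem_range.1 hj).le
      have := sub_nonneg.2 hjd
      positivity
  · intro j hj
    rw [tsub_eq_zero_of_le, zero_mul]
    exact Nat.cast_le.2 (not_lt.1 fun h => hj (Finset.mem_range.2 h))

end Union

/-! ### The output of TPA and the number of oracle calls -/

section Output

variable {α S : Type*}

theorem mem_Icc_of_mem_tpaOutput {H : α → ℝ} {oracle : ℝ → S → α} {lo hi : ℝ} {ω : ℕ → S × I}
    {β : ℝ} (h : β ∈ tpaOutput H oracle lo hi ω) : β ∈ Set.Icc lo hi := by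
  obtain ⟨i, hlt, rfl⟩ := Multiset.mem_map.1 h
  by_contra h'
  exact absurd (Nat.sInf_le (show i ∈ tpaExits H oracle lo hi ω from h'))
    (not_le.2 (Multiset.mem_range.1 hlt))

theorem mem_Icc_of_mem_tpaUnion {H : α → ℝ} {oracle : ℝ → S → α} {lo hi : ℝ} {k : ℕ}
    {ω : Fin k → ℕ → S × I} {β : ℝ} (h : β ∈ tpaUnion H oracle lo hi ω) : β ∈ Set.Icc lo hi := by
  obtain ⟨j, -, hj⟩ := Multiset.mem_sum.1 h
  exact mem_Icc_of_mem_tpaOutput hj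

theorem tpaExits_nonempty {H : α → ℝ} {oracle : ℝ → S → α} {lo hi : ℝ} {ω : ℕ → S × I}
    (h : visits H oracle (Set.Icc lo hi) lo ω ≠ ∞) : (tpaExits H oracle lo hi ω).Nonempty := by
  by_contra h'
  rw [Set.not_nonempty_iff_eq_empty] at h'
  refine h ?_
  have h1 : ∀ i, (Set.Icc lo hi).indicator (1 : ℝ → ℝ≥0∞) (tpaPath H oracle lo ω (i + 1)) = 1 := by
    intro i
    refine Set.indicator_of_mem ?_ _
    by_contra hout
    have : i ∈ tpaExits H oracle lo hi ω := hout
    rw [h'] at this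
    exact this
  rw [visits, tsum_congr h1]
  exact ENNReal.tsum_const_eq_top_of_ne_zero one_ne_zero

/-- At its first exit the path passes above `hi`, and by monotonicity it never returns. The visits
of the infinite path are therefore those of the output. -/
theorem countP_tpaOutput {H : α → ℝ} (hH : ∀ x, 0 < H x) {oracle : ℝ → S → α} {lo hi : ℝ}
    {ω : ℕ → S × I} (hne : (tpaExits H oracle lo hi ω).Nonempty) {B : Set ℝ}
    [DecidablePred (· ∈ B)] (hB : B ⊆ Set.Icc lo hi) :
    ((tpaOutput H oracle lo hi ω).countP (· ∈ B) : ℝ≥0∞) = visits H oracle B lo ω := by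
  have hex : hi < tpaPath H oracle lo ω (sInf (tpaExits H oracle lo hi ω) + 1) := by
    have h1 := Nat.sInf_mem hne
    by_contra h2
    exact h1 ⟨le_tpaPath hH _ _ _ _, not_lt.1 h2⟩
  rw [visits, tsum_eq_sum (s := Finset.range (sInf (tpaExits H oracle lo hi ω))), tpaOutput,
    Multiset.countP_map]
  · simp only [Set.indicator_apply, Pi.one_apply]
    rw [Finset.sum_boole]
    rfl
  · intro i hi'
    refine Set.indicator_of_notMem (fun h => ?_) _
    have h1 : sInf (tpaExits H oracle lo hi ω) ≤ i := not_lt.1 fun h => hi' (Finset.mem_range.2 h)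
    have h2 := monotone_tpaPath hH oracle lo ω (Nat.succ_le_succ h1)
    exact not_le.2 (hex.trans_le h2) (hB h).2

theorem tpaCalls_eq {H : α → ℝ} {oracle : ℝ → S → α} {lo hi : ℝ}
    {ω : ℕ → S × I} (hne : (tpaExits H oracle lo hi ω).Nonempty) :
    tpaCalls H oracle lo hi ω = (((tpaOutput H oracle lo hi ω).card + 1 : ℕ) : ℕ∞) := by
  rw [tpaOutput, Multiset.card_map, Multiset.card_range, tpaCalls]
  refine le_antisymm (iInf₂_le _ (Nat.sInf_mem hne)) (le_iInf₂ fun i hi => ?_)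
  exact Nat.cast_le.2 (Nat.succ_le_succ (Nat.sInf_le hi))

theorem countP_tpaUnion {H : α → ℝ} (hH : ∀ x, 0 < H x) {oracle : ℝ → S → α} {lo hi : ℝ} {k : ℕ}
    {ω : Fin k → ℕ → S × I} (hne : ∀ j, (tpaExits H oracle lo hi (ω j)).Nonempty) {B : Set ℝ}
    [DecidablePred (· ∈ B)] (hB : B ⊆ Set.Icc lo hi) :
    ((tpaUnion H oracle lo hi ω).countP (· ∈ B) : ℝ≥0∞) = unionVisits H oracle B lo ω := by
  rw [tpaUnion, unionVisits, ← Multiset.coe_countPAddMonoidHom, map_sum, Nat.cast_sum]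
  exact Finset.sum_congr rfl fun j _ => countP_tpaOutput hH (hne j) hB

theorem card_tpaUnion {H : α → ℝ} (hH : ∀ x, 0 < H x) {oracle : ℝ → S → α} {lo hi : ℝ} {k : ℕ}
    {ω : Fin k → ℕ → S × I} (hne : ∀ j, (tpaExits H oracle lo hi (ω j)).Nonempty) :
    ((tpaUnion H oracle lo hi ω).card : ℝ≥0∞) = unionVisits H oracle (Set.Icc lo hi) lo ω := by
  rw [← countP_tpaUnion hH hne (B := Set.Icc lo hi) subset_rfl]
  refine congrArg Nat.cast (Eq.symm ?_)
  exact Multiset.countP_eq_card.2 fun a ha => mem_Icc_of_mem_tpaUnion ha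

/-- The number of `i < N` with `i ≡ c` modulo `d`. -/
def residueCount (d c N : ℕ) : ℕ := ((Finset.range N).filter fun i => i % d = c).card

theorem length_schedule (lo hi : ℝ) (d c : ℕ) (B : Multiset ℝ) :
    (schedule lo hi d c B).length = residueCount d c B.card + 2 := by
  have h : (everyNth d c (B.sort (· ≤ ·))).length = residueCount d c B.card := by
    rw [everyNth, List.length_map, Multiset.length_sort, residueCount]
    rfl
  rw [schedule, List.length_cons, List.length_append, h]
  rfl

/-- Each index has exactly one residue. Averaging over a uniform offset thus keeps `N / d` points in
the mean. -/
theorem sum_residueCount {d : ℕ} (hd : 1 ≤ d) (N : ℕ) : ∑ c : Fin d, residueCount d c N = N := by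
  rw [Fin.sum_univ_eq_sum_range (fun c => residueCount d c N) d]
  have h := Finset.card_eq_sum_card_fiberwise (s := Finset.range N) (t := Finset.range d)
    (f := fun i => i % d) fun i _ => Finset.mem_coe.2 (Finset.mem_range.2 (Nat.mod_lt i hd))
  rw [Finset.card_range] at h
  exact h.symm

theorem algCallsMerged_eq (H : α → ℝ) (oracle : ℝ → S → α) (lo hi : ℝ) {k d r : ℕ}
    (ω : Randomness S k d r) : algCallsMerged H oracle lo hi ω =
      (tpaUnion H oracle lo hi ω.1).card + 1 +
        (residueCount d ω.2.1 (tpaUnion H oracle lo hi ω.1).card + 2) * r := by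
  rw [algCallsMerged, algSchedule, length_schedule]
  push_cast
  rfl

theorem algCalls_eq {H : α → ℝ} {oracle : ℝ → S → α} {lo hi : ℝ} {k d r : ℕ}
    {ω : Randomness S k d r} (hne : ∀ j, (tpaExits H oracle lo hi (ω.1 j)).Nonempty) :
    algCalls H oracle lo hi ω = (tpaUnion H oracle lo hi ω.1).card + k +
        (residueCount d ω.2.1 (tpaUnion H oracle lo hi ω.1).card + 2) * r := by
  have hcard : (tpaUnion H oracle lo hi ω.1).card = ∑ j, (tpaOutput H oracle lo hi (ω.1 j)).card :=
    map_sum Multiset.cardHom _ _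
  have hcalls : ∑ j, ((tpaCalls H oracle lo hi (ω.1 j) : ℕ∞) : ℝ≥0∞) =
      (tpaUnion H oracle lo hi ω.1).card + k := by
    simp only [tpaCalls_eq (hne _), hcard]
    push_cast
    rw [Finset.sum_add_distrib]
    simp
  rw [algCalls, hcalls, algSchedule, length_schedule]
  push_cast
  rfl

end Output

theorem lintegral_uniformOn_univ {d : ℕ} (f : Fin d → ℝ≥0∞) :
    ∫⁻ c, f c ∂(uniformOn (Set.univ : Set (Fin d))) = (∑ c, f c) / d := by
  rw [lintegral_fintype, ENNReal.div_eq_inv_mul, Finset.mul_sum]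
  refine Finset.sum_congr rfl fun c _ => ?_
  rw [uniformOn_univ, Measure.count_singleton, Fintype.card_fin, one_div, mul_comm]

section Calls

variable {α S : Type*} [Fintype α] [MeasurableSpace α] [MeasurableSingletonClass α] [Nonempty α]
  [MeasurableSpace S] {ν : Measure S} [IsProbabilityMeasure ν] {H : α → ℝ} {lo hi : ℝ}
  {oracle : ℝ → S → α} {k d r : ℕ}

theorem isFreeInterval_Icc (hH : ∀ x, 0 < H x) (hlh : lo ≤ hi) :
    IsFreeInterval H lo hi (Set.Icc lo hi) 0 (freeDiff H lo hi) := by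
  have hmono := strictMono_freeDiff hH lo
  refine ⟨measurableSet_Icc, fun β hβ => hβ.2, ?_, le_rfl, fun β h1 h2 => ?_, fun β hβ => ?_⟩
  · rw [← freeDiff_self H lo]
    exact hmono.monotone hlh
  · rw [← freeDiff_self H lo] at h1
    exact ⟨(hmono.lt_iff_lt.1 h1).le, (hmono.lt_iff_lt.1 h2).le⟩
  · rw [← freeDiff_self H lo]
    exact ⟨hmono.monotone hβ.1, hmono.monotone hβ.2⟩

theorem ae_tpaExits_nonempty (hH : ∀ x, 1 ≤ H x) (ho : IsGibbsOracle H lo hi ν oracle)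
    (hlh : lo ≤ hi) :
    ∀ᵐ ω ∂(unionLaw ν k), ∀ j, (tpaExits H oracle lo hi (ω j)).Nonempty := by
  filter_upwards [ae_forall_visits_ne_top hH ho hlh (B := Set.Icc lo hi) measurableSet_Icc
    fun β hβ => hβ.2] with ω hω j
  exact tpaExits_nonempty (hω j)

/-- The mean of a quantity `N + a + b (#{i < N | i ≡ c} + 2)`, where `N` is the number of points
of `TPA(k)` and `c` the offset. -/
theorem lintegral_card_add (hH : ∀ x, 1 ≤ H x) (ho : IsGibbsOracle H lo hi ν oracle) (hlh : lo ≤ hi)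
    (hd : 1 ≤ d) (a : ℕ) {f : Randomness S k d r → ℝ≥0∞}
    (hf : ∀ ω : Randomness S k d r, (∀ j, (tpaExits H oracle lo hi (ω.1 j)).Nonempty) →
      f ω = (tpaUnion H oracle lo hi ω.1).card + a +
        (residueCount d ω.2.1 (tpaUnion H oracle lo hi ω.1).card + 2) * r) :
    ∫⁻ ω, f ω ∂(law ν k d r) =
      ENNReal.ofReal ((k : ℝ) * logRatio H lo hi * (1 + r / d) + 2 * r + a) := by
  have hH0 : ∀ x, 0 < H x := fun x => one_pos.trans_le (hH x)
  have hne : Nonempty (Fin d) := ⟨⟨0, hd⟩⟩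
  have hprob : IsProbabilityMeasure (uniformOn (Set.univ : Set (Fin d))) :=
    isProbabilityMeasure_uniformOn Set.finite_univ Set.univ_nonempty
  have hd0 : (d : ℝ≥0∞) ≠ 0 := Nat.cast_ne_zero.2 (by omega)
  have hdt : (d : ℝ≥0∞) ≠ ∞ := ENNReal.natCast_ne_top d
  have hum := measurable_unionVisits (k := k) ho (B := Set.Icc lo hi) measurableSet_Icc
  -- A measurable version of the number of points: it agrees with the cardinality of `tpaUnion`
  -- almost surely, and its measurability is clear from that of `unionVisits`.
  set NN : (Fin k → ℕ → S × I) → ℕ := fun ω =>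
    ⌊(unionVisits H oracle (Set.Icc lo hi) lo ω).toReal⌋₊ with hNN
  have hNNm : Measurable NN := Nat.measurable_floor.comp hum.ennreal_toReal
  set g : ℕ × Fin d → ℝ≥0∞ := fun p => p.1 + a + (residueCount d p.2 p.1 + 2) * r with hg
  have hgm : Measurable g := Measurable.of_discrete
  have hNNeq : ∀ ω : Fin k → ℕ → S × I, (∀ j, (tpaExits H oracle lo hi (ω j)).Nonempty) →
      (tpaUnion H oracle lo hi ω).card = NN ω := fun ω hω => by
    simp only [hNN]
    rw [← card_tpaUnion hH0 hω, ENNReal.toReal_natCast, Nat.floor_natCast]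
  have hae : ∀ᵐ ω ∂(unionLaw ν k), (NN ω : ℝ≥0∞) = unionVisits H oracle (Set.Icc lo hi) lo ω := by
    filter_upwards [ae_tpaExits_nonempty hH ho hlh] with ω hω
    rw [← hNNeq ω hω, card_tpaUnion hH0 hω]
  have h1 : ∫⁻ ω, f ω ∂(law ν k d r) = ∫⁻ ω, g (NN ω.1, ω.2.1) ∂(law ν k d r) := by
    refine lintegral_congr_ae ?_
    have h2 : ∀ᵐ ω ∂(law ν k d r), ∀ j, (tpaExits H oracle lo hi (ω.1 j)).Nonempty :=
      Measure.quasiMeasurePreserving_fst.ae (ae_tpaExits_nonempty hH ho hlh)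
    filter_upwards [h2] with ω hω
    rw [hf ω hω, hNNeq ω.1 hω]
  have h3 : Measurable fun ω : Randomness S k d r => g (NN ω.1, ω.2.1) :=
    hgm.comp ((hNNm.comp measurable_fst).prodMk (measurable_fst.comp measurable_snd))
  rw [h1, law, lintegral_prod _ h3.aemeasurable]
  have h4 : ∀ ω : Fin k → ℕ → S × I, ∫⁻ y : Fin d × (Fin r → ℕ → S), g (NN ω, y.1)
      ∂((uniformOn (Set.univ : Set (Fin d))).prod
        (Measure.pi fun _ : Fin r => Measure.infinitePi fun _ : ℕ => ν)) =
      NN ω * (1 + r / d) + (2 * r + a) := by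
    intro ω
    have hgm' : Measurable fun y : Fin d × (Fin r → ℕ → S) => g (NN ω, y.1) :=
      hgm.comp (measurable_const.prodMk measurable_fst)
    rw [lintegral_prod _ hgm'.aemeasurable]
    simp only [lintegral_const, measure_univ, mul_one, hg]
    have hsum : ∑ c : Fin d, (residueCount d c (NN ω) : ℝ≥0∞) = NN ω := by
      rw [← Nat.cast_sum, sum_residueCount hd]
    rw [lintegral_uniformOn_univ]
    simp only [Finset.sum_add_distrib, ← Finset.sum_mul, hsum, Finset.sum_const, Finset.card_univ, Fintype.card_fin, nsmul_eq_mul]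
    have hdd : (d : ℝ≥0∞) * (d : ℝ≥0∞)⁻¹ = 1 := ENNReal.mul_inv_cancel hd0 hdt
    rw [div_eq_mul_inv, div_eq_mul_inv]
    calc _ = (NN ω + a + 2 * r : ℝ≥0∞) * (d * (d : ℝ≥0∞)⁻¹) + NN ω * (r * (d : ℝ≥0∞)⁻¹) := by ring
      _ = _ := by rw [hdd]; ring
  simp only [h4]
  have hNNm' : Measurable fun ω => (NN ω : ℝ≥0∞) :=
    (measurable_from_top (f := fun n : ℕ => (n : ℝ≥0∞))).comp hNNm
  rw [lintegral_add_right _ measurable_const, lintegral_mul_const _ hNNm', lintegral_congr_ae hae,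
    lintegral_unionVisits hH ho hlh (isFreeInterval_Icc hH0 hlh) le_rfl, lintegral_const,
    measure_univ, mul_one, sub_zero, freeDiff_eq_logRatio]
  have hq : 0 ≤ logRatio H lo hi := by
    rw [← freeDiff_eq_logRatio]
    exact (isFreeInterval_Icc hH0 hlh).le
  have hkq : 0 ≤ (k : ℝ) * logRatio H lo hi := mul_nonneg k.cast_nonneg hq
  have hd' : (0 : ℝ) < d := Nat.cast_pos.2 hd
  have hr' : (0 : ℝ) ≤ r / d := div_nonneg r.cast_nonneg d.cast_nonneg
  rw [add_assoc, ENNReal.ofReal_add (by positivity) (by positivity), ENNReal.ofReal_mul hkq,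
    ENNReal.ofReal_add zero_le_one hr', ENNReal.ofReal_div_of_pos hd',
    ENNReal.ofReal_add (by positivity) (by positivity), ENNReal.ofReal_mul (by positivity)]
  rw [ENNReal.ofReal_mul zero_le_two]
  simp only [ENNReal.ofReal_natCast, ENNReal.ofReal_one, ENNReal.ofReal_ofNat]

theorem lintegral_algCalls (hH : ∀ x, 1 ≤ H x) (ho : IsGibbsOracle H lo hi ν oracle) (hlh : lo ≤ hi)
    (hd : 1 ≤ d) {m : ℝ} (hkm : (k : ℝ) = m * d) :
    ∫⁻ ω, algCalls H oracle lo hi ω ∂(law ν k d r) =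
      ENNReal.ofReal (m * logRatio H lo hi * (r + d) + 2 * r + k) := by
  rw [lintegral_card_add hH ho hlh hd k fun ω hω => algCalls_eq hω, hkm]
  have hd' : (d : ℝ) ≠ 0 := Nat.cast_ne_zero.2 (by omega)
  congr 1
  field_simp
  ring

theorem lintegral_algCallsMerged (hH : ∀ x, 1 ≤ H x) (ho : IsGibbsOracle H lo hi ν oracle)
    (hlh : lo ≤ hi) (hd : 1 ≤ d) {m : ℝ} (hkm : (k : ℝ) = m * d) :
    ∫⁻ ω, algCallsMerged H oracle lo hi ω ∂(law ν k d r) =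
      ENNReal.ofReal (m * logRatio H lo hi * (r + d) + 2 * r + 1) := by
  rw [lintegral_card_add hH ho hlh hd 1 fun ω _ => by
    rw [algCallsMerged_eq, Nat.cast_one], hkm]
  have hd' : (d : ℝ) ≠ 0 := Nat.cast_ne_zero.2 (by omega)
  congr 1
  push_cast
  field_simp
  ring

end Calls

/-! ### The schedule -/

section Schedule

theorem mem_everyNth {d c : ℕ} {L : List ℝ} {x : ℝ} :
    x ∈ everyNth d c L ↔ ∃ i < L.length, i % d = c ∧ L.getD i 0 = x := by
  simp only [everyNth, List.mem_map, List.mem_filter, List.mem_range, decide_eq_true_eq, and_assoc]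

theorem mem_of_mem_everyNth {d c : ℕ} {L : List ℝ} {x : ℝ} (h : x ∈ everyNth d c L) : x ∈ L := by
  obtain ⟨i, hi, -, rfl⟩ := mem_everyNth.1 h
  rw [List.getD_eq_getElem _ _ hi]
  exact List.getElem_mem hi

theorem getD_le_getD {L : List ℝ} (hL : L.Pairwise (· ≤ ·)) {i j : ℕ} (hij : i ≤ j)
    (hj : j < L.length) : L.getD i 0 ≤ L.getD j 0 := by
  rcases hij.eq_or_lt with rfl | hij
  · exact le_rfl
  rw [List.getD_eq_getElem _ _ (hij.trans hj), List.getD_eq_getElem _ _ hj]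
  exact List.pairwise_iff_getElem.1 hL i j _ _ hij

theorem pairwise_everyNth (d c : ℕ) {L : List ℝ} (hL : L.Pairwise (· ≤ ·)) :
    (everyNth d c L).Pairwise (· ≤ ·) := by
  rw [everyNth, List.pairwise_map]
  refine (List.Pairwise.filter _ List.pairwise_lt_range).imp_of_mem fun _ hb hab => ?_
  exact getD_le_getD hL hab.le (List.mem_range.1 (List.mem_of_mem_filter hb))

theorem countP_eq_card_filter_range (L : List ℝ) (p : ℝ → Prop) [DecidablePred p] :
    L.countP p = ((Finset.range L.length).filter fun i => p (L.getD i 0)).card := by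
  have h : (List.range L.length).map (fun i => L.getD i 0) = L := by
    refine List.ext_getElem (by simp) fun i h1 h2 => ?_
    rw [List.getElem_map, List.getElem_range, List.getD_eq_getElem _ _ h2]
  conv_lhs => rw [← h]
  rw [List.countP_map, List.countP_eq_length_filter]
  rfl

/-- In a sorted list the entries in an order-connected set occupy consecutive positions. Any min(d,
N) consecutive positions have distinct residues, and every offset equal to one of these residues
keeps a point of the set. -/
theorem card_offsets_avoiding_le {d : ℕ} (hd : 1 ≤ d) {L : List ℝ} (hL : L.Pairwise (· ≤ ·))
    {J : Set ℝ} [DecidablePred (· ∈ J)] (hJ : J.OrdConnected) :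
    (Finset.univ.filter fun c : Fin d => ∀ x ∈ everyNth d c L, x ∉ J).card ≤
      d - L.countP (· ∈ J) := by
  classical
  rw [countP_eq_card_filter_range L (· ∈ J)]
  set K := (Finset.range L.length).filter fun i => L.getD i 0 ∈ J with hK
  obtain ⟨p, hp⟩ : ∃ p, Finset.Ico p (p + K.card) ⊆ K := by
    rcases K.eq_empty_or_nonempty with h | h
    · exact ⟨0, by simp [h]⟩
    · have hsub : Finset.Icc (K.min' h) (K.max' h) ⊆ K := by
        intro i hi
        rw [Finset.mem_Icc] at hi
        have h1 := Finset.mem_filter.1 (K.min'_mem h)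
        have h2 := Finset.mem_filter.1 (K.max'_mem h)
        have hlt : i < L.length := hi.2.trans_lt (Finset.mem_range.1 h2.1)
        exact Finset.mem_filter.2 ⟨Finset.mem_range.2 hlt, hJ.out h1.2 h2.2
          ⟨getD_le_getD hL hi.1 hlt, getD_le_getD hL hi.2 (Finset.mem_range.1 h2.1)⟩⟩
      have hsup : K ⊆ Finset.Icc (K.min' h) (K.max' h) := fun i hi =>
        Finset.mem_Icc.2 ⟨K.min'_le i hi, K.le_max' i hi⟩
      refine ⟨K.min' h, fun i hi => hsub ?_⟩
      have hc := Finset.card_le_card hsup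
      rw [Finset.mem_Ico] at hi
      rw [Nat.card_Icc] at hc
      exact Finset.mem_Icc.2 ⟨hi.1, by omega⟩
  have himg : min d K.card ≤ (K.image fun i => i % d).card := by
    set T := Finset.Ico p (p + min d K.card) with hT
    have hTK : T ⊆ K := (Finset.Ico_subset_Ico_right (by omega)).trans hp
    calc min d K.card = T.card := by rw [hT, Nat.card_Ico]; omega
      _ = (T.image fun i => i % d).card := by
        refine (Finset.card_image_of_injOn fun i hi j hj hij => ?_).symm
        refine Nat.mod_injOn_Ico p d ?_ ?_ hij
        · rw [Finset.mem_coe, Finset.mem_Ico] at hi ⊢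
          omega
        · rw [Finset.mem_coe, Finset.mem_Ico] at hj ⊢
          omega
      _ ≤ _ := Finset.card_le_card (Finset.image_subset_image hTK)
  set G := Finset.univ.filter fun c : Fin d => ∀ x ∈ everyNth d c L, x ∉ J with hG
  have hdisj : Disjoint (G.map Fin.valEmbedding) (K.image fun i => i % d) := by
    rw [Finset.disjoint_left]
    intro a ha hb
    obtain ⟨c, hc, rfl⟩ := Finset.mem_map.1 ha
    obtain ⟨i, hi, hic⟩ := Finset.mem_image.1 hb
    have h1 := Finset.mem_filter.1 hi
    exact (Finset.mem_filter.1 hc).2 _ (mem_everyNth.2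
      ⟨i, Finset.mem_range.1 h1.1, hic, rfl⟩) h1.2
  have hunion : (G.map Fin.valEmbedding) ∪ (K.image fun i => i % d) ⊆ Finset.range d := by
    refine Finset.union_subset (fun a ha => ?_) fun a ha => ?_
    · obtain ⟨c, -, rfl⟩ := Finset.mem_map.1 ha
      exact Finset.mem_range.2 c.2
    · obtain ⟨i, -, rfl⟩ := Finset.mem_image.1 ha
      exact Finset.mem_range.2 (Nat.mod_lt i hd)
  have hcard := Finset.card_le_card hunion
  rw [Finset.card_union_of_disjoint hdisj, Finset.card_map, Finset.card_range] at hcard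
  omega

variable {lo hi : ℝ} {d c : ℕ} {U : Multiset ℝ}

theorem pairwise_schedule (hlh : lo ≤ hi) (d c : ℕ) (hU : ∀ x ∈ U, x ∈ Set.Icc lo hi) :
    (schedule lo hi d c U).Pairwise (· ≤ ·) := by
  have hmem : ∀ x ∈ everyNth d c (U.sort (· ≤ ·)), x ∈ Set.Icc lo hi := fun x hx =>
    hU x ((Multiset.mem_sort _).1 (mem_of_mem_everyNth hx))
  rw [schedule, List.pairwise_cons, List.pairwise_append]
  refine ⟨fun x hx => ?_, pairwise_everyNth d c (Multiset.pairwise_sort U (· ≤ ·)),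
    List.pairwise_singleton _ _, fun x hx y hy => ?_⟩
  · rcases List.mem_append.1 hx with h | h
    · exact (hmem x h).1
    · rwa [List.mem_singleton.1 h]
  · rw [List.mem_singleton.1 hy]
    exact (hmem x hx).2

theorem schedule_getD_zero : (schedule lo hi d c U).getD 0 0 = lo := rfl

theorem schedule_getD_last :
    (schedule lo hi d c U).getD ((schedule lo hi d c U).length - 1) 0 = hi := by
  rw [List.getD_eq_getElem _ _ (by rw [length_schedule]; omega), ← List.getLast_eq_getElem]
  · simp [schedule]
  · simp [schedule]

theorem schedule_getD_mem_Icc (hlh : lo ≤ hi) (hU : ∀ x ∈ U, x ∈ Set.Icc lo hi) {i : ℕ}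
    (hi' : i < (schedule lo hi d c U).length) :
    (schedule lo hi d c U).getD i 0 ∈ Set.Icc lo hi := by
  have hp := pairwise_schedule hlh d c hU
  constructor
  · exact getD_le_getD hp (Nat.zero_le i) hi'
  · exact (getD_le_getD hp (Nat.le_sub_one_of_lt hi') (by omega)).trans_eq schedule_getD_last

theorem le_or_le_of_mem_everyNth (hlh : lo ≤ hi) (hU : ∀ x ∈ U, x ∈ Set.Icc lo hi) {x : ℝ}
    (hx : x ∈ everyNth d c (U.sort (· ≤ ·))) {i : ℕ}
    (hi' : i + 1 < (schedule lo hi d c U).length) :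
    x ≤ (schedule lo hi d c U).getD i 0 ∨ (schedule lo hi d c U).getD (i + 1) 0 ≤ x := by
  have hp := pairwise_schedule hlh d c hU
  have hx' : x ∈ schedule lo hi d c U :=
    List.mem_cons_of_mem _ (List.mem_append_left _ hx)
  obtain ⟨j, hj, rfl⟩ := List.mem_iff_getElem.1 hx'
  rw [← List.getD_eq_getElem _ 0 hj]
  rcases Nat.lt_or_ge i j with h | h
  · exact Or.inr (getD_le_getD hp h hj)
  · exact Or.inl (getD_le_getD hp h (by omega))

end Schedule

/-! ### The relative variance of the paired product estimator for a fixed schedule -/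

section Curvature

variable {α : Type*} [Fintype α] [Nonempty α] {H : α → ℝ}

/-- If X > Y, then ln(1 + u) ≥ 2u / (u + 2) at u = X / Y - 1 says (X - Y) / ((X + Y) / 2) ≤ ln(X /
Y), and X / Y ≤ g / h. Otherwise the left side is not positive. -/
theorem sub_le_half_add_mul_log {X Y g h : ℝ} (hX : 0 < X) (hY : 0 < Y) (hg : 0 < g) (hh : 0 < h)
    (hhg : h ≤ g) (hXY : X * h ≤ Y * g) :
    X - Y ≤ (X + Y) / 2 * (Real.log g - Real.log h) := by
  have hlog : 0 ≤ Real.log g - Real.log h := sub_nonneg.2 (Real.log_le_log hh hhg)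
  rcases le_total X Y with hle | hle
  · have : 0 ≤ (X + Y) / 2 * (Real.log g - Real.log h) := by positivity
    linarith
  have h1 : Real.log (X / Y) ≤ Real.log g - Real.log h := by
    rw [← Real.log_div hg.ne' hh.ne']
    refine Real.log_le_log (div_pos hX hY) ?_
    rw [div_le_div_iff₀ hY hh]
    linarith
  have h2 := Real.le_log_one_add_of_nonneg (x := X / Y - 1)
    (sub_nonneg.2 ((one_le_div hY).2 hle))
  have h3 : 2 * (X / Y - 1) / (X / Y - 1 + 2) = 2 * (X - Y) / (X + Y) := by
    field_simp
    ring
  rw [h3, add_sub_cancel] at h2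
  have h4 := h2.trans h1
  rw [div_le_iff₀ (by positivity)] at h4
  linarith

/-- The second difference of the free energy over an interval. -/
theorem secondDifference_le (hH : ∀ x, 1 ≤ H x) (lo : ℝ) {a b : ℝ} (hab : a ≤ b) :
    2 * freeDiff H lo ((a + b) / 2) - freeDiff H lo a - freeDiff H lo b ≤
      (freeDiff H lo b - freeDiff H lo a) / 2 *
        (Real.log (meanEnergy H a) - Real.log (meanEnergy H b)) := by
  have hH0 : ∀ x, 0 < H x := fun x => one_pos.trans_le (hH x)
  rcases hab.eq_or_lt with rfl | hab
  · rw [add_self_div_two]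
    simp
    linarith
  have hmono := strictMono_freeDiff hH0 lo
  have hbound : ∀ x, H x ∈ Set.Icc 1 (∑ y, H y) := fun x =>
    ⟨hH x, Finset.single_le_sum (f := H) (fun y _ => (hH0 y).le) (Finset.mem_univ x)⟩
  have hga := one_pos.trans_le (meanEnergy_mem_Icc hbound a).1
  have hgb := one_pos.trans_le (meanEnergy_mem_Icc hbound b).1
  have h1 := freeDiff_sub_le_mul_meanEnergy H lo a ((a + b) / 2)
  have h2 := freeDiff_sub_le_mul_meanEnergy H lo b ((a + b) / 2)
  have h3 := hmono (show a < (a + b) / 2 by linarith)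
  have h4 := hmono (show (a + b) / 2 < b by linarith)
  -- X and Y are the increments of z over the two halves of [a, b]. The tangents at the ends bound X
  -- above by the slope at `a` and Y below by the slope at `b`, each times half the length.
  have key := sub_le_half_add_mul_log (X := freeDiff H lo ((a + b) / 2) - freeDiff H lo a)
    (Y := freeDiff H lo b - freeDiff H lo ((a + b) / 2)) (sub_pos.2 h3) (sub_pos.2 h4) hga hgb
    (antitone_meanEnergy H hab.le) (by
      have e1 : (freeDiff H lo ((a + b) / 2) - freeDiff H lo a) * meanEnergy H b ≤
          ((a + b) / 2 - a) * meanEnergy H a * meanEnergy H b :=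
        mul_le_mul_of_nonneg_right h1 hgb.le
      have e2 : (b - (a + b) / 2) * meanEnergy H b * meanEnergy H a ≤
          (freeDiff H lo b - freeDiff H lo ((a + b) / 2)) * meanEnergy H a :=
        mul_le_mul_of_nonneg_right (by linarith) hga.le
      have e3 : ((a + b) / 2 - a) * meanEnergy H a * meanEnergy H b =
        (b - (a + b) / 2) * meanEnergy H b * meanEnergy H a := by ring
      linarith)
  calc _ = freeDiff H lo ((a + b) / 2) - freeDiff H lo a -
        (freeDiff H lo b - freeDiff H lo ((a + b) / 2)) := by ring
    _ ≤ _ := key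
    _ = _ := by ring

/-- The logarithm of the relative second moment of the paired product estimator. -/
noncomputable def curvature (H : α → ℝ) (lo : ℝ) (s : List ℝ) : ℝ :=
  ∑ i ∈ Finset.range (s.length - 1),
    (2 * freeDiff H lo ((s.getD i 0 + s.getD (i + 1) 0) / 2) - freeDiff H lo (s.getD i 0) -
      freeDiff H lo (s.getD (i + 1) 0))

/-- The contribution of the long intervals of the schedule. -/
noncomputable def excess (H : α → ℝ) (lo θ : ℝ) (s : List ℝ) : ℝ≥0∞ :=
  ∑ i ∈ Finset.range (s.length - 1),
    ENNReal.ofReal (freeDiff H lo (s.getD (i + 1) 0) - freeDiff H lo (s.getD i 0) - θ) *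
      ENNReal.ofReal (Real.log (meanEnergy H (s.getD i 0)) -
        Real.log (meanEnergy H (s.getD (i + 1) 0)))

theorem log_meanEnergy_sub_nonneg {n : ℝ} (hH : ∀ x, H x ∈ Set.Icc 1 n) {a b : ℝ} (hab : a ≤ b) :
    0 ≤ Real.log (meanEnergy H a) - Real.log (meanEnergy H b) :=
  sub_nonneg.2 (Real.log_le_log (one_pos.trans_le (meanEnergy_mem_Icc hH b).1)
    (antitone_meanEnergy H hab))

theorem log_meanEnergy_sub_le {n : ℝ} (hH : ∀ x, H x ∈ Set.Icc 1 n) (a b : ℝ) :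
    Real.log (meanEnergy H a) - Real.log (meanEnergy H b) ≤ Real.log n := by
  have h1 := Real.log_le_log (one_pos.trans_le (meanEnergy_mem_Icc hH a).1)
    (meanEnergy_mem_Icc hH a).2
  have h2 := Real.log_nonneg (meanEnergy_mem_Icc hH b).1
  linarith

/-- Split each length as δ ≤ θ + (δ - θ)⁺. The drops of the logarithmic mean energy telescope to at
most ln n in the first part, and the second part is the excess. -/
theorem curvature_le {n θ T : ℝ} (hH : ∀ x, H x ∈ Set.Icc 1 n) (lo : ℝ) {s : List ℝ}
    (hs : s.Pairwise (· ≤ ·)) (hθ : 0 ≤ θ) (hT : 0 ≤ T) (hex : excess H lo θ s ≤ ENNReal.ofReal T) :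
    curvature H lo s ≤ (θ * Real.log n + T) / 2 := by
  set δ : ℕ → ℝ := fun i => freeDiff H lo (s.getD (i + 1) 0) - freeDiff H lo (s.getD i 0) with hδ
  set w : ℕ → ℝ := fun i => Real.log (meanEnergy H (s.getD i 0)) with hw
  have hsle : ∀ i ∈ Finset.range (s.length - 1), s.getD i 0 ≤ s.getD (i + 1) 0 := fun i hi =>
    getD_le_getD hs (Nat.le_succ i) (by have := Finset.mem_range.1 hi; omega)
  have hwn : ∀ i ∈ Finset.range (s.length - 1), 0 ≤ w i - w (i + 1) := fun i hi =>
    log_meanEnergy_sub_nonneg hH (hsle i hi)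
  have h1 : ∑ i ∈ Finset.range (s.length - 1), max (δ i - θ) 0 * (w i - w (i + 1)) ≤ T := by
    rw [← ENNReal.ofReal_le_ofReal_iff hT, ENNReal.ofReal_sum_of_nonneg fun i hi =>
      mul_nonneg (le_max_right _ _) (hwn i hi)]
    refine le_trans (le_of_eq (Finset.sum_congr rfl fun i hi => ?_)) hex
    rw [ENNReal.ofReal_mul (le_max_right _ _)]
    congr 1
    rcases le_total (δ i - θ) 0 with h | h
    · rw [max_eq_right h, ENNReal.ofReal_of_nonpos h, ENNReal.ofReal_zero]
    · rw [max_eq_left h]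
  have h2 : ∑ i ∈ Finset.range (s.length - 1), (w i - w (i + 1)) ≤ Real.log n := by
    rw [Finset.sum_range_sub']
    exact log_meanEnergy_sub_le hH _ _
  have h3 : curvature H lo s ≤ ∑ i ∈ Finset.range (s.length - 1),
      (θ * (w i - w (i + 1)) + max (δ i - θ) 0 * (w i - w (i + 1))) / 2 := by
    refine Finset.sum_le_sum fun i hi => ?_
    refine (secondDifference_le (fun x => (hH x).1) lo (hsle i hi)).trans ?_
    have h4 : δ i ≤ θ + max (δ i - θ) 0 := by linarith [le_max_left (δ i - θ) 0]
    have h5 := mul_le_mul_of_nonneg_right h4 (hwn i hi)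
    rw [add_mul] at h5
    change δ i / 2 * (w i - w (i + 1)) ≤ _
    linarith
  rw [← Finset.sum_div, Finset.sum_add_distrib, ← Finset.mul_sum] at h3
  have h6 := mul_le_mul_of_nonneg_left h2 hθ
  linarith

end Curvature

/-! ### Incomplete gamma functions and Poisson sums -/

section ExpSum

/-- The function `e^{-x} ∑_{j < D} a_j x^j / j!`. -/
noncomputable def expSum (a : ℕ → ℝ) (D : ℕ) (x : ℝ) : ℝ :=
  Real.exp (-x) * ∑ j ∈ Finset.range D, a j * (x ^ j / j.factorial)

theorem hasDerivAt_sum_pow_div_factorial (a : ℕ → ℝ) (D : ℕ) (x : ℝ) :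
    HasDerivAt (fun x : ℝ => ∑ j ∈ Finset.range (D + 1), a j * (x ^ j / j.factorial))
      (∑ j ∈ Finset.range D, a (j + 1) * (x ^ j / j.factorial)) x := by
  have h : HasDerivAt (fun x : ℝ => ∑ j ∈ Finset.range (D + 1), a j * (x ^ j / j.factorial))
      (∑ j ∈ Finset.range (D + 1), a j * (j * x ^ (j - 1) / j.factorial)) x :=
    HasDerivAt.fun_sum fun j _ => ((hasDerivAt_pow j x).div_const _).const_mul _
  refine h.congr_deriv ?_
  rw [Finset.sum_range_succ']
  simp only [Nat.cast_zero, zero_mul, zero_div, mul_zero, add_zero, Nat.add_sub_cancel]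
  refine Finset.sum_congr rfl fun j _ => ?_
  rw [Nat.factorial_succ]
  push_cast
  field_simp

/-- Differentiation acts on the coefficients as the forward difference. The condition `a D = 0`
allows one more term in the sum, so that the shifted sum has the same range. -/
theorem hasDerivAt_expSum {a : ℕ → ℝ} {D : ℕ} (ha : a D = 0) (x : ℝ) :
    HasDerivAt (expSum a D) (expSum (fun j => a (j + 1) - a j) D x) x := by
  have h1 : expSum a D =
      fun x => Real.exp (-x) * ∑ j ∈ Finset.range (D + 1), a j * (x ^ j / j.factorial) := by
    ext y
    rw [Finset.sum_range_succ, ha, zero_mul, add_zero, expSum]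
  rw [h1]
  refine (((hasDerivAt_neg x).exp).mul (hasDerivAt_sum_pow_div_factorial a D x)).congr_deriv ?_
  rw [Finset.sum_range_succ, ha, zero_mul, add_zero, expSum]
  simp only [sub_mul, Finset.sum_sub_distrib]
  ring

theorem tendsto_expSum (a : ℕ → ℝ) (D : ℕ) : Tendsto (expSum a D) atTop (𝓝 0) := by
  have h : ∀ j, Tendsto (fun x : ℝ => a j / j.factorial * (x ^ j * Real.exp (-x))) atTop (𝓝 0) :=
    fun j => by
      simpa using (Real.tendsto_pow_mul_exp_neg_atTop_nhds_zero j).const_mul (a j / j.factorial)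
  have h2 := tendsto_finsetSum (Finset.range D) fun j _ => h j
  rw [Finset.sum_const_zero] at h2
  refine h2.congr fun x => ?_
  rw [expSum, Finset.mul_sum]
  exact Finset.sum_congr rfl fun j _ => by ring

theorem continuous_expSum (a : ℕ → ℝ) (D : ℕ) : Continuous (expSum a D) := by
  unfold expSum
  fun_prop

theorem expSum_nonneg {a : ℕ → ℝ} {D : ℕ} (ha : ∀ j < D, 0 ≤ a j) {x : ℝ} (hx : 0 ≤ x) :
    0 ≤ expSum a D x :=
  mul_nonneg (Real.exp_pos _).le (Finset.sum_nonneg fun j hj =>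
    mul_nonneg (ha j (Finset.mem_range.1 hj)) (by positivity))

theorem expSum_neg (a : ℕ → ℝ) (D : ℕ) (x : ℝ) :
    expSum (fun j => -a j) D x = -expSum a D x := by
  rw [expSum, expSum, ← mul_neg, ← Finset.sum_neg_distrib]
  simp only [neg_mul]

/-- Decreasing coefficients make the integrand nonnegative, so integrability comes with the
fundamental theorem. Tail integrals thus reduce to finding coefficients with prescribed differences.
-/
theorem integral_Ioi_expSum {a : ℕ → ℝ} {D : ℕ} (ha : a D = 0) (hdec : ∀ j < D, a (j + 1) ≤ a j)
    {x : ℝ} (hx : 0 ≤ x) :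
    IntegrableOn (expSum (fun j => a j - a (j + 1)) D) (Set.Ioi x) ∧
      ∫ y in Set.Ioi x, expSum (fun j => a j - a (j + 1)) D y = expSum a D x := by
  have hd : ∀ y ∈ Set.Ici x, HasDerivAt (fun y => -expSum a D y)
      (expSum (fun j => a j - a (j + 1)) D y) y := fun y _ => by
    refine (hasDerivAt_expSum ha y).neg.congr_deriv ?_
    rw [← expSum_neg]
    simp only [neg_sub]
  have hn : ∀ y ∈ Set.Ioi x, 0 ≤ expSum (fun j => a j - a (j + 1)) D y := fun y hy =>
    expSum_nonneg (fun j hj => sub_nonneg.2 (hdec j hj)) (hx.trans (le_of_lt hy))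
  have ht : Tendsto (fun y => -expSum a D y) atTop (𝓝 0) := by
    simpa using (tendsto_expSum a D).neg
  refine ⟨integrableOn_Ioi_deriv_of_nonneg' hd hn ht, ?_⟩
  rw [integral_Ioi_of_hasDerivAt_of_nonneg' hd hn ht]
  ring

theorem upperGamma_eq (d : ℕ) {x : ℝ} (hx : 0 ≤ x) :
    upperGamma (d + 2) x = (d + 1).factorial * expSum (fun _ => 1) (d + 2) x := by
  -- The differences `a j - a (j + 1)` vanish except at `j = d + 1`, which leaves the single term
  -- t^(d+1) e^(-t) / (d+1)!.
  set a : ℕ → ℝ := fun j => if j < d + 2 then 1 else 0 with ha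
  have h1 : expSum (fun _ => 1) (d + 2) x = expSum a (d + 2) x := by
    rw [expSum, expSum]
    congr 1
    refine Finset.sum_congr rfl fun j hj => ?_
    simp only [ha, if_pos (Finset.mem_range.1 hj)]
  have h2 := (integral_Ioi_expSum (a := a) (D := d + 2) (by simp [ha])
    (fun j hj => by
      simp only [ha, if_pos hj]
      split_ifs
      · exact le_rfl
      · exact zero_le_one) hx).2
  rw [h1, ← h2, upperGamma, ← integral_const_mul]
  refine integral_congr_ae (ae_of_all _ fun t => ?_)
  simp only [expSum]
  rw [Finset.sum_eq_single (d + 1)]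
  · have h3 : ((d : ℝ) + 2 - 1) = ((d + 1 : ℕ) : ℝ) := by push_cast; ring
    rw [h3, Real.rpow_natCast]
    simp only [ha]
    rw [if_pos (by omega), if_neg (by omega)]
    field_simp
    ring
  · intro j hj hne
    have := Finset.mem_range.1 hj
    simp only [ha]
    rw [if_pos (by omega), if_pos (by omega), sub_self, zero_mul]
  · intro h
    exact absurd (Finset.mem_range.2 (by omega)) h

theorem poissonDeficit_eq_expSum (d : ℕ) (x : ℝ) :
    poissonDeficit d x = expSum (fun j => (d : ℝ) - j) d x := by
  rw [poissonDeficit, expSum, Finset.mul_sum]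
  exact Finset.sum_congr rfl fun j _ => by ring

theorem poissonDeficit_nonneg (d : ℕ) {x : ℝ} (hx : 0 ≤ x) : 0 ≤ poissonDeficit d x := by
  rw [poissonDeficit_eq_expSum]
  exact expSum_nonneg (fun j hj => sub_nonneg.2 (Nat.cast_le.2 hj.le)) hx

theorem continuous_poissonDeficit (d : ℕ) : Continuous (poissonDeficit d) := by
  unfold poissonDeficit
  fun_prop

/-- The antiderivative of `poissonDeficit d` that vanishes at infinity, up to sign. -/
noncomputable def deficitTail (d : ℕ) : ℝ → ℝ :=
  expSum (fun j => ((d : ℝ) - j) * ((d : ℝ) - j + 1) / 2) d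

theorem lintegral_Ioi_poissonDeficit (d : ℕ) {k : ℝ} (hk : 0 < k) {x : ℝ} (hx : 0 ≤ x) :
    ∫⁻ y in Set.Ioi x, ENNReal.ofReal (poissonDeficit d (k * y)) =
      ENNReal.ofReal (deficitTail d (k * x) / k) := by
  have h1 := integral_Ioi_expSum (a := fun j => ((d : ℝ) - j) * ((d : ℝ) - j + 1) / 2) (D := d)
    (by simp) (fun j hj => by
      have : (j : ℝ) + 1 ≤ d := by exact_mod_cast hj
      push_cast
      nlinarith) (mul_nonneg hk.le hx)
  have h2 : expSum (fun j => ((d : ℝ) - j) * ((d : ℝ) - j + 1) / 2 -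
      ((d : ℝ) - (j + 1 : ℕ)) * ((d : ℝ) - (j + 1 : ℕ) + 1) / 2) d = poissonDeficit d := by
    ext y
    rw [poissonDeficit_eq_expSum]
    congr 1
    ext j
    push_cast
    ring
  rw [h2] at h1
  rw [← ofReal_integral_eq_lintegral_ofReal]
  · congr 1
    have h3 := integral_comp_mul_left_Ioi (fun y => poissonDeficit d y) x hk
    rw [h3, h1.2, smul_eq_mul, deficitTail, inv_mul_eq_div]
  · have h3 := (integrableOn_Ioi_comp_mul_left_iff (poissonDeficit d) x hk).2 h1.1
    exact h3
  · refine (ae_restrict_iff' measurableSet_Ioi).2 (ae_of_all _ fun y hy => ?_)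
    exact poissonDeficit_nonneg d (mul_nonneg hk.le (hx.trans (le_of_lt hy)))

/-- Multiplication by x shifts the index, and coefficientwise the claim is (d - j)(d - j + 1) + j (d
- j + 1) = d (d - j + 1). -/
theorem two_mul_deficitTail_add (d : ℕ) (x : ℝ) :
    2 * deficitTail d x + x * poissonDeficit d x = d * poissonDeficit (d + 1) x := by
  have h1 : 2 * deficitTail d x = Real.exp (-x) *
      ∑ j ∈ Finset.range (d + 1), ((d : ℝ) - j) * ((d : ℝ) - j + 1) * (x ^ j / j.factorial) := by
    rw [deficitTail, expSum, Finset.sum_range_succ, sub_self, zero_mul, zero_mul, add_zero,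
      mul_left_comm, Finset.mul_sum]
    congr 1
    exact Finset.sum_congr rfl fun j _ => by ring
  have h2 : x * poissonDeficit d x = Real.exp (-x) *
      ∑ j ∈ Finset.range (d + 1), (j : ℝ) * ((d : ℝ) - j + 1) * (x ^ j / j.factorial) := by
    rw [poissonDeficit_eq_expSum, expSum, Finset.sum_range_succ', Nat.cast_zero, zero_mul, zero_mul,
      add_zero, mul_left_comm, Finset.mul_sum]
    congr 1
    refine Finset.sum_congr rfl fun j _ => ?_
    rw [Nat.factorial_succ]
    push_cast
    field_simp
    ring
  rw [h1, h2, ← mul_add, ← Finset.sum_add_distrib, poissonDeficit_eq_expSum, expSum,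
    mul_left_comm, Finset.mul_sum _ _ (d : ℝ)]
  congr 1
  refine Finset.sum_congr rfl fun j _ => ?_
  push_cast
  ring

/-- Bound the weights d + 1 - j by d + 1 and add the nonnegative term `j = d + 1`. -/
theorem poissonDeficit_succ_le (d : ℕ) {x : ℝ} (hx : 0 ≤ x) :
    poissonDeficit (d + 1) x ≤ upperGamma (d + 2) x / d.factorial := by
  rw [upperGamma_eq d hx, poissonDeficit_eq_expSum, le_div_iff₀ (by positivity), expSum, expSum,
    mul_assoc, mul_left_comm ((d + 1).factorial : ℝ)]
  refine mul_le_mul_of_nonneg_left ?_ (Real.exp_pos _).le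
  rw [Finset.sum_mul, Finset.mul_sum, Finset.sum_range_succ _ (d + 1)]
  refine le_add_of_le_of_nonneg (Finset.sum_le_sum fun j _ => ?_) (by positivity)
  rw [Nat.factorial_succ]
  push_cast
  have h1 : (0 : ℝ) ≤ x ^ j / j.factorial := by positivity
  have h2 : (0 : ℝ) ≤ d.factorial := by positivity
  have h3 : (0 : ℝ) ≤ j := j.cast_nonneg
  have h4 := mul_nonneg (mul_nonneg h3 h1) h2
  linarith

/-- Integral of the probability that no point of a stationary schedule separates `[x, x + θ]`
from `y`. -/
theorem lintegral_poissonDeficit_le (d : ℕ) {k : ℝ} (hk : 0 < k) {θ : ℝ} (hθ : 0 ≤ θ) (y : ℝ) :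
    ∫⁻ x, ENNReal.ofReal (poissonDeficit d (k * (max (x + θ) y - min x y))) ≤
      ENNReal.ofReal (d / k * (upperGamma (d + 2) (k * θ) / d.factorial)) := by
  set f : ℝ → ℝ≥0∞ := fun s => ENNReal.ofReal (poissonDeficit d (k * s)) with hf
  have hfm : Measurable f := by
    have := continuous_poissonDeficit d
    fun_prop
  set F : ℝ → ℝ≥0∞ := (Set.Ioi θ).indicator f with hF
  have hFm : Measurable F := hfm.indicator measurableSet_Ioi
  -- The point y lies to the right of [x, x + θ], in it, or to its left; the span has length y - x,
  -- θ or x + θ - y. The two outer cases each integrate to a tail beyond θ, the middle one to θ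
  -- times a constant, and `two_mul_deficitTail_add` sums the three.
  have hle : ∀ x, ENNReal.ofReal (poissonDeficit d (k * (max (x + θ) y - min x y))) ≤
      (Set.Icc (y - θ) y).indicator (fun _ => f θ) x + (F (y - x) + F (x + (θ - y))) := by
    intro x
    change f (max (x + θ) y - min x y) ≤ _
    rcases lt_or_ge x (y - θ) with h | h
    · rw [max_eq_right (by linarith), min_eq_left (by linarith)]
      refine le_add_left (le_add_right ?_)
      rw [hF, Set.indicator_of_mem (show y - x ∈ Set.Ioi θ by rw [Set.mem_Ioi]; linarith)]
    rcases le_or_gt x y with h' | h'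
    · rw [max_eq_left (by linarith), min_eq_left (by linarith), add_sub_cancel_left]
      refine le_add_right ?_
      rw [Set.indicator_of_mem (show x ∈ Set.Icc (y - θ) y from ⟨h, h'⟩)]
    · rw [max_eq_left (by linarith), min_eq_right (by linarith), add_sub_assoc]
      refine le_add_left (le_add_left ?_)
      rw [hF, Set.indicator_of_mem (show x + (θ - y) ∈ Set.Ioi θ by rw [Set.mem_Ioi]; linarith)]
  have hFi : ∫⁻ x, F x = ENNReal.ofReal (deficitTail d (k * θ) / k) := by
    rw [hF, lintegral_indicator measurableSet_Ioi]
    exact lintegral_Ioi_poissonDeficit d hk hθ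
  have hkθ : 0 ≤ k * θ := mul_nonneg hk.le hθ
  have htail : 0 ≤ deficitTail d (k * θ) := expSum_nonneg (fun j hj => by
    have : (j : ℝ) ≤ d := Nat.cast_le.2 hj.le
    have := sub_nonneg.2 this
    positivity) hkθ
  have hpd := poissonDeficit_nonneg d hkθ
  have hFm' : Measurable fun x => F (y - x) := hFm.comp (measurable_const.sub measurable_id)
  refine (lintegral_mono hle).trans ?_
  rw [lintegral_add_left (measurable_const.indicator measurableSet_Icc),
    lintegral_add_left hFm',
    lintegral_indicator_const measurableSet_Icc, lintegral_sub_left_eq_self,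
    lintegral_add_right_eq_self, hFi, Real.volume_Icc, sub_sub_cancel, hf,
    ← ENNReal.ofReal_mul hpd, ← ENNReal.ofReal_add (by positivity) (by positivity),
    ← ENNReal.ofReal_add (by positivity) (by positivity)]
  refine ENNReal.ofReal_le_ofReal ?_
  calc _ = d / k * poissonDeficit (d + 1) (k * θ) := by
        rw [div_mul_eq_mul_div, ← two_mul_deficitTail_add]
        field_simp
        ring
    _ ≤ _ := mul_le_mul_of_nonneg_left (poissonDeficit_succ_le d hkθ) (by positivity)

end ExpSum

/-! ### The expected contribution of the long intervals of the schedule -/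

section Excess

variable {α : Type*} [Fintype α] [Nonempty α] {H : α → ℝ} {lo hi θ : ℝ}

/-- Minus the logarithm of the mean energy, as a Stieltjes function. -/
noncomputable def energyStieltjes (hH : ∀ x, 1 ≤ H x) : StieltjesFunction ℝ where
  toFun β := -Real.log (meanEnergy H β)
  mono' a b hab := by
    have hbound : ∀ x, H x ∈ Set.Icc 1 (∑ y, H y) := fun x => ⟨hH x,
      Finset.single_le_sum (f := H) (fun y _ => zero_le_one.trans (hH y)) (Finset.mem_univ x)⟩
    have := log_meanEnergy_sub_nonneg hbound hab
    simp only
    linarith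
  right_continuous' β := by
    have hbound : ∀ x, H x ∈ Set.Icc 1 (∑ y, H y) := fun x => ⟨hH x,
      Finset.single_le_sum (f := H) (fun y _ => zero_le_one.trans (hH y)) (Finset.mem_univ x)⟩
    exact (((continuous_meanEnergy H).log fun β =>
      (one_pos.trans_le (meanEnergy_mem_Icc hbound β).1).ne').neg).continuousWithinAt

theorem energyStieltjes_measure_Ioc (hH : ∀ x, 1 ≤ H x) (a b : ℝ) :
    (energyStieltjes hH).measure (Set.Ioc a b) =
      ENNReal.ofReal (Real.log (meanEnergy H a) - Real.log (meanEnergy H b)) := by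
  rw [StieltjesFunction.measure_Ioc]
  congr 1
  change -Real.log (meanEnergy H b) - -Real.log (meanEnergy H a) = _
  ring

/-- The parameters whose free energy lies strictly between `min x y` and `max (x + θ) y`, where
`y` is the free energy of `t`. -/
def spanSet (H : α → ℝ) (lo hi θ : ℝ) (p : ℝ × ℝ) : Set ℝ :=
  {β | β ∈ Set.Icc lo hi ∧ min p.2 (freeDiff H lo p.1) < freeDiff H lo β ∧
    freeDiff H lo β < max (p.2 + θ) (freeDiff H lo p.1)}

theorem ordConnected_spanSet (hH : ∀ x, 0 < H x) (p : ℝ × ℝ) :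
    (spanSet H lo hi θ p).OrdConnected := by
  have hmono := (strictMono_freeDiff hH lo).monotone
  refine ⟨fun a ha b hb x hx => ⟨⟨ha.1.1.trans hx.1, hx.2.trans hb.1.2⟩, ?_, ?_⟩⟩
  · exact ha.2.1.trans_le (hmono hx.1)
  · exact (hmono hx.2).trans_lt hb.2.2

/-- The measure on pairs `(t, x)` that is used to expand the excess. -/
noncomputable def spanMeasure (hH : ∀ x, 1 ≤ H x) (lo hi θ : ℝ) : Measure (ℝ × ℝ) :=
  ((energyStieltjes hH).measure.restrict (Set.Ioc lo hi)).prod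
    (volume.restrict (Set.Icc 0 (freeDiff H lo hi - θ)))

instance (hH : ∀ x, 1 ≤ H x) (lo hi θ : ℝ) : SFinite (spanMeasure hH lo hi θ) := by
  unfold spanMeasure
  infer_instance

/-- The rectangle in `(t, x)` that corresponds to the interval number `i` of a schedule. -/
def spanRect (H : α → ℝ) (lo θ : ℝ) (s : List ℝ) (i : ℕ) : Set (ℝ × ℝ) :=
  Set.Ioc (s.getD i 0) (s.getD (i + 1) 0) ×ˢ
    Set.Icc (freeDiff H lo (s.getD i 0)) (freeDiff H lo (s.getD (i + 1) 0) - θ)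

theorem measurableSet_spanRect (H : α → ℝ) (lo θ : ℝ) (s : List ℝ) (i : ℕ) :
    MeasurableSet (spanRect H lo θ s i) :=
  measurableSet_Ioc.prod measurableSet_Icc

/-- Each summand is the measure of a rectangle: the drop of ln z' is the Stieltjes mass of the
t-interval and (δ - θ)⁺ the length of the x-interval, which is empty when δ < θ. -/
theorem excess_eq_lintegral (hH : ∀ x, 1 ≤ H x) {s : List ℝ}
    (hs : ∀ i < s.length, s.getD i 0 ∈ Set.Icc lo hi) :
    excess H lo θ s = ∫⁻ p, ∑ i ∈ Finset.range (s.length - 1),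
      (spanRect H lo θ s i).indicator 1 p ∂(spanMeasure hH lo hi θ) := by
  have hmono := (strictMono_freeDiff (fun x => one_pos.trans_le (hH x)) lo).monotone
  rw [lintegral_finsetSum _ fun i _ => measurable_one.indicator (measurableSet_spanRect H lo θ s i)]
  refine Finset.sum_congr rfl fun i hi' => ?_
  have hi1 : i + 1 < s.length := by have := Finset.mem_range.1 hi'; omega
  have h1 := hs i (by omega)
  have h2 := hs (i + 1) hi1
  rw [lintegral_indicator_one (measurableSet_spanRect H lo θ s i), spanRect, spanMeasure,
    Measure.prod_prod, Measure.restrict_eq_self _ (Set.Ioc_subset_Ioc h1.1 h2.2),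
    Measure.restrict_eq_self, energyStieltjes_measure_Ioc, Real.volume_Icc, mul_comm, sub_right_comm]
  refine Set.Icc_subset_Icc ?_ (sub_le_sub_right (hmono h2.2) _)
  exact (freeDiff_self H lo).ge.trans (hmono h1.1)

/-- The half-open t-intervals are disjoint, so at most one rectangle contains `p`. Its schedule
interval then covers the span of `p`, and kept points cannot lie strictly inside a schedule
interval. -/
theorem sum_indicator_spanRect_le (hH : ∀ x, 0 < H x) (hlh : lo ≤ hi) {d c : ℕ} {U : Multiset ℝ}
    (hU : ∀ x ∈ U, x ∈ Set.Icc lo hi) (p : ℝ × ℝ) [Decidable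
      (∀ x ∈ everyNth d c (U.sort (· ≤ ·)), x ∉ spanSet H lo hi θ p)] :
    ∑ i ∈ Finset.range ((schedule lo hi d c U).length - 1),
      (spanRect H lo θ (schedule lo hi d c U) i).indicator (1 : ℝ × ℝ → ℝ≥0∞) p ≤
      if ∀ x ∈ everyNth d c (U.sort (· ≤ ·)), x ∉ spanSet H lo hi θ p then 1 else 0 := by
  have hmono := strictMono_freeDiff hH lo
  have hsort := pairwise_schedule hlh d c hU
  set s := schedule lo hi d c U with hs
  by_cases hex : ∃ i ∈ Finset.range (s.length - 1), p ∈ spanRect H lo θ s i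
  · obtain ⟨i, hi', hpi⟩ := hex
    have hi1 : i + 1 < s.length := by have := Finset.mem_range.1 hi'; omega
    rw [Finset.sum_eq_single_of_mem i hi', Set.indicator_of_mem hpi, if_pos, Pi.one_apply]
    · intro x hx hxs
      obtain ⟨⟨ht1, ht2⟩, hx1, hx2⟩ := hpi
      rcases le_or_le_of_mem_everyNth hlh hU hx hi1 with h | h
      · refine not_le.2 hxs.2.1 (le_min ?_ ?_)
        · exact (hmono.monotone h).trans hx1
        · exact hmono.monotone (h.trans ht1.le)
      · refine not_le.2 hxs.2.2 (max_le ?_ ?_)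
        · exact (le_sub_iff_add_le.1 hx2).trans (hmono.monotone h)
        · exact hmono.monotone (ht2.trans h)
    · intro j hj hne
      have hj1 : j + 1 < s.length := by have := Finset.mem_range.1 hj; omega
      refine Set.indicator_of_notMem (fun hpj => ?_) _
      rcases lt_or_gt_of_ne hne with h | h
      · exact not_le.2 hpi.1.1 (hpj.1.2.trans (getD_le_getD hsort h (by omega)))
      · exact not_le.2 hpj.1.1 (hpi.1.2.trans (getD_le_getD hsort h (by omega)))
  · rw [Finset.sum_eq_zero]
    · exact zero_le
    · intro i hi'
      exact Set.indicator_of_notMem (fun h => hex ⟨i, hi', h⟩) _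

-- Exchanging the sum over offsets with the integral turns the integrand into the number of offsets
-- that keep no point in the span.
open Classical in
theorem sum_excess_le (hH : ∀ x, 1 ≤ H x) (hlh : lo ≤ hi) {d : ℕ} (hd : 1 ≤ d) {U : Multiset ℝ}
    (hU : ∀ x ∈ U, x ∈ Set.Icc lo hi) :
    ∑ c : Fin d, excess H lo θ (schedule lo hi d c U) ≤
      ∫⁻ p, ((d : ℝ≥0∞) - (U.countP (· ∈ spanSet H lo hi θ p) : ℕ)) ∂(spanMeasure hH lo hi θ) := by
  have hH0 : ∀ x, 0 < H x := fun x => one_pos.trans_le (hH x)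
  have h1 : ∀ c : Fin d, excess H lo θ (schedule lo hi d c U) = _ := fun c =>
    excess_eq_lintegral (θ := θ) hH fun i hi' => schedule_getD_mem_Icc hlh hU hi'
  simp only [h1]
  rw [← lintegral_finsetSum _ fun c _ => Finset.measurable_sum _ fun i _ =>
    measurable_one.indicator (measurableSet_spanRect H lo θ _ i)]
  refine lintegral_mono fun p => ?_
  refine (Finset.sum_le_sum fun c _ => sum_indicator_spanRect_le hH0 hlh hU p).trans ?_
  rw [Finset.sum_boole]
  have h2 := card_offsets_avoiding_le hd (Multiset.pairwise_sort U (· ≤ ·))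
    (ordConnected_spanSet (lo := lo) (hi := hi) (θ := θ) hH0 p)
  rw [← Multiset.coe_countP, Multiset.sort_eq] at h2
  rw [← ENNReal.natCast_sub]
  exact Nat.cast_le.2 h2

end Excess

/-! ### Averaging the excess over the TPA runs -/

section ExpectedExcess

variable {α S : Type*} [Fintype α] [MeasurableSpace α] [MeasurableSingletonClass α] [Nonempty α]
  [MeasurableSpace S] {ν : Measure S} [IsProbabilityMeasure ν] {H : α → ℝ} {lo hi θ : ℝ}
  {oracle : ℝ → S → α} {k d : ℕ}

/-- The restriction of `spanMeasure` to these ranges of t and x keeps the span inside [0, q], where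
the Poisson law is available. -/
theorem isFreeInterval_spanSet (hH : ∀ x, 0 < H x) {p : ℝ × ℝ} (hp1 : p.1 ∈ Set.Ioc lo hi)
    (hp2 : p.2 ∈ Set.Icc 0 (freeDiff H lo hi - θ)) :
    IsFreeInterval H lo hi (spanSet H lo hi θ p) (min p.2 (freeDiff H lo p.1))
      (max (p.2 + θ) (freeDiff H lo p.1)) := by
  have hmono := strictMono_freeDiff hH lo
  have hmax : max (p.2 + θ) (freeDiff H lo p.1) ≤ freeDiff H lo hi :=
    max_le (by linarith [hp2.2]) (hmono.monotone hp1.2)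
  have hmin : 0 ≤ min p.2 (freeDiff H lo p.1) := by
    refine le_min hp2.1 ?_
    rw [← freeDiff_self H lo]
    exact hmono.monotone hp1.1.le
  refine ⟨?_, fun β hβ => hβ.1.2, ?_, hmax, fun β h1 h2 => ⟨⟨?_, ?_⟩, h1, h2⟩,
    fun β hβ => ⟨hβ.2.1.le, hβ.2.2.le⟩⟩
  · exact (ordConnected_spanSet hH p).measurableSet
  · exact (min_le_right _ _).trans (le_max_right _ _)
  · refine (hmono.lt_iff_lt.1 ?_).le
    rw [freeDiff_self]
    exact hmin.trans_lt h1
  · exact (hmono.lt_iff_lt.1 (h2.trans_le hmax)).le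

theorem measurable_unionVisits_spanSet (ho : IsGibbsOracle H lo hi ν oracle) (θ : ℝ) :
    Measurable fun x : (Fin k → ℕ → S × I) × ℝ × ℝ =>
      unionVisits H oracle (spanSet H lo hi θ x.2) lo x.1 := by
  refine Finset.measurable_sum _ fun j _ => Measurable.tsum fun i => ?_
  have hpath : Measurable fun x : (Fin k → ℕ → S × I) × ℝ × ℝ =>
      tpaPath H oracle lo (x.1 j) (i + 1) :=
    (measurable_uncurry_tpaPath H ho.measurable (i + 1)).comp
      (measurable_const.prodMk ((measurable_pi_apply j).comp measurable_fst))
  have hfree := (continuous_freeDiff H lo).measurable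
  have hset : MeasurableSet {x : (Fin k → ℕ → S × I) × ℝ × ℝ |
      tpaPath H oracle lo (x.1 j) (i + 1) ∈ spanSet H lo hi θ x.2} := by
    have m1 : Measurable fun x : (Fin k → ℕ → S × I) × ℝ × ℝ =>
        freeDiff H lo (tpaPath H oracle lo (x.1 j) (i + 1)) := hfree.comp hpath
    have m2 : Measurable fun x : (Fin k → ℕ → S × I) × ℝ × ℝ => freeDiff H lo x.2.1 :=
      hfree.comp (measurable_fst.comp measurable_snd)
    have m3 : Measurable fun x : (Fin k → ℕ → S × I) × ℝ × ℝ => x.2.2 :=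
      measurable_snd.comp measurable_snd
    exact (hpath measurableSet_Icc).inter ((measurableSet_lt (m3.min m2) m1).inter
      (measurableSet_lt m1 ((m3.add_const θ).max m2)))
  exact measurable_one.indicator hset

/-- The sum over the offsets of the excesses of the schedules, up to a null set. -/
noncomputable def excessBound (hH : ∀ x, 1 ≤ H x) (oracle : ℝ → S → α) (lo hi θ : ℝ) (d : ℕ)
    (ω : Fin k → ℕ → S × I) : ℝ≥0∞ :=
  ∫⁻ p, ((d : ℝ≥0∞) - unionVisits H oracle (spanSet H lo hi θ p) lo ω) ∂(spanMeasure hH lo hi θ)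

theorem measurable_uncurry_sub_unionVisits (ho : IsGibbsOracle H lo hi ν oracle) (θ : ℝ) (d : ℕ) :
    Measurable fun x : (Fin k → ℕ → S × I) × ℝ × ℝ =>
      (d : ℝ≥0∞) - unionVisits H oracle (spanSet H lo hi θ x.2) lo x.1 :=
  measurable_const.sub (measurable_unionVisits_spanSet ho θ)

theorem measurable_excessBound (hH : ∀ x, 1 ≤ H x) (ho : IsGibbsOracle H lo hi ν oracle) (d : ℕ) :
    Measurable fun ω : Fin k → ℕ → S × I => excessBound hH oracle lo hi θ d ω :=
  (measurable_uncurry_sub_unionVisits ho θ d).lintegral_prod_right'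

/-- The majorant is measurable in `ω`, so the excess itself need not be shown measurable. -/
theorem ae_sum_excess_le (hH : ∀ x, 1 ≤ H x) (ho : IsGibbsOracle H lo hi ν oracle) (hlh : lo ≤ hi)
    (hd : 1 ≤ d) : ∀ᵐ ω ∂(unionLaw ν k),
      ∑ c : Fin d, excess H lo θ (schedule lo hi d c (tpaUnion H oracle lo hi ω)) ≤
        excessBound hH oracle lo hi θ d ω := by
  classical
  filter_upwards [ae_tpaExits_nonempty hH ho hlh] with ω hω
  refine (sum_excess_le hH hlh hd fun x hx => mem_Icc_of_mem_tpaUnion hx).trans (le_of_eq ?_)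
  refine lintegral_congr fun p => ?_
  rw [countP_tpaUnion (fun x => one_pos.trans_le (hH x)) hω fun β hβ => hβ.1]

/-- By Tonelli the runs are averaged first, for a fixed pair (t, x), which gives the Poisson deficit
of the span. The x-integral is extended to the whole line, and the remaining Stieltjes mass in t is
at most ln n. -/
theorem lintegral_excessBound_le {n : ℝ} (hH : ∀ x, H x ∈ Set.Icc 1 n)
    (ho : IsGibbsOracle H lo hi ν oracle) (hlh : lo ≤ hi) (hk : 1 ≤ k) (hθ : 0 ≤ θ) :
    ∫⁻ ω, excessBound (fun x => (hH x).1) oracle lo hi θ d ω ∂(unionLaw ν k) ≤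
      ENNReal.ofReal (d / k * (upperGamma (d + 2) (k * θ) / d.factorial)) *
        ENNReal.ofReal (Real.log n) := by
  have hH1 : ∀ x, 1 ≤ H x := fun x => (hH x).1
  have hH0 : ∀ x, 0 < H x := fun x => one_pos.trans_le (hH1 x)
  have hk0 : (0 : ℝ) < k := Nat.cast_pos.2 hk
  have hfree := (continuous_freeDiff H lo).measurable
  unfold excessBound
  rw [lintegral_lintegral_swap (measurable_uncurry_sub_unionVisits ho θ d).aemeasurable]
  have hm : Measurable fun p : ℝ × ℝ => ENNReal.ofReal (poissonDeficit d
      (k * (max (p.2 + θ) (freeDiff H lo p.1) - min p.2 (freeDiff H lo p.1)))) := by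
    have hc := (continuous_poissonDeficit d).measurable
    have m2 : Measurable fun x : ℝ × ℝ => freeDiff H lo x.1 := hfree.comp measurable_fst
    exact ENNReal.measurable_ofReal.comp (hc.comp (measurable_const.mul
      (((measurable_snd.add_const θ).max m2).sub (measurable_snd.min m2))))
  have hae : ∀ᵐ p ∂(spanMeasure hH1 lo hi θ),
      ∫⁻ ω, ((d : ℝ≥0∞) - unionVisits H oracle (spanSet H lo hi θ p) lo ω) ∂(unionLaw ν k) =
      ENNReal.ofReal (poissonDeficit d
        (k * (max (p.2 + θ) (freeDiff H lo p.1) - min p.2 (freeDiff H lo p.1)))) := by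
    rw [spanMeasure, Measure.prod_restrict]
    refine (ae_restrict_iff' (measurableSet_Ioc.prod measurableSet_Icc)).2 (ae_of_all _ ?_)
    rintro p ⟨hp1, hp2⟩
    refine lintegral_sub_unionVisits hH1 ho hlh (isFreeInterval_spanSet hH0 hp1 hp2) ?_ d
    refine le_min hp2.1 ?_
    rw [← freeDiff_self H lo]
    exact (strictMono_freeDiff hH0 lo).monotone hp1.1.le
  rw [lintegral_congr_ae hae, spanMeasure, lintegral_prod _ hm.aemeasurable]
  calc _ ≤ ∫⁻ _, ENNReal.ofReal (d / k * (upperGamma (d + 2) (k * θ) / d.factorial))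
        ∂((energyStieltjes hH1).measure.restrict (Set.Ioc lo hi)) :=
        lintegral_mono fun t => (setLIntegral_le_lintegral _ _).trans
          (lintegral_poissonDeficit_le d hk0 hθ (freeDiff H lo t))
    _ ≤ _ := by
        rw [lintegral_const, Measure.restrict_apply_univ, energyStieltjes_measure_Ioc]
        exact mul_le_mul_right (ENNReal.ofReal_le_ofReal (log_meanEnergy_sub_le hH _ _)) _

end ExpectedExcess

/-! ### The paired product estimator for a fixed schedule -/

/-- The injection `f` covers both products of the estimator: the samples of V are those of W shifted
by one. -/
theorem integral_prod_infinitePi {S : Type*} [MeasurableSpace S] (ν : Measure S)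
    [IsProbabilityMeasure ν] {φ : ℕ → S → ℝ} (hφ : ∀ i, Measurable (φ i)) {f : ℕ → ℕ}
    (hf : Function.Injective f) (L : ℕ) :
    ∫ ω, ∏ i ∈ Finset.range L, φ i (ω (f i)) ∂(Measure.infinitePi fun _ : ℕ => ν) =
      ∏ i ∈ Finset.range L, ∫ x, φ i x ∂ν := by
  have h1 : iIndepFun (fun (i : ℕ) (ω : ℕ → S) => ω i) (Measure.infinitePi fun _ : ℕ => ν) :=
    iIndepFun_infinitePi (X := fun _ x => x) fun _ => measurable_id
  have h2 : iIndepFun (fun (i : Fin L) (ω : ℕ → S) => φ i (ω (f i)))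
      (Measure.infinitePi fun _ : ℕ => ν) :=
    (h1.precomp (g := fun i : Fin L => f i) (hf.comp Fin.val_injective)).comp
      (fun i => φ i) fun i => hφ i
  have h3 := h2.integral_fun_prod_eq_prod_integral fun i =>
    ((hφ i).comp (measurable_pi_apply (f i))).aestronglyMeasurable
  rw [← Fin.prod_univ_eq_prod_range (fun i => ∫ x, φ i x ∂ν) L, ← (show _ = _ from h3.trans
    (Finset.prod_congr rfl fun i _ => ?_))]
  · exact integral_congr_ae (ae_of_all _ fun ω =>
      (Fin.prod_univ_eq_prod_range (fun i => φ i (ω (f i))) L).symm)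
  · have h4 := Measure.infinitePi_map_eval (fun _ : ℕ => ν) (f i)
    conv_rhs => rw [← h4]
    rw [integral_map (measurable_pi_apply _).aemeasurable (hφ i).aestronglyMeasurable]

/-- Chebyshev's inequality for the average of independent copies of `X`, in terms of the relative
second moment of `X`. -/
theorem measure_abs_average_sub_ge_le {Ω : Type*} [MeasurableSpace Ω] {μ : Measure Ω}
    [IsProbabilityMeasure μ] {X : Ω → ℝ} (hX : MemLp X 2 μ) {δ t : ℝ} (ht : 0 < t)
    (hpos : 0 < ∫ x, X x ∂μ) (hsq : ∫ x, X x ^ 2 ∂μ ≤ (∫ x, X x ∂μ) ^ 2 * (1 + δ)) {r : ℕ}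
    (hr : 1 ≤ r) :
    (Measure.pi fun _ : Fin r => μ)
      {η | t * ∫ x, X x ∂μ ≤ |(∑ j, X (η j)) / r - ∫ x, X x ∂μ|} ≤
      ENNReal.ofReal (δ / (r * t ^ 2)) := by
  set a := ∫ x, X x ∂μ with ha
  have hr0 : (0 : ℝ) < r := Nat.cast_pos.2 hr
  set Y : (Fin r → Ω) → ℝ := ∑ j, fun η => X (η j) with hY
  have hYj : ∀ j : Fin r, MemLp (fun η : Fin r → Ω => X (η j)) 2 (Measure.pi fun _ : Fin r => μ) :=
    fun j => hX.comp_measurePreserving (measurePreserving_eval _ j)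
  have hYL : MemLp Y 2 (Measure.pi fun _ : Fin r => μ) := memLp_finsetSum' _ fun j _ => hYj j
  have hvarX : Var[X; μ] ≤ a ^ 2 * δ := by
    rw [variance_eq_sub hX]
    simp only [Pi.pow_apply]
    linarith
  have hvar : Var[Y; Measure.pi fun _ : Fin r => μ] ≤ r * (a ^ 2 * δ) := by
    rw [hY, variance_sum_pi (X := fun _ => X) fun _ => hX, Finset.sum_const, Finset.card_univ,
      Fintype.card_fin, nsmul_eq_mul]
    exact mul_le_mul_of_nonneg_left hvarX hr0.le
  have hEY : ∫ η, Y η ∂(Measure.pi fun _ : Fin r => μ) = r * a := by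
    simp only [hY, Finset.sum_apply]
    rw [integral_finsetSum _ fun j _ => (hYj j).integrable one_le_two]
    have : ∀ j : Fin r, ∫ η : Fin r → Ω, X (η j) ∂(Measure.pi fun _ : Fin r => μ) = a := fun j => by
      rw [ha]
      conv_rhs => rw [← (measurePreserving_eval (fun _ : Fin r => μ) j).map_eq]
      rw [integral_map (measurable_pi_apply j).aemeasurable]
      · rw [(measurePreserving_eval (fun _ : Fin r => μ) j).map_eq]
        exact hX.1
    simp [this]
  have hcheb := meas_ge_le_variance_div_sq hYL (c := r * (t * a)) (by positivity)
  refine (measure_mono fun η hη => ?_).trans (hcheb.trans (ENNReal.ofReal_le_ofReal ?_))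
  · change r * (t * a) ≤ |Y η - _|
    rw [hEY]
    have h1 : Y η - r * a = r * ((∑ j, X (η j)) / r - a) := by
      simp only [hY, Finset.sum_apply]
      field_simp
    rw [h1, abs_mul, abs_of_pos hr0]
    exact mul_le_mul_of_nonneg_left hη hr0.le
  · rw [div_le_div_iff₀ (by positivity) (by positivity)]
    calc _ ≤ r * (a ^ 2 * δ) * (r * t ^ 2) := mul_le_mul_of_nonneg_right hvar (by positivity)
      _ = _ := by ring

theorem epsTilde_mem_Ioo {ε : ℝ} (hε : 0 < ε) : epsTilde ε ∈ Set.Ioo 0 1 := by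
  have h1 : (1 + ε) ^ (-(1 / 2) : ℝ) < 1 :=
    Real.rpow_lt_one_of_one_lt_of_neg (by linarith) (by norm_num)
  have h2 : 0 < (1 + ε) ^ (-(1 / 2) : ℝ) := Real.rpow_pos_of_pos (by linarith) _
  constructor <;> rw [epsTilde] <;> linarith

theorem one_sub_epsTilde_sq {ε : ℝ} (hε : 0 < ε) : (1 - epsTilde ε) ^ 2 * (1 + ε) = 1 := by
  have h : 0 < 1 + ε := by linarith
  rw [epsTilde, sub_sub_cancel, ← Real.rpow_natCast, ← Real.rpow_mul h.le]
  norm_num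
  rw [Real.rpow_neg_one, inv_mul_cancel₀ h.ne']

/-- With s = 1 - ε̃ one has 1 + ε = s⁻². The extreme relative errors of the quotient are (2 - s) / s
and its inverse, and (2 - s) s < 1. -/
theorem div_mem_Ioo_of_abs_sub_lt {ε a b x y : ℝ} (hε : 0 < ε) (ha : 0 < a) (hb : 0 < b)
    (hx : |x - a| < epsTilde ε * a) (hy : |y - b| < epsTilde ε * b) :
    x / y ∈ Set.Ioo (a / b / (1 + ε)) (a / b * (1 + ε)) := by
  obtain ⟨h0, h1⟩ := epsTilde_mem_Ioo hε
  have h2 := one_sub_epsTilde_sq hε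
  set s := 1 - epsTilde ε with hs
  have hes : epsTilde ε = 1 - s := by rw [hs]; ring
  rw [hes] at hx hy h0 h1
  have hs0 : 0 < s := by linarith
  have hs2 : (2 - s) * s < 1 := by nlinarith
  rw [abs_lt] at hx hy
  have hx1 : s * a < x := by linarith
  have hx2 : x < (2 - s) * a := by linarith
  have hy1 : s * b < y := by linarith
  have hy2 : y < (2 - s) * b := by linarith
  have hy0 : 0 < y := (mul_pos hs0 hb).trans hy1
  have hε1 : 1 + ε = 1 / s ^ 2 := by
    rw [eq_div_iff (by positivity)]
    linarith
  rw [hε1, Set.mem_Ioo]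
  constructor
  · rw [div_div_eq_mul_div, div_one, div_mul_eq_mul_div, div_lt_div_iff₀ hb hy0]
    calc a * s ^ 2 * y < a * s ^ 2 * ((2 - s) * b) := mul_lt_mul_of_pos_left hy2 (by positivity)
      _ = ((2 - s) * s) * (a * s * b) := by ring
      _ ≤ 1 * (a * s * b) := mul_le_mul_of_nonneg_right hs2.le (by positivity)
      _ = s * a * b := by ring
      _ < x * b := mul_lt_mul_of_pos_right hx1 hb
  · rw [div_mul_div_comm, mul_one, div_lt_div_iff₀ hy0 (by positivity)]
    calc x * (b * s ^ 2) < (2 - s) * a * (b * s ^ 2) := mul_lt_mul_of_pos_right hx2 (by positivity)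
      _ = ((2 - s) * s) * (a * (s * b)) := by ring
      _ ≤ 1 * (a * (s * b)) := mul_le_mul_of_nonneg_right hs2.le (by positivity)
      _ = a * (s * b) := one_mul _
      _ < a * y := mul_lt_mul_of_pos_left hy1 ha

section Estimator

variable {α S : Type*} [Fintype α] [MeasurableSpace α] [MeasurableSingletonClass α] [Nonempty α]
  [MeasurableSpace S] {ν : Measure S} [IsProbabilityMeasure ν] {H : α → ℝ} {lo hi : ℝ}
  {oracle : ℝ → S → α} {s : List ℝ}

/-- The samples that the oracle returns for the schedule `s`. -/
def scheduleSamples (oracle : ℝ → S → α) (s : List ℝ) (η : ℕ → S) : ℕ → α :=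
  fun i => oracle (s.getD i 0) (η i)

theorem measurable_exp_mul_oracle (ho : IsGibbsOracle H lo hi ν oracle) (t β : ℝ) :
    Measurable fun x => Real.exp (t * H (oracle β x)) :=
  Real.measurable_exp.comp (measurable_const.mul ((measurable_of_finite H).comp
    (ho.measurable.comp measurable_prodMk_left)))

theorem integral_exp_mul_oracle (ho : IsGibbsOracle H lo hi ν oracle) {β : ℝ}
    (hβ : β ∈ Set.Icc lo hi) (t : ℝ) :
    ∫ x, Real.exp (t * H (oracle β x)) ∂ν = partitionFn H (β - t) / partitionFn H β := by
  have h1 : ∫ x, Real.exp (t * H (oracle β x)) ∂ν = ∫ y, Real.exp (t * H y) ∂(gibbs H β) := by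
    rw [← ho.map_eq β hβ, integral_map]
    · exact (ho.measurable.comp measurable_prodMk_left).aemeasurable
    · exact (measurable_of_finite _).aestronglyMeasurable
  rw [h1, integral_gibbs, partitionFn]
  congr 1
  refine Finset.sum_congr rfl fun x _ => ?_
  rw [← Real.exp_add]
  ring_nf

/-- The product `∏_{i < L} exp(t_i H(Y_i))`, where `Y_i` is the sample number `f i`. -/
noncomputable def expProduct (H : α → ℝ) (oracle : ℝ → S → α) (s : List ℝ) (f : ℕ → ℕ) (t : ℕ → ℝ)
    (L : ℕ) (η : ℕ → S) : ℝ :=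
  ∏ i ∈ Finset.range L, Real.exp (t i * H (scheduleSamples oracle s η (f i)))

theorem measurable_expProduct (ho : IsGibbsOracle H lo hi ν oracle) (s : List ℝ) (f : ℕ → ℕ)
    (t : ℕ → ℝ) (L : ℕ) : Measurable (expProduct H oracle s f t L) :=
  Finset.measurable_fun_prod _ fun i _ =>
    (measurable_exp_mul_oracle ho (t i) (s.getD (f i) 0)).comp (measurable_pi_apply (f i))

theorem memLp_expProduct (ho : IsGibbsOracle H lo hi ν oracle) (s : List ℝ) (f : ℕ → ℕ)
    (t : ℕ → ℝ) (L : ℕ) :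
    MemLp (expProduct H oracle s f t L) 2 (Measure.infinitePi fun _ : ℕ => ν) := by
  refine MemLp.of_bound (measurable_expProduct ho s f t L).aestronglyMeasurable
    (∏ i ∈ Finset.range L, Real.exp (|t i| * ∑ x, |H x|)) (ae_of_all _ fun η => ?_)
  rw [expProduct, norm_prod]
  refine Finset.prod_le_prod (fun i _ => norm_nonneg _) fun i _ => ?_
  rw [Real.norm_eq_abs, Real.abs_exp]
  refine Real.exp_le_exp.2 ((le_abs_self _).trans ?_)
  rw [abs_mul]
  exact mul_le_mul_of_nonneg_left (Finset.single_le_sum (f := fun x => |H x|)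
    (fun x _ => abs_nonneg _) (Finset.mem_univ _)) (abs_nonneg _)

theorem integral_expProduct (ho : IsGibbsOracle H lo hi ν oracle) {f : ℕ → ℕ}
    (hf : Function.Injective f) (t : ℕ → ℝ) {L : ℕ} (hs : ∀ i < L, s.getD (f i) 0 ∈ Set.Icc lo hi) :
    ∫ η, expProduct H oracle s f t L η ∂(Measure.infinitePi fun _ : ℕ => ν) =
      ∏ i ∈ Finset.range L,
        partitionFn H (s.getD (f i) 0 - t i) / partitionFn H (s.getD (f i) 0) := by
  refine (integral_prod_infinitePi ν (φ := fun i x => Real.exp (t i * H (oracle (s.getD (f i) 0) x)))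
    (fun i => measurable_exp_mul_oracle ho _ _) hf L).trans ?_
  exact Finset.prod_congr rfl fun i hi' =>
    integral_exp_mul_oracle ho (hs i (Finset.mem_range.1 hi')) (t i)

/-- Second moments become first moments with doubled exponents. -/
theorem expProduct_sq (s : List ℝ) (f : ℕ → ℕ) (t : ℕ → ℝ) (L : ℕ) (η : ℕ → S) :
    expProduct H oracle s f t L η ^ 2 = expProduct H oracle s f (fun i => 2 * t i) L η := by
  rw [expProduct, expProduct, ← Finset.prod_pow]
  refine Finset.prod_congr rfl fun i _ => ?_
  rw [← Real.exp_nat_mul]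
  congr 1
  push_cast
  ring

theorem exp_curvature (H : α → ℝ) (lo : ℝ) (s : List ℝ) : Real.exp (curvature H lo s) =
    ∏ i ∈ Finset.range (s.length - 1),
      partitionFn H (s.getD i 0) * partitionFn H (s.getD (i + 1) 0) /
        partitionFn H ((s.getD i 0 + s.getD (i + 1) 0) / 2) ^ 2 := by
  rw [curvature, Real.exp_sum]
  refine Finset.prod_congr rfl fun i _ => ?_
  have h1 := partitionFn_pos H (s.getD i 0)
  have h2 := partitionFn_pos H (s.getD (i + 1) 0)
  have h3 := partitionFn_pos H ((s.getD i 0 + s.getD (i + 1) 0) / 2)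
  rw [← Real.exp_log (div_pos (mul_pos h1 h2) (pow_pos h3 2)), Real.log_div (mul_pos h1 h2).ne'
    (pow_pos h3 2).ne', Real.log_mul h1.ne' h2.ne', Real.log_pow]
  congr 1
  simp only [freeDiff]
  push_cast
  ring

/-- For a fixed schedule whose relative second moment is small, the paired product estimator is
accurate with probability at least `1 - γ`. -/
theorem le_measure_pairedEstimate_mem (ho : IsGibbsOracle H lo hi ν oracle)
    (hs : ∀ i < s.length, s.getD i 0 ∈ Set.Icc lo hi) (hs0 : s.getD 0 0 = lo)
    (hslast : s.getD (s.length - 1) 0 = hi) {r : ℕ} (hr : 1 ≤ r) {ε γ : ℝ} (hε : 0 < ε)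
    (hκ : Real.exp (curvature H lo s) ≤ 1 + 1 / 2 * γ * r * epsTilde ε ^ 2) :
    1 - ENNReal.ofReal γ ≤ (Measure.pi fun _ : Fin r => Measure.infinitePi fun _ : ℕ => ν)
      {η | pairedEstimate H oracle s η ∈
        Set.Ioo (ratio H lo hi / (1 + ε)) (ratio H lo hi * (1 + ε))} := by
  obtain ⟨he0, -⟩ := epsTilde_mem_Ioo hε
  set L := s.length - 1 with hL
  set μ := Measure.infinitePi fun _ : ℕ => ν with hμ
  set Z := partitionFn H with hZdef
  have hZ : ∀ x, 0 < Z x := partitionFn_pos H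
  set β : ℕ → ℝ := fun i => s.getD i 0 with hβ
  set W : (ℕ → S) → ℝ :=
    expProduct H oracle s (fun i => i) (fun i => -((β (i + 1) - β i) / 2)) L with hW
  set V : (ℕ → S) → ℝ :=
    expProduct H oracle s (fun i => i + 1) (fun i => (β (i + 1) - β i) / 2) L with hV
  have hsW : ∀ i < L, s.getD i 0 ∈ Set.Icc lo hi := fun i hi' => hs i (by omega)
  have hsV : ∀ i < L, s.getD (i + 1) 0 ∈ Set.Icc lo hi := fun i hi' => hs (i + 1) (by omega)
  have hinjV : Function.Injective fun i : ℕ => i + 1 := add_left_injective 1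
  -- Half an interval of tilt moves each parameter to the midpoint. For the squares below, the full
  -- tilt moves it to the other end of the interval.
  have hEW : ∫ η, W η ∂μ = ∏ i ∈ Finset.range L, Z ((β i + β (i + 1)) / 2) / Z (β i) := by
    refine (integral_expProduct ho Function.injective_id _ hsW).trans
      (Finset.prod_congr rfl fun i _ => ?_)
    congr 2
    simp only [hβ, id]
    ring
  have hEV : ∫ η, V η ∂μ = ∏ i ∈ Finset.range L, Z ((β i + β (i + 1)) / 2) / Z (β (i + 1)) := by
    refine (integral_expProduct ho hinjV _ hsV).trans (Finset.prod_congr rfl fun i _ => ?_)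
    congr 2
    simp only [hβ]
    ring
  have hEW2 : ∫ η, W η ^ 2 ∂μ = ∏ i ∈ Finset.range L, Z (β (i + 1)) / Z (β i) := by
    simp only [hW, expProduct_sq]
    refine (integral_expProduct ho Function.injective_id _ hsW).trans
      (Finset.prod_congr rfl fun i _ => ?_)
    congr 2
    simp only [hβ, id]
    ring
  have hEV2 : ∫ η, V η ^ 2 ∂μ = ∏ i ∈ Finset.range L, Z (β i) / Z (β (i + 1)) := by
    simp only [hV, expProduct_sq]
    refine (integral_expProduct ho hinjV _ hsV).trans (Finset.prod_congr rfl fun i _ => ?_)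
    congr 2
    simp only [hβ]
    ring
  have hEWpos : 0 < ∫ η, W η ∂μ := by
    rw [hEW]
    exact Finset.prod_pos fun i _ => div_pos (hZ _) (hZ _)
  have hEVpos : 0 < ∫ η, V η ∂μ := by
    rw [hEV]
    exact Finset.prod_pos fun i _ => div_pos (hZ _) (hZ _)
  have hW2 : ∫ η, W η ^ 2 ∂μ ≤ (∫ η, W η ∂μ) ^ 2 * (1 + 1 / 2 * γ * r * epsTilde ε ^ 2) := by
    refine le_trans (le_of_eq ?_) (mul_le_mul_of_nonneg_left hκ (sq_nonneg _))
    rw [hEW2, hEW, exp_curvature, ← Finset.prod_pow, ← Finset.prod_mul_distrib]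
    refine Finset.prod_congr rfl fun i _ => ?_
    have h1 := (hZ (β i)).ne'
    have h2 := (hZ (β (i + 1))).ne'
    have h3 := (hZ ((β i + β (i + 1)) / 2)).ne'
    change _ = _ * (Z (β i) * Z (β (i + 1)) / Z ((β i + β (i + 1)) / 2) ^ 2)
    field_simp
  have hV2 : ∫ η, V η ^ 2 ∂μ ≤ (∫ η, V η ∂μ) ^ 2 * (1 + 1 / 2 * γ * r * epsTilde ε ^ 2) := by
    refine le_trans (le_of_eq ?_) (mul_le_mul_of_nonneg_left hκ (sq_nonneg _))
    rw [hEV2, hEV, exp_curvature, ← Finset.prod_pow, ← Finset.prod_mul_distrib]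
    refine Finset.prod_congr rfl fun i _ => ?_
    have h1 := (hZ (β i)).ne'
    have h2 := (hZ (β (i + 1))).ne'
    have h3 := (hZ ((β i + β (i + 1)) / 2)).ne'
    change _ = _ * (Z (β i) * Z (β (i + 1)) / Z ((β i + β (i + 1)) / 2) ^ 2)
    field_simp
  have hratio : (∫ η, V η ∂μ) / ∫ η, W η ∂μ = ratio H lo hi := by
    rw [hEV, hEW, ← Finset.prod_div_distrib, ratio, ← hs0, ← hslast]
    change _ = Z (β 0) / Z (β L)
    have htel : ∀ N, ∏ i ∈ Finset.range N, Z (β i) / Z (β (i + 1)) = Z (β 0) / Z (β N) := by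
      intro N
      induction N with
      | zero => rw [Finset.prod_range_zero, div_self (hZ _).ne']
      | succ N ih => rw [Finset.prod_range_succ, ih, div_mul_div_cancel₀ (hZ _).ne']
    rw [← htel L]
    refine Finset.prod_congr rfl fun i _ => ?_
    have h1 := (hZ (β i)).ne'
    have h2 := (hZ (β (i + 1))).ne'
    have h3 := (hZ ((β i + β (i + 1)) / 2)).ne'
    field_simp
  have hr0 : (0 : ℝ) < r := Nat.cast_pos.2 hr
  have hδ : 1 / 2 * γ * r * epsTilde ε ^ 2 / (r * epsTilde ε ^ 2) = γ / 2 := by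
    field_simp
  have hPW := measure_abs_average_sub_ge_le (memLp_expProduct ho s _ _ L) he0 hEWpos hW2 hr
  have hPV := measure_abs_average_sub_ge_le (memLp_expProduct ho s _ _ L) he0 hEVpos hV2 hr
  rw [hδ] at hPW hPV
  set P := Measure.pi fun _ : Fin r => μ with hP
  set BW := {η : Fin r → ℕ → S |
    epsTilde ε * ∫ x, W x ∂μ ≤ |(∑ j, W (η j)) / r - ∫ x, W x ∂μ|} with hBW
  set BV := {η : Fin r → ℕ → S |
    epsTilde ε * ∫ x, V x ∂μ ≤ |(∑ j, V (η j)) / r - ∫ x, V x ∂μ|} with hBV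
  set G := {η : Fin r → ℕ → S | pairedEstimate H oracle s η ∈
    Set.Ioo (ratio H lo hi / (1 + ε)) (ratio H lo hi * (1 + ε))} with hG
  have hcover : Set.univ ⊆ G ∪ (BV ∪ BW) := by
    intro η _
    by_contra hη
    simp only [Set.mem_union, not_or] at hη
    obtain ⟨h1, h2, h3⟩ := hη
    have h4 := div_mem_Ioo_of_abs_sub_lt hε hEVpos hEWpos (not_le.1 h2) (not_le.1 h3)
    rw [hratio] at h4
    exact h1 h4
  rw [tsub_le_iff_right]
  -- `ENNReal.ofReal` is additive only on nonnegative numbers, and no sign of γ is assumed.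
  rcases le_or_gt γ 0 with hγ | hγ
  · have hz : ENNReal.ofReal (γ / 2) = 0 := ENNReal.ofReal_of_nonpos (by linarith)
    rw [hz] at hPW hPV
    calc (1 : ℝ≥0∞) = P Set.univ := measure_univ.symm
      _ ≤ P G + (P BV + P BW) := (measure_mono hcover).trans
          ((measure_union_le _ _).trans (add_le_add_right (measure_union_le _ _) _))
      _ ≤ P G + (0 + 0) := by gcongr
      _ ≤ _ := by simp
  · calc (1 : ℝ≥0∞) = P Set.univ := measure_univ.symm
      _ ≤ P G + (P BV + P BW) := (measure_mono hcover).trans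
          ((measure_union_le _ _).trans (add_le_add_right (measure_union_le _ _) _))
      _ ≤ P G + (ENNReal.ofReal (γ / 2) + ENNReal.ofReal (γ / 2)) := by gcongr
      _ = _ := by rw [← ENNReal.ofReal_add (by linarith) (by linarith), add_halves]

end Estimator

/-! ### The success probability -/

theorem upperGamma_pos (d : ℕ) {x : ℝ} (hx : 0 ≤ x) : 0 < upperGamma (d + 2) x := by
  rw [upperGamma_eq d hx, expSum]
  refine mul_pos (by positivity) (mul_pos (Real.exp_pos _) ?_)
  rw [Finset.sum_range_succ']
  refine add_pos_of_nonneg_of_pos (Finset.sum_nonneg fun j _ => by positivity) ?_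
  simp

/-- The infimum in the definition of `τ_ρ(d)` is attained. -/
theorem exists_tauRho_eq {ρ : ℝ} (hρ : ρ < 1) {d : ℕ} (hd : 1 ≤ d) :
    ∃ τ τp : ℝ, 0 ≤ τ ∧ 0 < τp ∧
      upperGamma (d + 2) (τ * d) / (τp * d * (d.factorial : ℝ)) ≤ 1 - ρ ∧
      tauRho ρ d = τ + τp := by
  have hd0 : (0 : ℝ) < d := Nat.cast_pos.2 hd
  have hf0 : (0 : ℝ) < d.factorial := Nat.cast_pos.2 d.factorial_pos
  have hρ' : 0 < 1 - ρ := sub_pos.2 hρ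
  -- For given τ the smallest admissible τ⁺ is `g τ`. The problem becomes to minimise τ + g(τ) over
  -- τ ≥ 0. Since g > 0, any τ > g(0) does worse than τ = 0, so a compact interval suffices.
  set g : ℝ → ℝ := fun τ => (d + 1).factorial * expSum (fun _ => 1) (d + 2) (τ * d) /
    ((1 - ρ) * d * d.factorial) with hg
  have hgeq : ∀ τ, 0 ≤ τ →
      g τ = upperGamma (d + 2) (τ * d) / ((1 - ρ) * d * d.factorial) := fun τ hτ => by
    rw [upperGamma_eq d (mul_nonneg hτ hd0.le)]
  have hgpos : ∀ τ, 0 ≤ τ → 0 < g τ := fun τ hτ => by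
    rw [hgeq τ hτ]
    exact div_pos (upperGamma_pos d (mul_nonneg hτ hd0.le)) (by positivity)
  have hcont : Continuous fun τ => τ + g τ := by
    have := continuous_expSum (fun _ => 1) (d + 2)
    fun_prop
  have hcond : ∀ τ τp, 0 ≤ τ → 0 < τp →
      (upperGamma (d + 2) (τ * d) / (τp * d * (d.factorial : ℝ)) ≤ 1 - ρ ↔ g τ ≤ τp) := by
    intro τ τp hτ hτp
    rw [hgeq τ hτ, div_le_iff₀ (by positivity), div_le_iff₀ (by positivity)]
    constructor <;> intro h <;> linarith
  have hne : (Set.Icc 0 (0 + g 0)).Nonempty := ⟨0, le_rfl, by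
    have := hgpos 0 le_rfl
    linarith⟩
  obtain ⟨τ, hτ, hmin⟩ := isCompact_Icc.exists_isMinOn hne hcont.continuousOn
  refine ⟨τ, g τ, hτ.1, hgpos τ hτ.1, (hcond τ _ hτ.1 (hgpos τ hτ.1)).2 le_rfl, ?_⟩
  refine IsLeast.csInf_eq ⟨⟨τ, g τ, hτ.1, hgpos τ hτ.1,
    (hcond τ _ hτ.1 (hgpos τ hτ.1)).2 le_rfl, rfl⟩, ?_⟩
  rintro t ⟨τ', τp, hτ', hτp, hle, rfl⟩
  rw [hcond τ' τp hτ' hτp] at hle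
  rcases le_or_gt τ' (0 + g 0) with h | h
  · have := hmin (show τ' ∈ Set.Icc 0 (0 + g 0) from ⟨hτ', h⟩)
    simp only [Set.mem_ofPred_eq] at this
    linarith
  · have := hmin (show (0 : ℝ) ∈ Set.Icc 0 (0 + g 0) from
      ⟨le_rfl, by have := hgpos 0 le_rfl; linarith⟩)
    simp only [Set.mem_ofPred_eq] at this
    linarith

/-- Only a lower bound for the success probability is needed, and this inequality requires no
measurability of the success event. -/
theorem lintegral_measure_section_le_prod {X Y : Type*} [MeasurableSpace X] [MeasurableSpace Y]
    (μ : Measure X) (ν : Measure Y) [SFinite ν] (s : Set (X × Y)) :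
    ∫⁻ x, ν (Prod.mk x ⁻¹' s) ∂μ ≤ (μ.prod ν) s := by
  rw [← measure_toMeasurable s, Measure.prod_apply (measurableSet_toMeasurable _ _)]
  exact lintegral_mono fun x => measure_mono (Set.preimage_mono (subset_toMeasurable _ _))

section Success

variable {α S : Type*} [Fintype α] [MeasurableSpace α] [MeasurableSingletonClass α] [Nonempty α]
  [MeasurableSpace S] {ν : Measure S} [IsProbabilityMeasure ν] {H : α → ℝ} {n lo hi : ℝ}
  {oracle : ℝ → S → α} {k d r : ℕ}

-- Markov's inequality over the indices: at least `card - (∑ f) / T` of them have `f i ≤ T`. The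
-- value T = 0, which occurs when n = 1, is allowed.
open Classical in
theorem mul_sub_sum_div_le {ι : Type*} (s : Finset ι) (f : ι → ℝ≥0∞) {g T : ℝ≥0∞} (hT : T ≠ ∞)
    {P : ι → ℝ≥0∞} (hP : ∀ i ∈ s, f i ≤ T → g ≤ P i) :
    g * (s.card - (∑ i ∈ s, f i) / T) ≤ ∑ i ∈ s, P i := by
  have h1 : (s.card : ℝ≥0∞) ≤ ∑ i ∈ s, (if f i ≤ T then 1 else 0) + (∑ i ∈ s, f i) / T := by
    rw [div_eq_mul_inv, Finset.sum_mul, ← Finset.sum_add_distrib, Finset.card_eq_sum_ones,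
      Nat.cast_sum]
    refine Finset.sum_le_sum fun i _ => ?_
    split_ifs with h
    · simp
    · have h0 : f i ≠ 0 := fun h' => h (by rw [h']; exact zero_le)
      rw [Nat.cast_one, zero_add, ← div_eq_mul_inv, ENNReal.le_div_iff_mul_le (Or.inr h0) (Or.inl hT),
        one_mul]
      exact (not_le.1 h).le
  calc g * (s.card - (∑ i ∈ s, f i) / T) ≤ g * ∑ i ∈ s, (if f i ≤ T then 1 else 0) := by
        gcongr
        exact tsub_le_iff_right.2 h1
    _ ≤ ∑ i ∈ s, P i := by
        rw [Finset.mul_sum]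
        refine Finset.sum_le_sum fun i hi => ?_
        split_ifs with h
        · rw [mul_one]
          exact hP i hi h
        · rw [mul_zero]
          exact zero_le

/-- The runs and the offset make the excess small with probability at least ρ, by Markov's
inequality. For each such schedule the independent samples of the estimator succeed with probability
at least 1 - γ. -/
theorem succeeds_of_paramCondition (hH : ∀ x, H x ∈ Set.Icc 1 n) (hlh : lo ≤ hi)
    (ho : IsGibbsOracle H lo hi ν oracle) (hk : 1 ≤ k) (hd : 1 ≤ d) (hr : 1 ≤ r) {m : ℝ}
    (hkm : (k : ℝ) = m * d) {ε : ℝ} (hε : 0 < ε) (hpar : ParamCondition n ε m d r) :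
    Succeeds H lo hi ν oracle k d r ε := by
  have hH1 : ∀ x, 1 ≤ H x := fun x => (hH x).1
  have hd0 : (0 : ℝ) < d := Nat.cast_pos.2 hd
  have hk0 : (0 : ℝ) < k := Nat.cast_pos.2 hk
  have hr0 : (0 : ℝ) < r := Nat.cast_pos.2 hr
  have hm : 0 < m := by
    by_contra h
    have := mul_nonpos_of_nonpos_of_nonneg (not_lt.1 h) hd0.le
    linarith
  obtain ⟨he0, -⟩ := epsTilde_mem_Ioo hε
  have hn : 1 ≤ n := by
    obtain ⟨x⟩ := ‹Nonempty α›
    exact (hH x).1.trans (hH x).2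
  have hlogn := Real.log_nonneg hn
  obtain ⟨γ, ⟨hγ0, hγ1⟩, hcond⟩ := hpar
  set ρ : ℝ := (3 / 4) / (1 - γ) with hρdef
  have hγ : 0 < 1 - γ := by linarith
  have hρ1 : ρ < 1 := by
    rw [hρdef, div_lt_one hγ]
    linarith
  have hρ0 : 0 < ρ := by positivity
  obtain ⟨τ, τp, hτ, hτp, hΓ, htau⟩ := exists_tauRho_eq hρ1 hd
  rw [htau] at hcond
  set x := 1 / 2 * γ * r * epsTilde ε ^ 2 with hx
  have hx0 : 0 < x := by positivity
  have hK : 0 < Real.log (1 + x) := Real.log_pos (by linarith)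
  rw [div_le_iff₀ (by positivity)] at hcond
  -- This θ makes k θ = τ d, the argument of the gamma function in the constraint. With T = τ⁺ ln n
  -- / m below, the bound on the curvature is (τ + τ⁺) ln n / (2m), which the parameter condition
  -- compares with ln(1 + x).
  set θ := τ / m with hθ
  have hθ0 : 0 ≤ θ := by positivity
  set T := τp * Real.log n / m with hT
  have hT0 : 0 ≤ T := by positivity
  have hkθ : k * θ = τ * d := by
    rw [hkm, hθ]
    field_simp
  have hTK : (θ * Real.log n + T) / 2 ≤ Real.log (1 + x) := by
    have : (θ * Real.log n + T) / 2 = (τ + τp) * Real.log n / (2 * m) := by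
      rw [hθ, hT]
      field_simp
    rw [this, div_le_iff₀ (by positivity)]
    linarith
  set estLaw := Measure.pi fun _ : Fin r => Measure.infinitePi fun _ : ℕ => ν with hest
  set g : ℝ≥0∞ := 1 - ENNReal.ofReal γ with hg
  set E := excessBound (k := k) hH1 oracle lo hi θ d with hE
  set good : Set (Randomness S k d r) := {ω | algEstimate H oracle lo hi ω ∈
    Set.Ioo (ratio H lo hi / (1 + ε)) (ratio H lo hi * (1 + ε))} with hgood
  have hfix : ∀ ω : Fin k → ℕ → S × I, ∀ c : Fin d,
      excess H lo θ (schedule lo hi d c (tpaUnion H oracle lo hi ω)) ≤ ENNReal.ofReal T →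
      g ≤ estLaw (Prod.mk c ⁻¹' (Prod.mk ω ⁻¹' good)) := by
    intro ω c hex
    have hU : ∀ x ∈ tpaUnion H oracle lo hi ω, x ∈ Set.Icc lo hi := fun x hx =>
      mem_Icc_of_mem_tpaUnion hx
    refine le_measure_pairedEstimate_mem ho (s := schedule lo hi d c (tpaUnion H oracle lo hi ω))
      (fun i hi' => schedule_getD_mem_Icc hlh hU hi') schedule_getD_zero schedule_getD_last hr hε ?_
    have h1 := curvature_le hH lo (pairwise_schedule hlh d c hU) hθ0 hT0 hex
    rw [← Real.le_log_iff_exp_le (by linarith)]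
    exact h1.trans hTK
  have hdE : (d : ℝ≥0∞) ≠ 0 := Nat.cast_ne_zero.2 (by omega)
  have hdT : (d : ℝ≥0∞) ≠ ∞ := ENNReal.natCast_ne_top d
  have hω : ∀ᵐ ω ∂(unionLaw ν k), g * (1 - E ω / (ENNReal.ofReal T * d)) ≤
      ((uniformOn (Set.univ : Set (Fin d))).prod estLaw) (Prod.mk ω ⁻¹' good) := by
    filter_upwards [ae_sum_excess_le (θ := θ) hH1 ho hlh hd] with ω hω
    refine le_trans ?_ (lintegral_measure_section_le_prod _ _ _)
    rw [lintegral_uniformOn_univ]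
    have h1 := mul_sub_sum_div_le Finset.univ
      (fun c : Fin d => excess H lo θ (schedule lo hi d c (tpaUnion H oracle lo hi ω)))
      ENNReal.ofReal_ne_top (P := fun c => estLaw (Prod.mk c ⁻¹' (Prod.mk ω ⁻¹' good)))
      fun c _ => hfix ω c
    rw [Finset.card_univ, Fintype.card_fin] at h1
    rw [ENNReal.le_div_iff_mul_le (Or.inl hdE) (Or.inl hdT)]
    refine le_trans ?_ h1
    rw [mul_assoc]
    gcongr
    rw [ENNReal.sub_mul fun _ _ => hdT, one_mul]
    refine tsub_le_tsub_left ((ENNReal.div_le_div_right hω _).trans (le_of_eq ?_)) _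
    rw [div_eq_mul_inv, div_eq_mul_inv, ENNReal.mul_inv (Or.inr hdT) (Or.inr hdE), mul_assoc,
      mul_assoc, ENNReal.inv_mul_cancel hdE hdT, mul_one]
  have hEint : ∫⁻ ω, E ω ∂(unionLaw ν k) ≤ ENNReal.ofReal (1 - ρ) * (ENNReal.ofReal T * d) := by
    refine (lintegral_excessBound_le hH ho hlh hk hθ0).trans ?_
    rw [hkθ, ← ENNReal.ofReal_natCast d, ← ENNReal.ofReal_mul hT0,
      ← ENNReal.ofReal_mul
        (by have := upperGamma_pos d (mul_nonneg hτ hd0.le); positivity),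
      ← ENNReal.ofReal_mul (by linarith)]
    refine ENNReal.ofReal_le_ofReal ?_
    have hf0 : (0 : ℝ) < d.factorial := Nat.cast_pos.2 d.factorial_pos
    rw [div_le_iff₀ (by positivity)] at hΓ
    have h2 : upperGamma (d + 2) (τ * d) / d.factorial ≤ (1 - ρ) * (τp * d) := by
      rw [div_le_iff₀ hf0]
      linarith
    calc (d : ℝ) / k * (upperGamma (d + 2) (τ * d) / d.factorial) * Real.log n ≤
          d / k * ((1 - ρ) * (τp * d)) * Real.log n := by gcongr
      _ = (1 - ρ) * (T * d) := by
          rw [hkm, hT]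
          field_simp
  have hEm : Measurable E := measurable_excessBound hH1 ho d
  unfold Succeeds
  rw [law]
  refine le_trans ?_ (lintegral_measure_section_le_prod _ _ _)
  refine le_trans ?_ (lintegral_mono_ae hω)
  have hEm' : Measurable fun ω => 1 - E ω / (ENNReal.ofReal T * d) :=
    measurable_const.sub (hEm.div_const _)
  rw [lintegral_const_mul _ hEm']
  have h3 : 1 - ENNReal.ofReal (1 - ρ) ≤
      ∫⁻ ω, (1 - E ω / (ENNReal.ofReal T * d)) ∂(unionLaw ν k) := by
    refine le_trans ?_ (lintegral_sub_le _ _ (hEm.div_const _))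
    rw [lintegral_one, measure_univ]
    refine tsub_le_tsub_left ?_ _
    simp_rw [div_eq_mul_inv]
    rw [lintegral_mul_const _ hEm, ← div_eq_mul_inv]
    exact ENNReal.div_le_of_le_mul hEint
  refine le_trans (le_of_eq ?_) (mul_le_mul_right h3 g)
  rw [hg, ← ENNReal.ofReal_one, ← ENNReal.ofReal_sub _ hγ0.le, ← ENNReal.ofReal_sub _ (by linarith),
    ← ENNReal.ofReal_mul hγ.le, sub_sub_cancel, hρdef, mul_div_cancel₀ _ hγ.ne']

end Success

/-! ### Explicit values of the parameters -/

/-- The choice γ = 6/25, τ = 3/2, τ⁺ = 9/200. Here 1 - ρ = 1/76, and after cancelling 64! the claim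
is 65 e^(-96) ∑_{j<66} 96^j / j! ≤ (9/200) · 64 / 76, which holds with e replaced by 2.718. -/
theorem upperGamma_66_96_le :
    upperGamma ((64 : ℕ) + 2) (3 / 2 * (64 : ℕ)) / (9 / 200 * (64 : ℕ) * ((64 : ℕ).factorial : ℝ)) ≤
      1 - 3 / 4 / (1 - 6 / 25) := by
  have hf : (0 : ℝ) < (64 : ℕ).factorial := Nat.cast_pos.2 (Nat.factorial_pos _)
  rw [upperGamma_eq 64 (by norm_num), Nat.factorial_succ, div_le_iff₀ (by positivity), expSum]
  have he : Real.exp (-(3 / 2 * (64 : ℕ))) ≤ ((2.718 : ℝ) ^ 96)⁻¹ := by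
    rw [Real.exp_neg]
    refine inv_anti₀ (by norm_num) ?_
    have h : Real.exp (3 / 2 * (64 : ℕ)) = Real.exp 1 ^ 96 := by
      rw [← Real.exp_nat_mul]
      norm_num
    rw [h]
    exact pow_le_pow_left₀ (by norm_num) (Real.exp_one_gt_d9.le.trans' (by norm_num)) _
  have hs : ∑ j ∈ Finset.range (64 + 2), (1 : ℝ) * ((3 / 2 * (64 : ℕ)) ^ j / j.factorial) ≤
      9 / 200 * 64 / 65 / 76 * 2.718 ^ 96 := by
    norm_num [Finset.sum_range_succ, Nat.factorial]
  have hes := (mul_le_mul he hs (Finset.sum_nonneg fun j _ => by positivity)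
    (by positivity)).trans_eq (b := ((2.718 : ℝ) ^ 96)⁻¹ * _)
    (by rw [mul_comm, mul_assoc, mul_inv_cancel₀ (by positivity), mul_one])
  rw [Nat.cast_mul, mul_right_comm]
  refine (mul_le_mul_of_nonneg_right (mul_le_mul_of_nonneg_left hes (Nat.cast_nonneg _))
    hf.le).trans (le_of_eq ?_)
  generalize ((64 : ℕ).factorial : ℝ) = f
  push_cast
  ring

theorem tauRho_64_le : tauRho (3 / 4 / (1 - 6 / 25)) 64 ≤ 309 / 200 := by
  refine csInf_le ⟨0, ?_⟩ ⟨3 / 2, 9 / 200, by norm_num, by norm_num, upperGamma_66_96_le,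
    by norm_num⟩
  rintro t ⟨τ, τp, hτ, hτp, -, rfl⟩
  positivity

/-- Equivalent to 1.24^93 ≥ e^20. The fraction is accurate enough for the constant 3.6, since
(309/200) · 93 / 40 < 3.6. -/
theorem log_1_24_ge : 20 / 93 ≤ Real.log (1.24 : ℝ) := by
  have h : (20 : ℝ) ≤ 93 * Real.log 1.24 := by
    have h0 : 93 * Real.log 1.24 = Real.log (1.24 ^ 93) := by
      rw [Real.log_pow]
      norm_num
    rw [h0, Real.le_log_iff_exp_le (by norm_num)]
    have h1 : Real.exp 20 = Real.exp 1 ^ 20 := by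
      rw [← Real.exp_nat_mul]
      norm_num
    rw [h1]
    refine (pow_le_pow_left₀ (Real.exp_pos 1).le Real.exp_one_lt_d9.le 20).trans ?_
    norm_num
  linarith

/-- The choice of r gives r ε̃² ≥ 2, so the argument of the logarithm is at least 1 + γ = 1.24. -/
theorem paramCondition_64 {n ε m : ℝ} (hn : 1 ≤ n) (hε : 0 < ε) (hm : 3.6 * Real.log n ≤ m) :
    ParamCondition n ε m 64 ⌈2 / epsTilde ε ^ 2⌉₊ := by
  obtain ⟨he, -⟩ := epsTilde_mem_Ioo hε
  refine ⟨6 / 25, ⟨by norm_num, by norm_num⟩, ?_⟩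
  have hr : 2 ≤ (⌈2 / epsTilde ε ^ 2⌉₊ : ℝ) * epsTilde ε ^ 2 := by
    rw [← div_le_iff₀ (by positivity)]
    exact Nat.le_ceil _
  have hlog : 20 / 93 ≤
      Real.log (1 + 1 / 2 * (6 / 25) * ⌈2 / epsTilde ε ^ 2⌉₊ * epsTilde ε ^ 2) :=
    log_1_24_ge.trans (Real.log_le_log (by norm_num) (by linarith))
  have hn0 := Real.log_nonneg hn
  rw [div_le_iff₀ (by linarith)]
  calc tauRho (3 / 4 / (1 - 6 / 25)) 64 * Real.log n ≤ 309 / 200 * Real.log n := by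
        gcongr
        exact tauRho_64_le
    _ ≤ 3.6 * Real.log n * (2 * (20 / 93)) := by linarith
    _ ≤ _ := by
        have hm0 : 0 ≤ m := hm.trans' (by positivity)
        gcongr

/-! ### Small relative errors -/

/-- With t = 1 - ε̃ one has ε = (1 - t²) / t² and ε̃ - ε/2 = -(1 - t)² (2t + 1) / (2t²). Dividing by
ε² leaves a factor bounded for 0 < t < 1. -/
theorem isBigO_epsTilde_sub :
    (fun ε : ℝ => epsTilde ε - ε / 2) =O[𝓝[>] 0] fun ε => ε ^ 2 := by
  refine IsBigO.of_bound (3 / 2) ?_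
  filter_upwards [self_mem_nhdsWithin] with ε hε
  obtain ⟨h0, h1⟩ := epsTilde_mem_Ioo hε
  have h2 := one_sub_epsTilde_sq hε
  set t := 1 - epsTilde ε with ht
  have het : epsTilde ε = 1 - t := by rw [ht]; ring
  rw [het] at h0 h1 ⊢
  have ht0 : 0 < t := by linarith
  have hεt : ε = (1 - t) * (1 + t) / t ^ 2 := by
    field_simp
    linarith
  have hd : 1 - t - ε / 2 = -((1 - t) ^ 2 * (2 * t + 1) / (2 * t ^ 2)) := by
    rw [hεt]
    field_simp
    ring
  rw [Real.norm_eq_abs, Real.norm_eq_abs, hd, abs_neg, abs_of_nonneg (by positivity),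
    abs_of_nonneg (by positivity), hεt, div_le_iff₀ (by positivity)]
  have : 3 / 2 * ((1 - t) * (1 + t) / t ^ 2) ^ 2 * (2 * t ^ 2) =
      (1 - t) ^ 2 * (3 * (1 + t) ^ 2 / t ^ 2) := by
    field_simp
  rw [this]
  gcongr
  rw [le_div_iff₀ (by positivity)]
  nlinarith [sq_nonneg t, mul_pos ht0 ht0]

theorem div_epsTilde_sq_mul {ε : ℝ} (hε : 0 < ε) :
    2 / epsTilde ε ^ 2 * ε ^ 2 = 2 * (2 - epsTilde ε) ^ 2 / (1 - epsTilde ε) ^ 4 := by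
  obtain ⟨h0, h1⟩ := epsTilde_mem_Ioo hε
  have h2 := one_sub_epsTilde_sq hε
  have ht : 0 < 1 - epsTilde ε := by linarith
  have hεt : ε = epsTilde ε * (2 - epsTilde ε) / (1 - epsTilde ε) ^ 2 := by
    rw [eq_div_iff (by positivity)]
    linarith
  generalize epsTilde ε = e at *
  rw [hεt]
  field_simp

theorem tendsto_ceil_mul_sq :
    Tendsto (fun ε : ℝ => (⌈2 / epsTilde ε ^ 2⌉₊ : ℝ) * ε ^ 2) (𝓝[>] 0) (𝓝 8) := by
  have he : Tendsto epsTilde (𝓝[>] 0) (𝓝 0) := by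
    have h : ContinuousAt epsTilde 0 := by
      unfold epsTilde
      exact continuousAt_const.sub
        ((continuousAt_const.add continuousAt_id).rpow_const (Or.inl (by norm_num)))
    have h0 : epsTilde 0 = 0 := by simp [epsTilde]
    have := h.tendsto
    rw [h0] at this
    exact this.mono_left nhdsWithin_le_nhds
  have hy : Tendsto (fun ε : ℝ => 2 / epsTilde ε ^ 2 * ε ^ 2) (𝓝[>] 0) (𝓝 8) := by
    have h : Tendsto (fun ε => 2 * (2 - epsTilde ε) ^ 2 / (1 - epsTilde ε) ^ 4) (𝓝[>] 0)
        (𝓝 (2 * (2 - 0) ^ 2 / (1 - 0) ^ 4)) :=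
      (((tendsto_const_nhds.sub he).pow 2).const_mul 2).div ((tendsto_const_nhds.sub he).pow 4)
        (by norm_num)
    norm_num at h
    refine h.congr' ?_
    filter_upwards [self_mem_nhdsWithin] with ε hε
    exact (div_epsTilde_sq_mul hε).symm
  have hsq : Tendsto (fun ε : ℝ => ε ^ 2) (𝓝[>] 0) (𝓝 0) := by
    have : Tendsto (fun ε : ℝ => ε ^ 2) (𝓝 0) (𝓝 (0 ^ 2)) := (continuous_pow 2).tendsto 0
    rw [zero_pow two_ne_zero] at this
    exact this.mono_left nhdsWithin_le_nhds
  -- Rounding up costs at most 1, hence at most ε² after multiplication.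
  have hy' := hy.add hsq
  rw [add_zero] at hy'
  refine tendsto_of_tendsto_of_tendsto_of_le_of_le hy hy' (fun ε => ?_) fun ε => ?_
  · exact mul_le_mul_of_nonneg_right (Nat.le_ceil _) (sq_nonneg ε)
  · have := (Nat.ceil_lt_add_one (show 0 ≤ 2 / epsTilde ε ^ 2 by positivity)).le
    simpa only [add_mul, one_mul] using mul_le_mul_of_nonneg_right this (sq_nonneg ε)

/-! ### The number of oracle calls with the explicit values -/

/-- In `div_epsTilde_sq_mul` the numerator is at most 8 and (1 - ε̃)⁻⁴ = (1 + ε)². The term ε₀² pays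
for rounding up. -/
theorem ceil_le_div_sq {ε ε₀ : ℝ} (hε : 0 < ε) (hεε : ε ≤ ε₀) :
    (⌈2 / epsTilde ε ^ 2⌉₊ : ℝ) ≤ (8 * (1 + ε₀) ^ 2 + ε₀ ^ 2) / ε ^ 2 := by
  rw [le_div_iff₀ (by positivity)]
  have h := mul_le_mul_of_nonneg_right
    (Nat.ceil_lt_add_one (show 0 ≤ 2 / epsTilde ε ^ 2 by positivity)).le (sq_nonneg ε)
  rw [add_mul, one_mul, div_epsTilde_sq_mul hε] at h
  refine h.trans (add_le_add ?_ (by gcongr))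
  obtain ⟨h0, h1⟩ := epsTilde_mem_Ioo hε
  have h2 := one_sub_epsTilde_sq hε
  have ht : 0 < 1 - epsTilde ε := by linarith
  have hεt : (1 + ε) ^ 2 = 1 / (1 - epsTilde ε) ^ 4 := by
    rw [eq_div_iff (by positivity)]
    calc _ = ((1 - epsTilde ε) ^ 2 * (1 + ε)) ^ 2 := by ring
      _ = 1 := by rw [h2, one_pow]
  calc 2 * (2 - epsTilde ε) ^ 2 / (1 - epsTilde ε) ^ 4 ≤ 2 * 2 ^ 2 / (1 - epsTilde ε) ^ 4 := by
        gcongr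
        · linarith
        · linarith
    _ = 8 * (1 + ε) ^ 2 := by rw [hεt]; ring
    _ ≤ 8 * (1 + ε₀) ^ 2 := by gcongr

/-- Each term is compared with q L / ε² by inserting those of the factors q / q₀, q L / (q₀ L₀) and
ε₀² / ε², all at least 1, that it lacks. -/
theorem calls_le {q₀ L₀ ε₀ A q L ε m r B : ℝ} (hq₀ : 0 < q₀) (hL₀ : 0 < L₀) (hA : 0 < A)
    (hε : 0 < ε) (hB : 0 < B) (hq : q₀ ≤ q) (hL : L₀ ≤ L) (hεε : ε ≤ ε₀) (hm : m ≤ A * L)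
    (hr0 : 0 ≤ r) (hr : r ≤ B / ε ^ 2) :
    m * q * (r + 64) + 2 * r + m * 64 ≤
      (A * (B + 64 * ε₀ ^ 2) + 2 * B / (q₀ * L₀) + 64 * A * ε₀ ^ 2 / q₀) * (q * L / ε ^ 2) := by
  have hq0 : 0 < q := hq₀.trans_le hq
  have hL0 : 0 < L := hL₀.trans_le hL
  have hone : 1 ≤ ε₀ ^ 2 / ε ^ 2 := (one_le_div (by positivity)).2 (by gcongr)
  have hq1 : 1 ≤ q / q₀ := (one_le_div hq₀).2 hq
  have hqL : 1 ≤ q * L / (q₀ * L₀) := (one_le_div (by positivity)).2 (by gcongr)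
  have h1 : m * q * (r + 64) ≤ A * L * q * (B / ε ^ 2 + 64 * (ε₀ ^ 2 / ε ^ 2)) := by
    gcongr
    linarith
  have h2 : 2 * r ≤ 2 * (B / ε ^ 2) * (q * L / (q₀ * L₀)) :=
    (mul_le_mul_of_nonneg_left hr zero_le_two).trans (le_mul_of_one_le_right (by positivity) hqL)
  have h3 : m * 64 ≤ A * L * 64 * (q / q₀ * (ε₀ ^ 2 / ε ^ 2)) := by
    refine (mul_le_mul_of_nonneg_right hm (by norm_num)).trans
      (le_mul_of_one_le_right (by positivity) ?_)
    exact one_le_mul_of_one_le_of_one_le hq1 hone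
  refine (add_le_add (add_le_add h1 h2) h3).trans (le_of_eq ?_)
  field_simp

end GibbsTPA

theorem mainTheorem1 :
    -- success probability and expected number of oracle calls
    (∀ (α : Type*) [Fintype α] [Nonempty α] [MeasurableSpace α] [MeasurableSingletonClass α]
      (S : Type*) [MeasurableSpace S] (ν : Measure S) [IsProbabilityMeasure ν]
      (H : α → ℝ) (n lo hi : ℝ) (oracle : ℝ → S → α) (k d r : ℕ) (m : ℝ),
      (∀ x, H x ∈ Set.Icc 1 n) → lo < hi → GibbsTPA.IsGibbsOracle H lo hi ν oracle →
      1 ≤ k → 1 ≤ d → 1 ≤ r → (k : ℝ) = m * d →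
      (∀ ε : ℝ, 0 < ε → GibbsTPA.ParamCondition n ε m d r →
        GibbsTPA.Succeeds H lo hi ν oracle k d r ε) ∧
      ∫⁻ ω, GibbsTPA.algCalls H oracle lo hi ω ∂(GibbsTPA.law ν k d r) =
        ENNReal.ofReal (m * GibbsTPA.logRatio H lo hi * (r + d) + 2 * r + k) ∧
      ∫⁻ ω, GibbsTPA.algCallsMerged H oracle lo hi ω ∂(GibbsTPA.law ν k d r) =
        ENNReal.ofReal (m * GibbsTPA.logRatio H lo hi * (r + d) + 2 * r + 1)) ∧
    -- the example values of the parameters satisfy the condition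
    (∀ n ε m : ℝ, 1 ≤ n → 0 < ε → 3.6 * Real.log n ≤ m →
      GibbsTPA.ParamCondition n ε m 64 ⌈2 / GibbsTPA.epsTilde ε ^ 2⌉₊) ∧
    -- asymptotics of `ε̃` and of the number of repetitions as `ε → 0+`
    ((fun ε : ℝ => GibbsTPA.epsTilde ε - ε / 2) =O[𝓝[>] 0] fun ε => ε ^ 2) ∧
    Tendsto (fun ε : ℝ => (⌈2 / GibbsTPA.epsTilde ε ^ 2⌉₊ : ℝ) * ε ^ 2) (𝓝[>] 0) (𝓝 8) ∧
    -- with the example values, `O(q ln n / ε²)` oracle calls suffice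
    (∀ q₀ n₀ ε₀ A : ℝ, 0 < q₀ → 1 < n₀ → 0 < ε₀ → 0 < A → ∃ C : ℝ, 0 < C ∧
      ∀ (α : Type*) [Fintype α] [Nonempty α] [MeasurableSpace α] [MeasurableSingletonClass α]
        (S : Type*) [MeasurableSpace S] (ν : Measure S) [IsProbabilityMeasure ν]
        (H : α → ℝ) (n lo hi : ℝ) (oracle : ℝ → S → α) (k : ℕ) (m ε : ℝ),
        (∀ x, H x ∈ Set.Icc 1 n) → lo < hi → GibbsTPA.IsGibbsOracle H lo hi ν oracle →
        1 ≤ k → (k : ℝ) = m * 64 → 3.6 * Real.log n ≤ m → m ≤ A * Real.log n →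
        q₀ ≤ GibbsTPA.logRatio H lo hi → n₀ ≤ n → 0 < ε → ε ≤ ε₀ →
        GibbsTPA.Succeeds H lo hi ν oracle k 64 ⌈2 / GibbsTPA.epsTilde ε ^ 2⌉₊ ε ∧
        ∫⁻ ω, GibbsTPA.algCalls H oracle lo hi ω
            ∂(GibbsTPA.law ν k 64 ⌈2 / GibbsTPA.epsTilde ε ^ 2⌉₊) ≤
          ENNReal.ofReal (C * (GibbsTPA.logRatio H lo hi * Real.log n / ε ^ 2))) := by
  refine ⟨?_, fun n ε m hn hε hm => GibbsTPA.paramCondition_64 hn hε hm,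
    GibbsTPA.isBigO_epsTilde_sub, GibbsTPA.tendsto_ceil_mul_sq, ?_⟩
  · intro α _ _ _ _ S _ ν _ H n lo hi oracle k d r m hH hlh ho hk hd hr hkm
    exact ⟨fun ε hε hpar =>
        GibbsTPA.succeeds_of_paramCondition hH hlh.le ho hk hd hr hkm hε hpar,
      GibbsTPA.lintegral_algCalls (fun x => (hH x).1) ho hlh.le hd hkm,
      GibbsTPA.lintegral_algCallsMerged (fun x => (hH x).1) ho hlh.le hd hkm⟩
  · intro q₀ n₀ ε₀ A hq₀ hn₀ hε₀ hA
    have hL₀ := Real.log_pos hn₀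
    refine ⟨A * ((8 * (1 + ε₀) ^ 2 + ε₀ ^ 2) + 64 * ε₀ ^ 2) +
      2 * (8 * (1 + ε₀) ^ 2 + ε₀ ^ 2) / (q₀ * Real.log n₀) + 64 * A * ε₀ ^ 2 / q₀,
      by positivity, ?_⟩
    intro α _ _ _ _ S _ ν _ H n lo hi oracle k m ε hH hlh ho hk hkm hm hmA hq hn hε hεε
    obtain ⟨he, -⟩ := GibbsTPA.epsTilde_mem_Ioo hε
    have hkm' : (k : ℝ) = m * (64 : ℕ) := by
      rw [hkm]
      norm_num
    constructor
    · exact GibbsTPA.succeeds_of_paramCondition hH hlh.le ho hk (by norm_num)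
        (Nat.ceil_pos.2 (by positivity)) hkm' hε
        (GibbsTPA.paramCondition_64 (hn₀.le.trans hn) hε hm)
    · rw [GibbsTPA.lintegral_algCalls (fun x => (hH x).1) ho hlh.le (by norm_num) hkm', hkm]
      refine ENNReal.ofReal_le_ofReal ?_
      push_cast
      exact GibbsTPA.calls_le hq₀ hL₀ hA hε (by positivity) hq
        (Real.log_le_log (by linarith) hn) hεε hmA (Nat.cast_nonneg _)
        (GibbsTPA.ceil_le_div_sq hε hεε)
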